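/- Let $B_n$ be the braid group on $n$ strands with Artin generators $\sigma_1,\dots,\sigma_{n-1}$, and let $\Delta^2=(\sigma_1\sigma_2\cdots\sigma_{n-1})^n$ be the positive full twist. A knot $K\subset S^3$ is called twist positive on $n$ strands if it is the closure of a braid $\beta\in B_n$ of the form $\beta=\Delta^2\gamma$, where $\gamma$ is a positive braid, i.e. a product of the generators $\sigma_i$ (no inverses; the empty product is allowed). The Alexander polynomial $\Delta_K(t)$, which is defined up to multiplication by $\pm t^k$, is normalized so that $\Delta_K(t)\in\mathbb Z[t]$, $\Delta_K(0)\neq 0$ and $\Delta_K(1)=1$. The braid index of $K$ is the least $m$ such that $K$ is the closure of a braid on $m$ strands. Suppose that the knot $K$ is twist positive on $n$ strands. Then there is a polynomial $R(t)\in\mathbb Z[t]$ with $$\Delta_K(t) = 1 - t + t^n + t^{n+1}R(t).$$ In particular, if $n\ge 2$, then the braid index of $K$ appears as an exponent in $\Delta_K(t)$: the coefficient of $t^{b}$ in $\Delta_K(t)$, where $b$ is the braid index of $K$, is non-zero. -/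

import Mathlib

open Polynomial LaurentPolynomial

noncomputable section

/-! ## Oriented link diagrams

An oriented link diagram in the plane, in general position with respect to the height function, is
recorded by the list of its critical levels, read from bottom to top: local minima, local maxima
and crossings.  Just above or below such a level the diagram meets a horizontal line in finitely
many strands, numbered `0, 1, 2, …` from left to right. -/

/-- An elementary piece of a diagram.
* `cup b`: a local minimum; the left one of the two new strands points upwards iff `b = true`;
* `cap`: a local maximum;
* `cross e`: a crossing of two neighbouring strands; for `e = true` the strand from bottom left to
  top right is the overpass, for `e = false` the strand from bottom right to top left is.
  (If both strands point upwards, `cross true` is a positive crossing.) -/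
inductive Piece : Type
  | cup (b : Bool)
  | cap
  | cross (e : Bool)

/-- Number of strands entering a piece from below. -/
def Piece.inputs : Piece → ℕ
  | .cup _ => 0
  | .cap => 2
  | .cross _ => 2

/-- Number of strands leaving a piece at the top. -/
def Piece.outputs : Piece → ℕ
  | .cup _ => 2
  | .cap => 0
  | .cross _ => 2

/-- A critical level: a piece with exactly `pos` strands passing to its left. -/
structure Slice : Type where
  piece : Piece
  pos : ℕ

/-- The relators of the Wirtinger presentation; arcs are denoted by natural numbers.
* `crossing o l r`: an overpass `o` with the arc `l` on its left and the arc `r` on its right (with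
  respect to the orientation of `o`) of the strand passing below it;
* `join a b`: the arcs `a` and `b` meet at a local maximum. -/
inductive Relator : Type
  | crossing (o l r : ℕ)
  | join (a b : ℕ)

/-- What is known about a diagram after reading some of its slices: the strands that reach the
current height, from left to right, each with its direction (`true` for upwards) and the arc it
belongs to; the number of arcs started so far (these are called `0, …, arcs - 1`); the relators. -/
structure Scan : Type where
  strands : List (Bool × ℕ)
  arcs : ℕ
  relators : List Relator

/-- Read one more slice; `none` if it does not fit to the strands below it.  A new arc begins at
each local minimum and at each underpass. -/
def Scan.step (s : Scan) (e : Slice) : Option Scan :=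
  if s.strands.length < e.pos then none
  else
    match e.piece, s.strands.drop e.pos with
    | .cup b, rest =>
        some ⟨s.strands.take e.pos ++ (b, s.arcs) :: (!b, s.arcs) :: rest, s.arcs + 1, s.relators⟩
    | .cap, (a, x) :: (b, y) :: rest =>
        if a = b then none
        else some ⟨s.strands.take e.pos ++ rest, s.arcs, .join x y :: s.relators⟩
    | .cross true, (a, x) :: (b, y) :: rest =>
        some ⟨s.strands.take e.pos ++ (b, s.arcs) :: (a, x) :: rest, s.arcs + 1,
          (if a then .crossing x s.arcs y else .crossing x y s.arcs) :: s.relators⟩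
    | .cross false, (a, x) :: (b, y) :: rest =>
        some ⟨s.strands.take e.pos ++ (b, y) :: (a, s.arcs) :: rest, s.arcs + 1,
          (if b then .crossing y x s.arcs else .crossing y s.arcs x) :: s.relators⟩
    | _, _ => none

/-- Read a list of slices. -/
def Scan.run : Scan → List Slice → Option Scan
  | s, [] => some s
  | s, e :: w => (s.step e).bind fun s' => s'.run w

/-- The empty diagram. -/
def Scan.start : Scan := ⟨[], 0, []⟩

/-- An oriented link diagram: a list of slices that fit together, with no strand left open. -/
structure LinkDiagram : Type where
  slices : List Slice
  closed : ∃ s : Scan, Scan.start.run slices = some s ∧ s.strands = []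

/-! ## Isotopy of links: Reidemeister moves and planar isotopy -/

/-- The moves between lists of slices: Reidemeister's moves, and the moves that change the position
of a diagram with respect to the height function. -/
inductive LocalMove : List Slice → List Slice → Prop
  /-- Two pieces that lie side by side exchange their heights. -/
  | interchange (p q : Piece) (i k : ℕ) :
      LocalMove [⟨p, i⟩, ⟨q, i + p.outputs + k⟩] [⟨q, i + p.inputs + k⟩, ⟨p, i⟩]
  /-- A minimum and a maximum next to each other on a strand cancel. -/
  | zigzag_left (i : ℕ) (b : Bool) : LocalMove [⟨.cup b, i⟩, ⟨.cap, i + 1⟩] []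
  | zigzag_right (i : ℕ) (b : Bool) : LocalMove [⟨.cup b, i + 1⟩, ⟨.cap, i⟩] []
  /-- A strand slides across a maximum or a minimum. -/
  | slide_cap (i : ℕ) (e : Bool) :
      LocalMove [⟨.cross e, i + 1⟩, ⟨.cap, i⟩] [⟨.cross !e, i⟩, ⟨.cap, i + 1⟩]
  | slide_cup (i : ℕ) (b e : Bool) :
      LocalMove [⟨.cup b, i⟩, ⟨.cross e, i + 1⟩] [⟨.cup b, i + 1⟩, ⟨.cross !e, i⟩]
  /-- The first Reidemeister move. -/
  | reidemeister_one_cap (i : ℕ) (e : Bool) : LocalMove [⟨.cross e, i⟩, ⟨.cap, i⟩] [⟨.cap, i⟩]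
  | reidemeister_one_cup (i : ℕ) (b e : Bool) :
      LocalMove [⟨.cup b, i⟩, ⟨.cross e, i⟩] [⟨.cup !b, i⟩]
  /-- The second Reidemeister move. -/
  | reidemeister_two (i : ℕ) (e : Bool) : LocalMove [⟨.cross e, i⟩, ⟨.cross !e, i⟩] []
  /-- The third Reidemeister move. -/
  | reidemeister_three (i : ℕ) (e : Bool) :
      LocalMove [⟨.cross e, i⟩, ⟨.cross e, i + 1⟩, ⟨.cross e, i⟩]
        [⟨.cross e, i + 1⟩, ⟨.cross e, i⟩, ⟨.cross e, i + 1⟩]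

namespace LinkDiagram

/-- Two diagrams differ by one local move. -/
def Move (D E : LinkDiagram) : Prop :=
  ∃ below above a b : List Slice, LocalMove a b ∧
    D.slices = below ++ a ++ above ∧ E.slices = below ++ b ++ above

/-- Two diagrams represent isotopic oriented links. -/
def Isotopic : LinkDiagram → LinkDiagram → Prop := Relation.EqvGen Move

/-! ## Components, Alexander polynomial -/

/-- The arcs and relators of a diagram. -/
def scan (D : LinkDiagram) : Scan := D.closed.choose

/-- The arcs `a` and `b` follow each other on the link, at an underpass or at a maximum. -/
def Consecutive (D : LinkDiagram) (a b : ℕ) : Prop :=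
  (∃ o, Relator.crossing o a b ∈ D.scan.relators) ∨ Relator.join a b ∈ D.scan.relators

/-- The link has exactly one component. -/
def IsKnot (D : LinkDiagram) : Prop :=
  0 < D.scan.arcs ∧
    ∀ a < D.scan.arcs, ∀ b < D.scan.arcs, Relation.EqvGen D.Consecutive a b

end LinkDiagram

/-- The row of the Alexander matrix given by a relator (the Fox derivatives of the Wirtinger relator
`o l o⁻¹ r⁻¹`, or `a b⁻¹`, with every arc sent to `t`). -/
def Relator.row : Relator → ℕ → ℤ[T;T⁻¹]
  | .crossing o l r, j =>
      (if j = o then 1 - T 1 else 0) + (if j = l then T 1 else 0) - (if j = r then 1 else 0)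
  | .join a b, j => (if j = a then 1 else 0) - (if j = b then 1 else 0)

namespace LinkDiagram

/-- The Alexander matrix of the Wirtinger presentation of the link group. -/
def alexanderMatrix (D : LinkDiagram) :
    Matrix (Fin D.scan.relators.length) (Fin D.scan.arcs) ℤ[T;T⁻¹] :=
  fun i j => (D.scan.relators.get i).row j

/-- The first elementary ideal: generated by the minors of size (number of arcs) - 1. -/
def alexanderIdeal (D : LinkDiagram) : Ideal ℤ[T;T⁻¹] :=
  Ideal.span {d | ∃ (f : Fin (D.scan.arcs - 1) → Fin D.scan.relators.length)
    (g : Fin (D.scan.arcs - 1) → Fin D.scan.arcs), d = (D.alexanderMatrix.submatrix f g).det}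

/-- `P` is the Alexander polynomial of the knot with diagram `D`, i.e. the generator of the first
elementary ideal, normalized among its multiples by units `± t ^ k` to be an element of `ℤ[t]` with
non-zero constant term and with value `1` at `t = 1`. -/
def IsAlexanderPolynomial (D : LinkDiagram) (P : ℤ[X]) : Prop :=
  D.alexanderIdeal = Ideal.span {toLaurent P} ∧ P.coeff 0 ≠ 0 ∧ P.eval 1 = 1

end LinkDiagram

/-! ## Braids -/

/-- Artin's relations between the generators `σ_1, …, σ_{n-1}` (here numbered from `0`). -/
def braidRels (n : ℕ) : Set (FreeGroup (Fin (n - 1))) :=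
  {r | ∃ i j : Fin (n - 1), (i : ℕ) + 2 ≤ j ∧
    r = (.of i * .of j) * (.of j * .of i)⁻¹} ∪
  {r | ∃ i j : Fin (n - 1), (i : ℕ) + 1 = j ∧
    r = (.of i * .of j * .of i) * (.of j * .of i * .of j)⁻¹}

/-- The braid group on `n` strands. -/
abbrev BraidGroup (n : ℕ) : Type := PresentedGroup (braidRels n)

namespace BraidGroup

/-- The Artin generators. -/
def sigma {n : ℕ} (i : Fin (n - 1)) : BraidGroup n := PresentedGroup.of i

/-- The positive full twist `Δ² = (σ_1 σ_2 ⋯ σ_{n-1})ⁿ`. -/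
def fullTwist (n : ℕ) : BraidGroup n := (List.ofFn (sigma (n := n))).prod ^ n

/-- Positive braids: products of Artin generators. -/
def IsPositive {n : ℕ} (β : BraidGroup n) : Prop :=
  β ∈ Submonoid.closure (Set.range (sigma (n := n)))

/-- Twist positive braids. -/
def IsTwistPositive {n : ℕ} (β : BraidGroup n) : Prop :=
  ∃ γ : BraidGroup n, γ.IsPositive ∧ β = fullTwist n * γ

/-- The braid given by a word; the letter `(i, true)` is `σ_i` and `(i, false)` is `σ_i⁻¹`. -/
def ofWord {n : ℕ} (w : List (Fin (n - 1) × Bool)) : BraidGroup n :=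
  PresentedGroup.mk (braidRels n) (FreeGroup.mk w)

end BraidGroup

/-- The slices of the closure of a braid word on `n` strands: `n` nested minima, whose left branches
carry the braid upwards and whose right branches lead back downwards, the crossings of the braid,
and `n` nested maxima. -/
def closureSlices (n : ℕ) (w : List (Fin (n - 1) × Bool)) : List Slice :=
  (List.range n).map (fun k => ⟨.cup true, k⟩) ++
    w.map (fun c => ⟨.cross c.2, (c.1 : ℕ)⟩) ++
    (List.range n).reverse.map (fun k => ⟨.cap, k⟩)

theorem Scan.run_append (s : Scan) (u v : List Slice) :
    s.run (u ++ v) = (s.run u).bind fun s' => s'.run v := by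
  induction u generalizing s with
  | nil => rfl
  | cons e u ih =>
    simp only [List.cons_append, Scan.run]
    cases s.step e with
    | none => rfl
    | some s' => simpa using ih s'

theorem Scan.step_cup {s : Scan} {l r : List Bool} (h : s.strands.map Prod.fst = l ++ r)
    (b : Bool) :
    ∃ s', s.step ⟨.cup b, l.length⟩ = some s' ∧ s'.strands.map Prod.fst = l ++ b :: (!b) :: r := by
  obtain ⟨L, R, hs, hl, hr⟩ := List.map_eq_append_iff.1 h
  have hL : l.length = L.length := by rw [← hl, List.length_map]
  refine ⟨_, by simp [Scan.step, hs, hL]; rfl, ?_⟩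
  simp [hl, hr]

theorem Scan.step_cap {s : Scan} {l r : List Bool} {a b : Bool}
    (h : s.strands.map Prod.fst = l ++ a :: b :: r) (hab : a ≠ b) :
    ∃ s', s.step ⟨.cap, l.length⟩ = some s' ∧ s'.strands.map Prod.fst = l ++ r := by
  obtain ⟨L, R, hs, hl, hr⟩ := List.map_eq_append_iff.1 h
  have hL : l.length = L.length := by rw [← hl, List.length_map]
  obtain ⟨⟨a', x⟩, R', rfl, rfl, hr'⟩ := List.map_eq_cons_iff.1 hr
  obtain ⟨⟨b', y⟩, R'', rfl, rfl, hr''⟩ := List.map_eq_cons_iff.1 hr'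
  refine ⟨_, by simp [Scan.step, hs, hL, hab]; rfl, ?_⟩
  simp [hl, hr'']

theorem Scan.step_cross {s : Scan} {l r : List Bool} {a b : Bool}
    (h : s.strands.map Prod.fst = l ++ a :: b :: r) (e : Bool) :
    ∃ s', s.step ⟨.cross e, l.length⟩ = some s' ∧
      s'.strands.map Prod.fst = l ++ b :: a :: r := by
  obtain ⟨L, R, hs, hl, hr⟩ := List.map_eq_append_iff.1 h
  have hL : l.length = L.length := by rw [← hl, List.length_map]
  obtain ⟨⟨a', x⟩, R', rfl, rfl, hr'⟩ := List.map_eq_cons_iff.1 hr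
  obtain ⟨⟨b', y⟩, R'', rfl, rfl, hr''⟩ := List.map_eq_cons_iff.1 hr'
  cases e
  · refine ⟨_, by simp [Scan.step, hs, hL]; rfl, ?_⟩
    simp [hl, hr'']
  · refine ⟨_, by simp [Scan.step, hs, hL]; rfl, ?_⟩
    simp [hl, hr'']

theorem run_cups (n : ℕ) :
    ∃ s, Scan.start.run ((List.range n).map fun k => ⟨.cup true, k⟩) = some s ∧
      s.strands.map Prod.fst = List.replicate n true ++ List.replicate n false := by
  induction n with
  | zero => exact ⟨Scan.start, rfl, rfl⟩
  | succ n ih =>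
    obtain ⟨s, hs, h⟩ := ih
    obtain ⟨s', hs', h'⟩ := Scan.step_cup h true
    refine ⟨s', ?_, ?_⟩
    · rw [List.range_succ, List.map_append, Scan.run_append, hs]
      rw [List.length_replicate] at hs'
      simp [Scan.run, hs']
    · rw [h', List.replicate_succ' (n := n) (a := true), List.replicate_succ (n := n) (a := false)]
      simp

theorem run_crossings (n : ℕ) (w : List (Fin (n - 1) × Bool)) (s : Scan)
    (h : s.strands.map Prod.fst = List.replicate n true ++ List.replicate n false) :
    ∃ s', s.run (w.map fun c => ⟨.cross c.2, (c.1 : ℕ)⟩) = some s' ∧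
      s'.strands.map Prod.fst = List.replicate n true ++ List.replicate n false := by
  induction w generalizing s with
  | nil => exact ⟨s, rfl, h⟩
  | cons c w ih =>
    have hc : (c.1 : ℕ) + (2 + (n - 2 - (c.1 : ℕ))) = n := by have := c.1.2; omega
    have hn : List.replicate n true ++ List.replicate n false =
        List.replicate (c.1 : ℕ) true ++ true :: true ::
          (List.replicate (n - 2 - (c.1 : ℕ)) true ++ List.replicate n false) := by
      conv_lhs => enter [1]; rw [← hc, List.replicate_add, List.replicate_add]
      simp [List.replicate_succ]
    rw [hn] at h
    obtain ⟨s', hs', h'⟩ := Scan.step_cross h c.2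
    rw [← hn] at h'
    rw [List.length_replicate] at hs'
    obtain ⟨s'', hs'', h''⟩ := ih s' h'
    exact ⟨s'', by simp [Scan.run, hs', hs''], h''⟩

theorem run_caps (n : ℕ) (s : Scan)
    (h : s.strands.map Prod.fst = List.replicate n true ++ List.replicate n false) :
    ∃ s', s.run ((List.range n).reverse.map fun k => ⟨.cap, k⟩) = some s' ∧ s'.strands = [] := by
  induction n generalizing s with
  | zero => exact ⟨s, rfl, by simpa using h⟩
  | succ n ih =>
    rw [List.replicate_succ' (n := n) (a := true), List.replicate_succ (n := n) (a := false),
      List.append_assoc, List.singleton_append] at h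
    obtain ⟨s', hs', h'⟩ := Scan.step_cap h (by simp)
    rw [List.length_replicate] at hs'
    obtain ⟨s'', hs'', h''⟩ := ih s' h'
    exact ⟨s'', by simpa [List.range_succ, Scan.run, hs'] using hs'', h''⟩

/-- The closure of a braid word on `n` strands. -/
def braidClosure (n : ℕ) (w : List (Fin (n - 1) × Bool)) : LinkDiagram where
  slices := closureSlices n w
  closed := by
    obtain ⟨s, hs, h⟩ := run_cups n
    obtain ⟨s', hs', h'⟩ := run_crossings n w s h
    obtain ⟨s'', hs'', h''⟩ := run_caps n s' h'
    refine ⟨s'', ?_, h''⟩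
    rw [closureSlices, Scan.run_append, Scan.run_append, hs]
    simp only [Option.bind_some, hs', hs'']

namespace LinkDiagram

/-- The link with diagram `K` is the closure of the braid `β`. -/
def IsClosureOf (K : LinkDiagram) {n : ℕ} (β : BraidGroup n) : Prop :=
  ∃ w : List (Fin (n - 1) × Bool), BraidGroup.ofWord w = β ∧ K.Isotopic (braidClosure n w)

/-- The link with diagram `K` is twist positive on `n` strands. -/
def IsTwistPositive (K : LinkDiagram) (n : ℕ) : Prop :=
  ∃ β : BraidGroup n, β.IsTwistPositive ∧ K.IsClosureOf β

/-- The braid index: the least number of strands of a braid with closure `K`. -/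
def braidIndex (K : LinkDiagram) : ℕ :=
  sInf {m | ∃ β : BraidGroup m, K.IsClosureOf β}

end LinkDiagram

end

/-! The shape of the polynomial and the value of the braid index come from two independent
arguments.

Alexander polynomial. The Alexander module of a closed braid is presented by `1 - B` with `B` the
Burau matrix, and its first elementary ideal is generated by the minor of `1 - B` without the last
row and column. The full twist acts as `t^n + (1 - t) 1 w`, a scalar plus a rank one matrix all of
whose rows are proportional to `w = (t^(n-1), ..., t, 1)`. The matrix `P` of the positive factor `γ`
fixes `w` from the right, hence `B = t^n P + (1 - t) 1 w` (`Burau.fullTwist_mul_apply`). The rank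
one part alone yields the determinant `1 - (1 - t)(t + ... + t^(n-1)) = 1 - t + t^n`. Modulo
`t^(n+1)` only the value of `P` at `t = 0` matters. For a knot every generator occurs in `γ`, since
the full twist is pure; then this value is strictly triangular off the last strand
(`Burau.posMat_zero`) and leaves the determinant alone (`Burau.det_submatrix`). The ideal of an
arbitrary diagram of the knot is compared with that of the closed braid through the Alexander
module, which is invariant under all moves (`LinkDiagram.iso_marked_of_isotopic`), and through the
independence of elementary ideals from the presentation (`Submodule.minorIdeal_eq_of_surjective`).

Braid index. This is the Morton–Franks–Williams inequality, in a case where it is sharp. The HOMFLY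
polynomial enters through its specialisations: for real `q > 1` and `N` colours the R-matrix of type
A gives a state sum that is an isotopy invariant (`Homfly.stateSum_eq_of_isotopic`). For a braid on
`m` strands it equals, up to a power of `Q = q^N`, a polynomial in `Q` of degree at most `2m` whose
coefficients do not depend on `N`; this follows from the Markov properties of the trace and a
spanning set of the Hecke algebra (`Homfly.exists_isPolynomial`). For a twist positive braid on `n`
strands both extreme coefficients are non-zero (`Homfly.coeff_ne_zero_of_isTwistPositive`): the
matrix entries of a positive braid are non-negative, the colouring by the largest colour forces
growth like `Q^(2n)`, and the constant coefficient is a non-zero multiple of the diagonal entry at a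
strictly decreasing sequence of colours, which the full twist makes positive. Comparing spans gives
`n ≤ m` for every braid on `m` strands with the same closure. So the braid index is `n`, and for `n
≥ 2` the coefficient in that degree is 1. -/

noncomputable section

/-! ## Directions of the strands -/

namespace Slice

/-- The slice with one more strand on its left. -/
def shift (e : Slice) : Slice := ⟨e.piece, e.pos + 1⟩

end Slice

namespace Piece

/-- The effect of a piece at the far left on the directions of the strands. -/
def dirHead : Piece → List Bool → Option (List Bool)
  | .cup b, d => some (b :: (!b) :: d)
  | .cap, a :: b :: d => if a = b then none else some d
  | .cross _, a :: b :: d => some (b :: a :: d)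
  | _, _ => none

/-- The effect of a piece at position `i` on the directions of the strands. -/
def dirAct (p : Piece) : ℕ → List Bool → Option (List Bool)
  | 0, d => p.dirHead d
  | _ + 1, [] => none
  | i + 1, a :: d => (p.dirAct i d).map (a :: ·)

end Piece

/-- The effect of a list of slices on the directions of the strands. -/
def dirRun : List Bool → List Slice → Option (List Bool)
  | d, [] => some d
  | d, e :: w => (e.piece.dirAct e.pos d).bind fun d' => dirRun d' w

theorem dirRun_append (d : List Bool) (u v : List Slice) :
    dirRun d (u ++ v) = (dirRun d u).bind fun d' => dirRun d' v := by
  induction u generalizing d with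
  | nil => rfl
  | cons e u ih =>
    simp only [List.cons_append, dirRun]
    cases e.piece.dirAct e.pos d with
    | none => rfl
    | some d' => simpa using ih d'

theorem dirRun_shift (a : Bool) (d : List Bool) (w : List Slice) :
    dirRun (a :: d) (w.map Slice.shift) = (dirRun d w).map (a :: ·) := by
  induction w generalizing d with
  | nil => rfl
  | cons e w ih =>
    simp only [List.map_cons, dirRun, Slice.shift, Piece.dirAct]
    cases e.piece.dirAct e.pos d with
    | none => rfl
    | some d' => simpa using ih d'

theorem Piece.dirAct_append (p : Piece) (l d : List Bool) :
    p.dirAct l.length (l ++ d) = (p.dirAct 0 d).map (l ++ ·) := by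
  induction l with
  | nil => simp
  | cons a l ih =>
    simp only [List.length_cons, List.cons_append, Piece.dirAct] at ih ⊢
    rw [ih]; simp [Function.comp_def]

/-- Whether slices fit together depends on directions alone, so later arguments about moves can
forget the arcs and relators of a scan. -/
theorem Scan.step_strands {s s' : Scan} {e : Slice} (h : s.step e = some s') :
    e.piece.dirAct e.pos (s.strands.map Prod.fst) = some (s'.strands.map Prod.fst) := by
  obtain ⟨p, i⟩ := e
  simp only [Scan.step] at h
  split at h
  · exact absurd h (by simp)
  rename_i hi
  have hi : i ≤ s.strands.length := by simpa using hi
  have hl : (s.strands.take i).length = i := by simp [hi]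
  have key : p.dirAct i (s.strands.map Prod.fst) =
      (p.dirAct 0 ((s.strands.drop i).map Prod.fst)).map
        ((s.strands.take i).map Prod.fst ++ ·) := by
    conv_lhs => rw [← List.take_append_drop i s.strands, List.map_append]
    have := Piece.dirAct_append p ((s.strands.take i).map Prod.fst)
      ((s.strands.drop i).map Prod.fst)
    rwa [List.length_map, hl] at this
  simp only [key]
  split at h
  · cases h
    simp [Piece.dirAct, Piece.dirHead]
  · rename_i heq
    split at h
    · exact absurd h (by simp)
    · rename_i hab
      cases h
      simp [Piece.dirAct, Piece.dirHead, heq, hab]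
  · rename_i heq
    cases h
    simp [Piece.dirAct, Piece.dirHead, heq]
  · rename_i heq
    cases h
    simp [Piece.dirAct, Piece.dirHead, heq]
  · exact absurd h (by simp)

theorem Scan.run_strands {s s' : Scan} {w : List Slice} (h : s.run w = some s') :
    dirRun (s.strands.map Prod.fst) w = some (s'.strands.map Prod.fst) := by
  induction w generalizing s with
  | nil => cases h; rfl
  | cons e w ih =>
    simp only [Scan.run] at h
    obtain ⟨t, ht, h⟩ := Option.bind_eq_some_iff.1 h
    simp only [dirRun, Scan.step_strands ht, Option.bind_some, ih h]

theorem LinkDiagram.dirRun_slices (D : LinkDiagram) : dirRun [] D.slices = some [] := by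
  obtain ⟨s, hs, h⟩ := D.closed
  simpa [Scan.start, h] using Scan.run_strands hs

/-! ## State sums -/

namespace Homfly

variable (q : ℝ) (N : ℕ)

/-- The quantum dimension weights. -/
def mu (x : Fin N) : ℝ := q ^ (2 * (x : ℕ) + 1) / q ^ N

/-- The weight of a maximum whose left strand has direction `a`. -/
def capWeight (a : Bool) (x : Fin N) : ℝ := if a then mu q N x else 1

/-- The weight of a minimum whose left strand has direction `b`. -/
def cupWeight (b : Bool) (x : Fin N) : ℝ := if b then 1 else (mu q N x)⁻¹

/-- The coefficient of an oriented smoothing, with colours `l` and `r` on the left and on the right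
arc. -/
def smoothCoeff (pos : Bool) (l r : Fin N) : ℝ :=
  if pos then (if l < r then q - q⁻¹ else 0) else (if r < l then q⁻¹ - q else 0)

/-- The weight of the oriented smoothing of a crossing. -/
def smooth (pos : Bool) : Bool → Bool → (x y y' x' : Fin N) → ℝ
  | true, true, x, y, y', x' => if x = y' ∧ y = x' then smoothCoeff q N pos x y else 0
  | false, false, x, y, y', x' => if x = y' ∧ y = x' then smoothCoeff q N pos y x else 0
  | true, false, x, y, y', x' =>
      if x = y ∧ x' = y' then mu q N x * (mu q N x')⁻¹ * smoothCoeff q N pos x' x else 0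
  | false, true, x, y, v, u => if x = y ∧ u = v then smoothCoeff q N pos x u else 0

/-- The weight of a pair of strands crossing without exchanging their colours. -/
def transmit (pos : Bool) (x y y' x' : Fin N) : ℝ :=
  if x = x' ∧ y = y' then (if x = y then (if pos then q else q⁻¹) else 1) else 0

/-- The factor that makes the state sum independent of the framing. -/
def frame (pos : Bool) : ℝ := if pos then (q ^ N)⁻¹ else q ^ N

/-- The weight of the crossing `cross e` of strands with directions `a`, `b`, with colours `x`, `y`
at the bottom and `v`, `u` at the top. -/
def weight (e a b : Bool) (x y v u : Fin N) : ℝ :=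
  frame q N (e == (a == b)) *
    (transmit q N (e == (a == b)) x y v u + smooth q N (e == (a == b)) a b x y v u)

/-- Sum over the colourings of a piece at the far left. -/
def actHead : Piece → List (Bool × Fin N) → (List (Bool × Fin N) → ℝ) → ℝ
  | .cup b, s, k => ∑ c, cupWeight q N b c * k ((b, c) :: (!b, c) :: s)
  | .cap, (a, x) :: (b, y) :: s, k => if b = !a ∧ x = y then capWeight q N a x * k s else 0
  | .cross e, (a, x) :: (b, y) :: s, k =>
      ∑ y', ∑ x', weight q N e a b x y y' x' * k ((b, y') :: (a, x') :: s)
  | _, _, _ => 0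

/-- Sum over the colourings of a piece at position `i`. -/
def act (p : Piece) : ℕ → List (Bool × Fin N) → (List (Bool × Fin N) → ℝ) → ℝ
  | 0, s, k => actHead q N p s k
  | _ + 1, [], _ => 0
  | i + 1, v :: s, k => act p i s fun o => k (v :: o)

/-- Sum over the colourings of a list of slices. -/
def run : List (Bool × Fin N) → List Slice → (List (Bool × Fin N) → ℝ) → ℝ
  | s, [], k => k s
  | s, e :: w, k => act q N e.piece e.pos s fun s' => run s' w k

variable {q N}

theorem run_append (s : List (Bool × Fin N)) (u v : List Slice) (k) :
    run q N s (u ++ v) k = run q N s u fun s' => run q N s' v k := by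
  induction u generalizing s with
  | nil => rfl
  | cons e u ih => simp only [List.cons_append, run, ih]

theorem run_shift (v : Bool × Fin N) (s : List (Bool × Fin N)) (w : List Slice) (k) :
    run q N (v :: s) (w.map Slice.shift) k = run q N s w fun o => k (v :: o) := by
  induction w generalizing s with
  | nil => rfl
  | cons e w ih => simp only [List.map_cons, run, Slice.shift, act, ih]

theorem actHead_congr {p : Piece} {s : List (Bool × Fin N)} {k k' : List (Bool × Fin N) → ℝ}
    {d : List Bool} (hd : p.dirHead (s.map Prod.fst) = some d)
    (hk : ∀ s', s'.map Prod.fst = d → k s' = k' s') : actHead q N p s k = actHead q N p s k' := by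
  rcases p with b | _ | e
  · simp only [Piece.dirHead, Option.some.injEq] at hd
    subst hd
    simp only [actHead]
    exact Finset.sum_congr rfl fun c _ => by rw [hk]; simp
  · rcases s with _ | ⟨⟨a, x⟩, _ | ⟨⟨b, y⟩, s⟩⟩
    · rfl
    · rfl
    · simp only [Piece.dirHead, List.map_cons] at hd
      split at hd
      · simp at hd
      · simp only [Option.some.injEq] at hd
        simp only [actHead, hk s hd]
  · rcases s with _ | ⟨⟨a, x⟩, _ | ⟨⟨b, y⟩, s⟩⟩
    · rfl
    · rfl
    · simp only [Piece.dirHead, List.map_cons, Option.some.injEq] at hd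
      subst hd
      simp only [actHead]
      exact Finset.sum_congr rfl fun c _ => Finset.sum_congr rfl fun c' _ => by rw [hk]; simp

theorem act_congr {p : Piece} {i : ℕ} {s : List (Bool × Fin N)} {k k' : List (Bool × Fin N) → ℝ}
    {d : List Bool} (hd : p.dirAct i (s.map Prod.fst) = some d)
    (hk : ∀ s', s'.map Prod.fst = d → k s' = k' s') : act q N p i s k = act q N p i s k' := by
  induction i generalizing s k k' d with
  | zero => exact actHead_congr hd hk
  | succ i ih =>
    cases s with
    | nil => rfl
    | cons v s =>
      simp only [List.map_cons, Piece.dirAct, Option.map_eq_some_iff] at hd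
      obtain ⟨d', hd', rfl⟩ := hd
      exact ih hd' fun s' hs' => hk _ (by simp [hs'])

/-- Continuations only need to agree on the directions that the slices really produce. This matters
because moves such as the zigzags preserve the sum for matching directions only. -/
theorem run_congr {w : List Slice} {s : List (Bool × Fin N)} {k k' : List (Bool × Fin N) → ℝ}
    {d : List Bool} (hd : dirRun (s.map Prod.fst) w = some d)
    (hk : ∀ s', s'.map Prod.fst = d → k s' = k' s') : run q N s w k = run q N s w k' := by
  induction w generalizing s with
  | nil => exact hk _ (by simpa [dirRun] using hd)
  | cons e w ih =>
    simp only [dirRun] at hd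
    obtain ⟨d', hd', hd⟩ := Option.bind_eq_some_iff.1 hd
    exact act_congr hd' fun s' hs' => ih (by rwa [hs'])

theorem actHead_finset_sum {ι : Type*} (p : Piece) (s : List (Bool × Fin N)) (F : Finset ι)
    (r : ι → ℝ) (k : ι → List (Bool × Fin N) → ℝ) :
    actHead q N p s (fun o => ∑ i ∈ F, r i * k i o) = ∑ i ∈ F, r i * actHead q N p s (k i) := by
  rcases p with b | _ | e
  · simp only [actHead, Finset.mul_sum]
    rw [Finset.sum_comm]
    exact Finset.sum_congr rfl fun _ _ => Finset.sum_congr rfl fun _ _ => by ring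
  · rcases s with _ | ⟨⟨a, x⟩, _ | ⟨⟨b, y⟩, s⟩⟩
    · simp [actHead]
    · simp [actHead]
    · simp only [actHead]
      split_ifs
      · rw [Finset.mul_sum]
        exact Finset.sum_congr rfl fun _ _ => by ring
      · simp
  · rcases s with _ | ⟨⟨a, x⟩, _ | ⟨⟨b, y⟩, s⟩⟩
    · simp [actHead]
    · simp [actHead]
    · simp only [actHead, Finset.mul_sum]
      refine (Finset.sum_congr rfl fun _ _ => Finset.sum_comm).trans (Finset.sum_comm.trans ?_)
      exact Finset.sum_congr rfl fun _ _ => Finset.sum_congr rfl fun _ _ =>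
        Finset.sum_congr rfl fun _ _ => by ring

/-- Linearity in the continuation: this is what permits two distant pieces to exchange their sums.
-/
theorem act_finset_sum {ι : Type*} (p : Piece) (i : ℕ) (s : List (Bool × Fin N)) (F : Finset ι)
    (r : ι → ℝ) (k : ι → List (Bool × Fin N) → ℝ) :
    act q N p i s (fun o => ∑ j ∈ F, r j * k j o) = ∑ j ∈ F, r j * act q N p i s (k j) := by
  induction i generalizing s k with
  | zero => exact actHead_finset_sum p s F r k
  | succ i ih =>
    cases s with
    | nil => simp [act]
    | cons v s => exact ih s _

theorem act_mul (p : Piece) (i : ℕ) (s : List (Bool × Fin N)) (r : ℝ)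
    (k : List (Bool × Fin N) → ℝ) :
    act q N p i s (fun o => r * k o) = r * act q N p i s k := by
  simpa using act_finset_sum p i s {()} (fun _ => r) (fun _ => k)

end Homfly

end

/-! ### Invariance of the state sum under planar moves -/

noncomputable section

namespace Homfly

variable {q : ℝ} {N : ℕ}

/-- Two lists of slices have the same state sums wherever both fit. -/
def Agree (q : ℝ) (N : ℕ) (a b : List Slice) : Prop :=
  ∀ (s : List (Bool × Fin N)) (k : List (Bool × Fin N) → ℝ) (d d' : List Bool),
    dirRun (s.map Prod.fst) a = some d → dirRun (s.map Prod.fst) b = some d' →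
      run q N s a k = run q N s b k

/-- A strand added on the left is carried along unchanged, so every local move has to be checked at
position 0 only. -/
theorem Agree.shift {a b : List Slice} (h : Agree q N a b) :
    Agree q N (a.map Slice.shift) (b.map Slice.shift) := by
  rintro (_ | ⟨v, s⟩) k d d' ha hb
  · rcases a with _ | ⟨e, a⟩
    · rcases b with _ | ⟨e, b⟩
      · rfl
      · cases hb
    · cases ha
  · simp only [List.map_cons, dirRun_shift, Option.map_eq_some_iff] at ha hb
    obtain ⟨_, ha, -⟩ := ha
    obtain ⟨_, hb, -⟩ := hb
    rw [run_shift, run_shift, h s _ _ _ ha hb]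

theorem mu_ne_zero (hq : 1 < q) (x : Fin N) : mu q N x ≠ 0 := by
  have : q ≠ 0 := by positivity
  simp [mu, this]

theorem agree_interchange_zero (p r : Piece) (k : ℕ) :
    Agree q N [⟨p, 0⟩, ⟨r, 0 + p.outputs + k⟩] [⟨r, 0 + p.inputs + k⟩, ⟨p, 0⟩] := by
  intro s κ d d' h h'
  rcases p with b | _ | e
  · simp only [Piece.outputs, Piece.inputs, show 0 + 2 + k = k + 1 + 1 by ring, zero_add, run, act,
      actHead, act_finset_sum]
  · simp only [Piece.outputs, Piece.inputs, show 0 + 2 + k = k + 1 + 1 by ring, zero_add, run] at *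
    rcases s with _ | ⟨⟨a, x⟩, _ | ⟨⟨b, y⟩, s⟩⟩
    · rfl
    · rfl
    · simp only [act, actHead]
      split_ifs
      · rw [act_mul]
      · simpa using (act_mul (q := q) (N := N) r k s 0 0).symm
  · simp only [Piece.outputs, Piece.inputs, show 0 + 2 + k = k + 1 + 1 by ring, run] at *
    rcases s with _ | ⟨⟨a, x⟩, _ | ⟨⟨b, y⟩, s⟩⟩
    · rfl
    · rfl
    · simp only [act, actHead]
      have : ∀ y', act q N r k s (fun o => ∑ x', weight q N e a b x y y' x' *
          κ ((b, y') :: (a, x') :: o)) = ∑ x', weight q N e a b x y y' x' *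
          act q N r k s fun o => κ ((b, y') :: (a, x') :: o) := fun y' => act_finset_sum ..
      simp only [← this]
      simpa using (act_finset_sum r k s Finset.univ (fun _ : Fin N => 1)
        (fun y' o => ∑ x', weight q N e a b x y y' x' * κ ((b, y') :: (a, x') :: o))).symm

theorem agree_zigzag_left_zero (hq : 1 < q) (b : Bool) :
    Agree q N [⟨.cup b, 0⟩, ⟨.cap, 0 + 1⟩] [] := by
  rintro (_ | ⟨⟨c, y⟩, s⟩) k d d' h -
  · cases h
  · have hc : c = b := by
      cases b <;> cases c <;> simp_all [dirRun, Piece.dirAct, Piece.dirHead]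
    subst hc
    have := mu_ne_zero hq y
    cases c <;> simp [run, act, actHead, cupWeight, capWeight, this]

theorem agree_zigzag_right_zero (hq : 1 < q) (b : Bool) :
    Agree q N [⟨.cup b, 0 + 1⟩, ⟨.cap, 0⟩] [] := by
  rintro (_ | ⟨⟨c, y⟩, s⟩) k d d' h -
  · cases h
  · have hc : c = !b := by
      cases b <;> cases c <;> simp_all [dirRun, Piece.dirAct, Piece.dirHead]
    subst hc
    have := mu_ne_zero hq y
    cases b <;> simp [run, act, actHead, cupWeight, capWeight, this]

/-- Crossing symmetry: turning a crossing by bending one of its strands over a maximum. The factors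
`mu` in `smooth` are the ones that make the weights compatible with this turn. -/
theorem weight_rotate_cap (hq : 1 < q) (e a b : Bool) (x y w y' : Fin N) :
    weight q N e b (!a) y w x y' * capWeight q N a x =
      weight q N (!e) a b x y y' w * capWeight q N a w := by
  -- The sign of a crossing is `e == (a == b)`. It survives the turn because the overpass flag and
  -- the direction of one strand both flip.
  have hp : (e == (b == !a)) = ((!e) == (a == b)) := by cases a <;> cases b <;> cases e <;> rfl
  have ht : ∀ p, transmit q N p y w x y' * capWeight q N a x =
      transmit q N p x y y' w * capWeight q N a w := by
    intro p
    unfold transmit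
    by_cases h : y = y' ∧ w = x
    · obtain ⟨rfl, rfl⟩ := h
      simp [eq_comm]
    · rw [if_neg h, if_neg fun h' => h ⟨h'.2, h'.1.symm⟩, zero_mul, zero_mul]
  have hs : ∀ p, smooth q N p b (!a) y w x y' * capWeight q N a x =
      smooth q N p a b x y y' w * capWeight q N a w := by
    intro p
    have h1 := mu_ne_zero hq x
    have h4 := mu_ne_zero hq w
    cases a <;> cases b <;> simp only [smooth, capWeight, Bool.not_true, Bool.not_false, if_true,
        Bool.false_eq_true, if_false] <;>
      split_ifs with h h' h' <;> first | simp; done | (exfalso; grind) |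
        (obtain ⟨rfl, rfl⟩ := h; first | rfl | field_simp)
  simp only [weight, hp]
  linear_combination frame q N ((!e) == (a == b)) * (ht ((!e) == (a == b)) + hs ((!e) == (a == b)))

theorem weight_rotate_cup (hq : 1 < q) (e b c : Bool) (g y y' g' : Fin N) :
    cupWeight q N b g * weight q N e (!b) c g y y' g' =
      cupWeight q N b g' * weight q N (!e) c b y g' g y' := by
  have hp : (e == ((!b) == c)) = ((!e) == (c == b)) := by cases b <;> cases c <;> cases e <;> rfl
  have ht : ∀ p, cupWeight q N b g * transmit q N p g y y' g' =
      cupWeight q N b g' * transmit q N p y g' g y' := by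
    intro p
    unfold transmit
    by_cases h : g = g' ∧ y = y'
    · obtain ⟨rfl, rfl⟩ := h
      simp [eq_comm]
    · rw [if_neg h, if_neg fun h' => h ⟨h'.2.symm, h'.1⟩, mul_zero, mul_zero]
  have hs : ∀ p, cupWeight q N b g * smooth q N p (!b) c g y y' g' =
      cupWeight q N b g' * smooth q N p c b y g' g y' := by
    intro p
    have h1 := mu_ne_zero hq g
    have h4 := mu_ne_zero hq g'
    cases b <;> cases c <;> simp only [smooth, cupWeight, Bool.not_true, Bool.not_false, if_true,
        Bool.false_eq_true, if_false] <;>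
      split_ifs with h h' h' <;> first | simp; done | (exfalso; grind) |
        (obtain ⟨rfl, rfl⟩ := h; first | rfl | field_simp)
  simp only [weight, hp]
  linear_combination frame q N ((!e) == (c == b)) * (ht ((!e) == (c == b)) + hs ((!e) == (c == b)))

theorem agree_slide_cap_zero (hq : 1 < q) (e : Bool) :
    Agree q N [⟨.cross e, 0 + 1⟩, ⟨.cap, 0⟩] [⟨.cross !e, 0⟩, ⟨.cap, 0 + 1⟩] := by
  rintro (_ | ⟨⟨a, x⟩, _ | ⟨⟨b, y⟩, _ | ⟨⟨c, w⟩, s⟩⟩⟩) k d d' h h'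
  · cases h
  · cases h
  · cases h
  · have hc : c = !a := by
      cases a <;> cases c <;> simp_all [dirRun, Piece.dirAct, Piece.dirHead]
    subst hc
    simp only [run, act, actHead, true_and]
    rw [Finset.sum_comm]
    refine Finset.sum_congr rfl fun y' _ => ?_
    simp only [mul_ite, mul_zero, Finset.sum_ite_eq, Finset.sum_ite_eq', Finset.mem_univ, if_true,
      ← mul_assoc, weight_rotate_cap hq]

theorem agree_slide_cup_zero (hq : 1 < q) (b e : Bool) :
    Agree q N [⟨.cup b, 0⟩, ⟨.cross e, 0 + 1⟩] [⟨.cup b, 0 + 1⟩, ⟨.cross !e, 0⟩] := by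
  rintro (_ | ⟨⟨c, y⟩, s⟩) k d d' h h'
  · cases h
  · simp only [run, act, actHead, Finset.mul_sum, ← mul_assoc, weight_rotate_cup hq]
    refine (Finset.sum_congr rfl fun _ _ => Finset.sum_comm).trans (Finset.sum_comm.trans ?_)
    rfl

end Homfly

end

/-! ### Weighted sums over colours -/

noncomputable section

namespace Homfly

variable {q : ℝ} {N : ℕ}

theorem sum_fin_telescope (f : ℕ → ℝ) {a b : ℕ} (hab : a ≤ b) (hb : b ≤ N) :
    ∑ c : Fin N, (if a ≤ (c : ℕ) ∧ (c : ℕ) < b then f (c + 1) - f c else 0) = f b - f a := by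
  rw [Fin.sum_univ_eq_sum_range (fun c => if a ≤ c ∧ c < b then f (c + 1) - f c else 0) N,
    ← Finset.sum_filter]
  have : (Finset.range N).filter (fun c => a ≤ c ∧ c < b) = Finset.Ico a b := by
    ext c; simp only [Finset.mem_filter, Finset.mem_range, Finset.mem_Ico]; omega
  rw [this, Finset.sum_Ico_eq_sub _ hab, Finset.sum_range_sub, Finset.sum_range_sub]
  ring

/-- A difference of consecutive values of `q^(2c) / q^N`; sums over intervals of colours therefore
telescope. -/
theorem sub_inv_mul_mu (hq : 1 < q) (c : Fin N) :
    (q - q⁻¹) * mu q N c = q ^ (2 * ((c : ℕ) + 1)) / q ^ N - q ^ (2 * (c : ℕ)) / q ^ N := by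
  have : q ≠ 0 := by positivity
  rw [mu]; field_simp; ring

theorem sub_inv_mul_mu_inv (hq : 1 < q) (c : Fin N) :
    (q - q⁻¹) * (mu q N c)⁻¹ =
      -(q ^ N / q ^ (2 * ((c : ℕ) + 1)) - q ^ N / q ^ (2 * (c : ℕ))) := by
  have : q ≠ 0 := by positivity
  rw [mu, inv_div]; field_simp; ring

/-- The factor of a crossing of strands of equal colours. -/
def eigen (q : ℝ) (p : Bool) : ℝ := if p then q else q⁻¹

theorem sum_mu (hq : 1 < q) {x : Fin N → Prop} [DecidablePred x] (lo hi : ℕ) (h : lo ≤ hi)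
    (hN : hi ≤ N) (hx : ∀ c, x c ↔ lo ≤ (c : ℕ) ∧ (c : ℕ) < hi) :
    ∑ c : Fin N, (if x c then (q - q⁻¹) * mu q N c else 0) =
      q ^ (2 * hi) / q ^ N - q ^ (2 * lo) / q ^ N := by
  simp only [hx, sub_inv_mul_mu hq]
  exact sum_fin_telescope (fun c => q ^ (2 * c) / q ^ N) h hN

theorem sum_mu_inv (hq : 1 < q) {x : Fin N → Prop} [DecidablePred x] (lo hi : ℕ) (h : lo ≤ hi)
    (hN : hi ≤ N) (hx : ∀ c, x c ↔ lo ≤ (c : ℕ) ∧ (c : ℕ) < hi) :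
    ∑ c : Fin N, (if x c then (q - q⁻¹) * (mu q N c)⁻¹ else 0) =
      q ^ N / q ^ (2 * lo) - q ^ N / q ^ (2 * hi) := by
  simp only [hx, sub_inv_mul_mu_inv hq]
  rw [← neg_inj, neg_sub, ← sum_fin_telescope (fun c => q ^ N / q ^ (2 * c)) h hN,
    ← Finset.sum_neg_distrib]
  exact Finset.sum_congr rfl fun c _ => by split_ifs <;> ring1

/-- The partial trace of a crossing: together with the term `eigen q p * mu q N x` from equal
colours, the sum no longer depends on `x`, and `frame` is its inverse. This gives the first
Reidemeister move here and the Markov property of the trace later. -/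
theorem sum_smoothCoeff_mul_mu (hq : 1 < q) (p : Bool) (x : Fin N) :
    ∑ c, smoothCoeff q N p x c * mu q N c = (frame q N p)⁻¹ - eigen q p * mu q N x := by
  have h0 : q ≠ 0 := by positivity
  cases p
  · have := sum_mu (N := N) hq (x := fun c => c < x) 0 x (by omega) (by omega) (by simp)
    simp only [smoothCoeff, Bool.false_eq_true, if_false, frame, eigen]
    rw [← neg_inj, ← Finset.sum_neg_distrib]
    convert this using 1
    · exact Finset.sum_congr rfl fun c _ => by split_ifs <;> ring
    · rw [mu]; field_simp; ring
  · have := sum_mu (N := N) hq (x := fun c => x < c) (x + 1) N (by omega) (by omega)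
      (fun c => by simp only [Fin.lt_def]; omega)
    simp only [smoothCoeff, if_true, frame, eigen]
    convert this using 1
    · exact Finset.sum_congr rfl fun c _ => by split_ifs <;> ring
    · rw [mu]; field_simp; ring

theorem sum_smoothCoeff_mul_mu_inv (hq : 1 < q) (p : Bool) (x : Fin N) :
    ∑ c, smoothCoeff q N p c x * (mu q N c)⁻¹ =
      (frame q N p)⁻¹ - eigen q p * (mu q N x)⁻¹ := by
  have h0 : q ≠ 0 := by positivity
  cases p
  · have := sum_mu_inv (N := N) hq (x := fun c => x < c) (x + 1) N (by omega) (by omega)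
      (fun c => by simp only [Fin.lt_def]; omega)
    simp only [smoothCoeff, Bool.false_eq_true, if_false, frame, eigen]
    rw [← neg_inj, ← Finset.sum_neg_distrib]
    convert this using 1
    · exact Finset.sum_congr rfl fun c _ => by split_ifs <;> ring
    · rw [mu]; field_simp; ring
  · have := sum_mu_inv (N := N) hq (x := fun c => c < x) 0 x (by omega) (by omega) (by simp)
    simp only [smoothCoeff, if_true, frame, eigen]
    convert this using 1
    · exact Finset.sum_congr rfl fun c _ => by split_ifs <;> ring
    · rw [mu]; field_simp; ring

/-- The product of the two coefficients is non-zero only for `c` strictly between `x` and `y`, on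
one side determined by `p`; there it is constant and the sum of `mu` telescopes. Needed for the
second Reidemeister move of antiparallel strands. -/
theorem sum_smoothCoeff_mul_smoothCoeff_mu (hq : 1 < q) (p : Bool) (x y : Fin N) :
    ∑ c, smoothCoeff q N p x c * smoothCoeff q N (!p) y c * mu q N c =
      -(eigen q !p) * smoothCoeff q N p x y * mu q N y
        - eigen q p * mu q N x * smoothCoeff q N (!p) y x := by
  have h0 : q ≠ 0 := by positivity
  cases p
  · rcases lt_or_ge y x with h | h
    · have h' : (y : ℕ) < x := h
      have := sum_mu (N := N) hq (x := fun c => y < c ∧ c < x) (y + 1) x (by omega) (by omega)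
        (fun c => by simp only [Fin.lt_def]; omega)
      simp only [smoothCoeff, Bool.not_false, Bool.false_eq_true, if_false, if_true, eigen, h]
      trans -(q - q⁻¹) * (q ^ (2 * (x : ℕ)) / q ^ N - q ^ (2 * ((y : ℕ) + 1)) / q ^ N)
      · rw [← this, Finset.mul_sum]
        exact Finset.sum_congr rfl fun c _ => by split_ifs <;> first | ring1 | (exfalso; tauto)
      · rw [mu, mu]; field_simp; ring
    · simp only [smoothCoeff, Bool.not_false, Bool.false_eq_true, if_false, if_true, eigen,
        not_lt.2 h]
      rw [Finset.sum_eq_zero]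
      · simp
      · intro c _
        split_ifs with h1 h2
        · exact absurd (h2.trans h1) (not_lt.2 h)
        · simp
        · simp
        · simp
  · rcases lt_or_ge x y with h | h
    · have h' : (x : ℕ) < y := h
      have := sum_mu (N := N) hq (x := fun c => x < c ∧ c < y) (x + 1) y (by omega) (by omega)
        (fun c => by simp only [Fin.lt_def]; omega)
      simp only [smoothCoeff, Bool.not_true, Bool.false_eq_true, if_false, if_true, eigen, h]
      trans -(q - q⁻¹) * (q ^ (2 * (y : ℕ)) / q ^ N - q ^ (2 * ((x : ℕ) + 1)) / q ^ N)
      · rw [← this, Finset.mul_sum]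
        exact Finset.sum_congr rfl fun c _ => by split_ifs <;> first | ring1 | (exfalso; tauto)
      · rw [mu, mu]; field_simp; ring
    · simp only [smoothCoeff, Bool.not_true, Bool.false_eq_true, if_false, if_true, eigen,
        not_lt.2 h]
      rw [Finset.sum_eq_zero]
      · simp
      · intro c _
        split_ifs with h1 h2
        · exact absurd (h1.trans h2) (not_lt.2 h)
        · simp
        · simp
        · simp

theorem sum_smoothCoeff_mul_smoothCoeff_mu_inv (hq : 1 < q) (p : Bool) (x y : Fin N) :
    ∑ c, smoothCoeff q N p c x * smoothCoeff q N (!p) c y * (mu q N c)⁻¹ =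
      -(eigen q !p) * smoothCoeff q N p y x * (mu q N y)⁻¹
        - eigen q p * (mu q N x)⁻¹ * smoothCoeff q N (!p) x y := by
  have h0 : q ≠ 0 := by positivity
  cases p
  · rcases lt_or_ge x y with h | h
    · have h' : (x : ℕ) < y := h
      have := sum_mu_inv (N := N) hq (x := fun c => x < c ∧ c < y) (x + 1) y (by omega) (by omega)
        (fun c => by simp only [Fin.lt_def]; omega)
      simp only [smoothCoeff, Bool.not_false, Bool.false_eq_true, if_false, if_true, eigen, h]
      trans -(q - q⁻¹) * (q ^ N / q ^ (2 * ((x : ℕ) + 1)) - q ^ N / q ^ (2 * (y : ℕ)))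
      · rw [← this, Finset.mul_sum]
        exact Finset.sum_congr rfl fun c _ => by split_ifs <;> first | ring1 | (exfalso; tauto)
      · rw [mu, mu]; field_simp; ring
    · simp only [smoothCoeff, Bool.not_false, Bool.false_eq_true, if_false, if_true, eigen,
        not_lt.2 h]
      rw [Finset.sum_eq_zero]
      · simp
      · intro c _
        split_ifs with h1 h2
        · exact absurd (h1.trans h2) (not_lt.2 h)
        · simp
        · simp
        · simp
  · rcases lt_or_ge y x with h | h
    · have h' : (y : ℕ) < x := h
      have := sum_mu_inv (N := N) hq (x := fun c => y < c ∧ c < x) (y + 1) x (by omega) (by omega)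
        (fun c => by simp only [Fin.lt_def]; omega)
      simp only [smoothCoeff, Bool.not_true, Bool.false_eq_true, if_false, if_true, eigen, h]
      trans -(q - q⁻¹) * (q ^ N / q ^ (2 * ((y : ℕ) + 1)) - q ^ N / q ^ (2 * (x : ℕ)))
      · rw [← this, Finset.mul_sum]
        exact Finset.sum_congr rfl fun c _ => by split_ifs <;> first | ring1 | (exfalso; tauto)
      · rw [mu, mu]; field_simp; ring
    · simp only [smoothCoeff, Bool.not_true, Bool.false_eq_true, if_false, if_true, eigen,
        not_lt.2 h]
      rw [Finset.sum_eq_zero]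
      · simp
      · intro c _
        split_ifs with h1 h2
        · exact absurd (h2.trans h1) (not_lt.2 h)
        · simp
        · simp
        · simp

/-- Sum over the colourings of a crossing of two strands of the same direction. -/
theorem sum_weight_same (e a : Bool) (x y : Fin N) (k : Fin N → Fin N → ℝ) :
    ∑ y', ∑ x', weight q N e a a x y y' x' * k y' x' =
      frame q N e * ((if x = y then eigen q e else 1) * k y x +
        (if a then smoothCoeff q N e x y else smoothCoeff q N e y x) * k x y) := by
  have h1 : ∑ y', ∑ x', transmit q N e x y y' x' * k y' x' =
      (if x = y then eigen q e else 1) * k y x := by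
    rw [Finset.sum_eq_single y, Finset.sum_eq_single x]
    · simp [transmit, eigen]
    · intro b _ hb; simp [transmit, hb.symm]
    · simp
    · intro b _ hb; simp [transmit, hb.symm]
    · simp
  have h2 : ∑ y', ∑ x', smooth q N e a a x y y' x' * k y' x' =
      (if a then smoothCoeff q N e x y else smoothCoeff q N e y x) * k x y := by
    rw [Finset.sum_eq_single x, Finset.sum_eq_single y]
    · cases a <;> simp [smooth]
    · intro b _ hb; cases a <;> simp [smooth, hb.symm]
    · simp
    · intro b _ hb; cases a <;> simp [smooth, hb.symm]
    · simp
  rw [← h1, ← h2, ← Finset.sum_add_distrib, Finset.mul_sum]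
  refine Finset.sum_congr rfl fun y' _ => ?_
  rw [← Finset.sum_add_distrib, Finset.mul_sum]
  refine Finset.sum_congr rfl fun x' _ => ?_
  have hp : (e == (a == a)) = e := by cases a <;> cases e <;> rfl
  simp only [weight, hp]
  ring

/-- The coefficient of a maximum of colour `x` below a minimum of colour `c`. -/
def smoothOpp (q : ℝ) (N : ℕ) (p a : Bool) (x c : Fin N) : ℝ :=
  if a then mu q N x * (mu q N c)⁻¹ * smoothCoeff q N p c x else smoothCoeff q N p x c

/-- Sum over the colourings of a crossing of two strands of opposite directions. -/
theorem sum_weight_opp (e a : Bool) (x y : Fin N) (k : Fin N → Fin N → ℝ) :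
    ∑ y', ∑ x', weight q N e a (!a) x y y' x' * k y' x' =
      frame q N (!e) * ((if x = y then eigen q (!e) else 1) * k y x +
        if x = y then ∑ c, smoothOpp q N (!e) a x c * k c c else 0) := by
  have h1 : ∑ y', ∑ x', transmit q N (!e) x y y' x' * k y' x' =
      (if x = y then eigen q (!e) else 1) * k y x := by
    rw [Finset.sum_eq_single y, Finset.sum_eq_single x]
    · simp [transmit, eigen]
    · intro b _ hb; simp [transmit, hb.symm]
    · simp
    · intro b _ hb; simp [transmit, hb.symm]
    · simp
  have h2 : ∑ y', ∑ x', smooth q N (!e) a (!a) x y y' x' * k y' x' =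
      if x = y then ∑ c, smoothOpp q N (!e) a x c * k c c else 0 := by
    split_ifs with h
    · refine Finset.sum_congr rfl fun y' _ => ?_
      rw [Finset.sum_eq_single y']
      · cases a <;> simp [smooth, h, smoothOpp]
      · intro b _ hb; cases a <;> simp [smooth, hb]
      · simp
    · refine Finset.sum_eq_zero fun y' _ => Finset.sum_eq_zero fun x' _ => ?_
      cases a <;> simp [smooth, h]
  have hp : (e == (a == !a)) = !e := by cases a <;> cases e <;> rfl
  rw [← h1, ← h2, ← Finset.sum_add_distrib, Finset.mul_sum]
  refine Finset.sum_congr rfl fun y' _ => ?_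
  rw [← Finset.sum_add_distrib, Finset.mul_sum]
  refine Finset.sum_congr rfl fun x' _ => ?_
  simp only [weight, hp]
  ring

end Homfly

end

/-! ### Reidemeister moves for the state sum -/

noncomputable section

namespace Homfly

variable {q : ℝ} {N : ℕ}

theorem frame_mul_frame_not (hq : 1 < q) (e : Bool) : frame q N e * frame q N (!e) = 1 := by
  have : q ≠ 0 := by positivity
  cases e <;> simp [frame, this]

theorem frame_ne_zero (hq : 1 < q) (e : Bool) : frame q N e ≠ 0 :=
  left_ne_zero_of_mul_eq_one (frame_mul_frame_not hq e)

theorem eigen_mul_eigen_not (hq : 1 < q) (e : Bool) : eigen q e * eigen q (!e) = 1 := by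
  have : q ≠ 0 := by positivity
  cases e <;> simp [eigen, this]

theorem agree_reidemeister_one_cap_zero (hq : 1 < q) (e : Bool) :
    Agree q N [⟨.cross e, 0⟩, ⟨.cap, 0⟩] [⟨.cap, 0⟩] := by
  rintro (_ | ⟨⟨a, x⟩, _ | ⟨⟨b, y⟩, s⟩⟩) k d d' h h'
  · cases h
  · cases h
  · have hb : b = !a := by
      cases a <;> cases b <;> simp_all [dirRun, Piece.dirAct, Piece.dirHead]
    subst hb
    simp only [run, act, actHead, Bool.not_not, true_and]
    rw [sum_weight_opp]
    by_cases hxy : x = y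
    · subst hxy
      have hf := frame_ne_zero (N := N) hq (!e)
      have hm := mu_ne_zero hq x
      simp only [if_true, ← mul_assoc, ← Finset.sum_mul, ← add_mul]
      congr 1
      cases a
      · simp only [smoothOpp, capWeight, Bool.false_eq_true, if_false, Bool.not_false, if_true]
        rw [sum_smoothCoeff_mul_mu hq]
        field_simp; ring
      · simp only [smoothOpp, capWeight, Bool.false_eq_true, if_false, Bool.not_true, if_true]
        have : ∀ c, mu q N x * (mu q N c)⁻¹ * smoothCoeff q N (!e) c x * 1 =
            mu q N x * (smoothCoeff q N (!e) c x * (mu q N c)⁻¹) := fun c => by ring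
        simp only [this, ← Finset.mul_sum]
        rw [sum_smoothCoeff_mul_mu_inv hq]
        field_simp; ring
    · simp [hxy, Ne.symm hxy]

theorem agree_reidemeister_one_cup_zero (hq : 1 < q) (b e : Bool) :
    Agree q N [⟨.cup b, 0⟩, ⟨.cross e, 0⟩] [⟨.cup !b, 0⟩] := by
  intro s k d d' h h'
  simp only [run, act, actHead, sum_weight_opp, Bool.not_not, if_true]
  have hf := frame_ne_zero (N := N) hq (!e)
  simp only [mul_add, Finset.mul_sum, Finset.sum_add_distrib]
  rw [Finset.sum_comm, ← Finset.sum_add_distrib]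
  refine Finset.sum_congr rfl fun x _ => ?_
  have hm := mu_ne_zero hq x
  simp only [← mul_assoc, ← Finset.sum_mul, ← add_mul]
  congr 1
  cases b
  · simp only [smoothOpp, cupWeight, Bool.false_eq_true, if_false, Bool.not_false, if_true]
    have : ∀ c, (mu q N c)⁻¹ * frame q N (!e) * smoothCoeff q N (!e) c x =
        frame q N (!e) * (smoothCoeff q N (!e) c x * (mu q N c)⁻¹) := fun c => by ring
    simp only [this, ← Finset.mul_sum]
    rw [sum_smoothCoeff_mul_mu_inv hq]
    field_simp; ring
  · simp only [smoothOpp, cupWeight, Bool.false_eq_true, if_false, Bool.not_true, if_true]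
    have : ∀ c, 1 * frame q N (!e) * (mu q N c * (mu q N x)⁻¹ * smoothCoeff q N (!e) x c) =
        frame q N (!e) * (mu q N x)⁻¹ * (smoothCoeff q N (!e) x c * mu q N c) := fun c => by ring
    simp only [this, ← Finset.mul_sum]
    rw [sum_smoothCoeff_mul_mu hq]
    field_simp; ring

/-- On pairs of antiparallel strands of equal colour a crossing acts, up to its frame, as the scalar
`eigen` plus the operator with matrix `smoothOpp`. In the product with the opposite crossing all
terms other than the product of the scalars cancel. -/
theorem smoothOpp_comp (hq : 1 < q) (e a : Bool) (x i : Fin N) :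
    eigen q (!e) * smoothOpp q N e (!a) x i + smoothOpp q N (!e) a x i * eigen q e +
      ∑ c, smoothOpp q N (!e) a x c * smoothOpp q N e (!a) c i = 0 := by
  have hx := mu_ne_zero hq x
  have hi := mu_ne_zero hq i
  cases a
  · have := sum_smoothCoeff_mul_smoothCoeff_mu hq (!e) x i
    simp only [Bool.not_not] at this
    simp only [smoothOpp, Bool.not_false, Bool.false_eq_true, if_true, if_false]
    have h2 : ∑ c, smoothCoeff q N (!e) x c * (mu q N c * (mu q N i)⁻¹ * smoothCoeff q N e i c) =
        (∑ c, smoothCoeff q N (!e) x c * smoothCoeff q N e i c * mu q N c) * (mu q N i)⁻¹ := by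
      rw [Finset.sum_mul]
      exact Finset.sum_congr rfl fun c _ => by ring
    rw [h2, this]
    field_simp; ring
  · have := sum_smoothCoeff_mul_smoothCoeff_mu_inv hq (!e) x i
    simp only [Bool.not_not] at this
    simp only [smoothOpp, Bool.not_true, Bool.false_eq_true, if_true, if_false]
    have h2 : ∑ c, mu q N x * (mu q N c)⁻¹ * smoothCoeff q N (!e) c x * smoothCoeff q N e c i =
        (∑ c, smoothCoeff q N (!e) c x * smoothCoeff q N e c i * (mu q N c)⁻¹) * mu q N x := by
      rw [Finset.sum_mul]
      exact Finset.sum_congr rfl fun c _ => by ring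
    rw [h2, this]
    field_simp; ring

theorem run_reidemeister_two (hq : 1 < q) (e a b : Bool) (x y : Fin N) (s k) :
    run q N ((a, x) :: (b, y) :: s) [⟨.cross e, 0⟩, ⟨.cross !e, 0⟩] k =
      k ((a, x) :: (b, y) :: s) := by
  have h0 : q ≠ 0 := by positivity
  have hf := frame_mul_frame_not (N := N) hq e
  have hE := eigen_mul_eigen_not hq e
  simp only [run, act, actHead]
  by_cases hab : b = a
  · subst hab
    simp only [sum_weight_same]
    rcases lt_trichotomy x y with h | h | h
    · cases b <;> cases e <;>
        simp only [smoothCoeff, h, h.ne, h.ne', not_lt.2 h.le, Bool.not_true, Bool.not_false,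
          Bool.false_eq_true, if_true, if_false] at hf ⊢ <;>
        linear_combination k ((_, x) :: (_, y) :: s) * hf
    · subst h
      cases b <;> cases e <;>
        simp only [smoothCoeff, lt_irrefl, Bool.not_true, Bool.not_false,
          Bool.false_eq_true, if_true, if_false, eigen] at hf ⊢ <;>
        field_simp <;> linear_combination q * k ((_, x) :: (_, x) :: s) * hf
    · cases b <;> cases e <;>
        simp only [smoothCoeff, h, h.ne, h.ne', not_lt.2 h.le, Bool.not_true, Bool.not_false,
          Bool.false_eq_true, if_true, if_false] at hf ⊢ <;>
        linear_combination k ((_, x) :: (_, y) :: s) * hf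
  · have hb : b = !a := by cases a <;> cases b <;> simp_all
    subst hb
    have := fun (y' x' : Fin N) => sum_weight_opp (q := q) (!e) (!a) y' x'
      (fun u v => k ((a, u) :: (!a, v) :: s))
    simp only [Bool.not_not] at this
    simp only [this, sum_weight_opp]
    by_cases hxy : x = y
    · subst hxy
      have hS : ∀ i, eigen q (!e) * smoothOpp q N e (!a) x i + smoothOpp q N (!e) a x i * eigen q e +
          ∑ c, smoothOpp q N (!e) a x c * smoothOpp q N e (!a) c i = 0 :=
        fun i => smoothOpp_comp hq e a x i
      simp only [if_true]
      -- The terms in which the first crossing is smoothed cancel those in which only the second is: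
      -- `smoothOpp_comp`, summed against the continuation.
      have : ∑ c, smoothOpp q N (!e) a x c * (frame q N e * (eigen q e * k ((a, c) :: (!a, c) :: s) +
          ∑ i, smoothOpp q N e (!a) c i * k ((a, i) :: (!a, i) :: s))) =
          -(frame q N e * eigen q (!e) *
            ∑ i, smoothOpp q N e (!a) x i * k ((a, i) :: (!a, i) :: s)) := by
        rw [← sub_eq_zero, sub_neg_eq_add]
        simp only [mul_add, Finset.mul_sum, Finset.sum_add_distrib]
        rw [add_right_comm, Finset.sum_comm, ← Finset.sum_add_distrib, ← Finset.sum_add_distrib]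
        refine Finset.sum_eq_zero fun i _ => ?_
        have := congrArg (· * (frame q N e * k ((a, i) :: (!a, i) :: s))) (hS i)
        simp only [add_mul, Finset.sum_mul, zero_mul] at this
        rw [← this]
        rw [add_comm (eigen q (!e) * _ * _)]
        congr 1
        · congr 1
          · ring
          · ring
        · exact Finset.sum_congr rfl fun c _ => by ring
      rw [this]
      linear_combination k ((a, x) :: (!a, x) :: s) * (eigen q e * eigen q (!e) * hf + hE)
    · simp only [hxy, Ne.symm hxy, if_false]
      linear_combination k ((_, x) :: (_, y) :: s) * hf

/-- The third Reidemeister move for strands with directions `a`, `b`, `c` and crossings `e₁₂`, `e₁₃`,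
`e₂₃`. -/
def ReidemeisterThree (q : ℝ) (N : ℕ) (a b c e₁₂ e₁₃ e₂₃ : Bool) : Prop :=
  ∀ (x y w : Fin N) (s : List (Bool × Fin N)) (k : List (Bool × Fin N) → ℝ),
    run q N ((a, x) :: (b, y) :: (c, w) :: s)
        [⟨.cross e₁₂, 0⟩, ⟨.cross e₁₃, 0 + 1⟩, ⟨.cross e₂₃, 0⟩] k =
      run q N ((a, x) :: (b, y) :: (c, w) :: s)
        [⟨.cross e₂₃, 0 + 1⟩, ⟨.cross e₁₃, 0⟩, ⟨.cross e₁₂, 0 + 1⟩] k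

/-- The Yang–Baxter equation. The coefficients depend only on the relative order of the three
colours, so finitely many identities in `q` suffice. -/
theorem reidemeisterThree_up (hq : 1 < q) :
    ReidemeisterThree q N true true true true true true := by
  intro x y w s k
  have h0 : q ≠ 0 := by positivity
  simp only [run, act, actHead, sum_weight_same, if_true]
  rcases lt_trichotomy x y with h1 | h1 | h1 <;> rcases lt_trichotomy y w with h2 | h2 | h2 <;>
    rcases lt_trichotomy x w with h3 | h3 | h3 <;> first
      | (exfalso; order)
      | (try subst h1
         try subst h2
         try subst h3
         simp only [smoothCoeff, eigen, lt_irrefl, *, ne_of_lt, ne_of_gt, not_lt_of_gt, if_true,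
          if_false]
         first | done | ring1 | (field_simp; ring1))

/-- The matrix of the left side of the third Reidemeister move. -/
def matrixLeft (q : ℝ) (N : ℕ) (a b c e₁₂ e₁₃ e₂₃ : Bool) (x₁ x₂ x₃ y₃ y₂ y₁ : Fin N) : ℝ :=
  ∑ i₂, ∑ i₁, ∑ j₃, weight q N e₁₂ a b x₁ x₂ i₂ i₁ * weight q N e₁₃ a c i₁ x₃ j₃ y₁ *
    weight q N e₂₃ b c i₂ j₃ y₃ y₂

/-- The matrix of the right side of the third Reidemeister move. -/
def matrixRight (q : ℝ) (N : ℕ) (a b c e₁₂ e₁₃ e₂₃ : Bool) (x₁ x₂ x₃ y₃ y₂ y₁ : Fin N) : ℝ :=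
  ∑ i₃, ∑ i₂, ∑ j₁, weight q N e₂₃ b c x₂ x₃ i₃ i₂ * weight q N e₁₃ a c x₁ i₃ y₃ j₁ *
    weight q N e₁₂ a b j₁ i₂ y₂ y₁

theorem sum_comm_three {ι : Type*} [Fintype ι] (f : ι → ι → ι → ι → ℝ) :
    ∑ a, ∑ b, ∑ c, ∑ d, f a b c d = ∑ d, ∑ a, ∑ b, ∑ c, f a b c d :=
  (Finset.sum_congr rfl fun _ _ => (Finset.sum_congr rfl fun _ _ => Finset.sum_comm).trans
    Finset.sum_comm).trans Finset.sum_comm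

theorem run_left (a b c e₁₂ e₁₃ e₂₃ : Bool) (x₁ x₂ x₃ : Fin N) (s k) :
    run q N ((a, x₁) :: (b, x₂) :: (c, x₃) :: s)
        [⟨.cross e₁₂, 0⟩, ⟨.cross e₁₃, 0 + 1⟩, ⟨.cross e₂₃, 0⟩] k =
      ∑ y₃, ∑ y₂, ∑ y₁, matrixLeft q N a b c e₁₂ e₁₃ e₂₃ x₁ x₂ x₃ y₃ y₂ y₁ *
        k ((c, y₃) :: (b, y₂) :: (a, y₁) :: s) := by
  simp only [run, act, actHead, Finset.mul_sum]
  rw [sum_comm_three]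
  refine (Finset.sum_congr rfl fun _ _ => (sum_comm_three _).trans
    (Finset.sum_congr rfl fun _ _ => sum_comm_three _)).trans ?_
  rw [Finset.sum_comm]
  refine Finset.sum_congr rfl fun y₃ _ => ?_
  rw [Finset.sum_comm]
  refine Finset.sum_congr rfl fun y₂ _ => Finset.sum_congr rfl fun y₁ _ => ?_
  simp only [matrixLeft, Finset.sum_mul]
  exact Finset.sum_congr rfl fun _ _ => Finset.sum_congr rfl fun _ _ =>
    Finset.sum_congr rfl fun _ _ => by ring

theorem run_right (a b c e₁₂ e₁₃ e₂₃ : Bool) (x₁ x₂ x₃ : Fin N) (s k) :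
    run q N ((a, x₁) :: (b, x₂) :: (c, x₃) :: s)
        [⟨.cross e₂₃, 0 + 1⟩, ⟨.cross e₁₃, 0⟩, ⟨.cross e₁₂, 0 + 1⟩] k =
      ∑ y₃, ∑ y₂, ∑ y₁, matrixRight q N a b c e₁₂ e₁₃ e₂₃ x₁ x₂ x₃ y₃ y₂ y₁ *
        k ((c, y₃) :: (b, y₂) :: (a, y₁) :: s) := by
  simp only [run, act, actHead, Finset.mul_sum]
  trans ∑ i₃, ∑ i₂, ∑ j₁, ∑ y₃, ∑ y₂, ∑ y₁, weight q N e₂₃ b c x₂ x₃ i₃ i₂ *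
    (weight q N e₁₃ a c x₁ i₃ y₃ j₁ * (weight q N e₁₂ a b j₁ i₂ y₂ y₁ *
      k ((c, y₃) :: (b, y₂) :: (a, y₁) :: s)))
  · exact Finset.sum_congr rfl fun _ _ => Finset.sum_congr rfl fun _ _ => Finset.sum_comm
  · rw [sum_comm_three]
    refine Finset.sum_congr rfl fun y₃ _ => ?_
    rw [sum_comm_three]
    refine Finset.sum_congr rfl fun y₂ _ => ?_
    rw [sum_comm_three]
    refine Finset.sum_congr rfl fun y₁ _ => ?_
    simp only [matrixRight, Finset.sum_mul]
    exact Finset.sum_congr rfl fun _ _ => Finset.sum_congr rfl fun _ _ =>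
      Finset.sum_congr rfl fun _ _ => by ring

/-- Indicator functions as continuations isolate the individual matrix entries. -/
theorem reidemeisterThree_iff (a b c e₁₂ e₁₃ e₂₃ : Bool) :
    ReidemeisterThree q N a b c e₁₂ e₁₃ e₂₃ ↔ ∀ x₁ x₂ x₃ y₃ y₂ y₁,
      matrixLeft q N a b c e₁₂ e₁₃ e₂₃ x₁ x₂ x₃ y₃ y₂ y₁ =
        matrixRight q N a b c e₁₂ e₁₃ e₂₃ x₁ x₂ x₃ y₃ y₂ y₁ := by
  constructor
  · intro h x₁ x₂ x₃ y₃ y₂ y₁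
    have := h x₁ x₂ x₃ [] fun s => if s = [(c, y₃), (b, y₂), (a, y₁)] then 1 else 0
    rw [run_left, run_right] at this
    simpa [ite_and, Finset.sum_ite_irrel] using this
  · intro h x₁ x₂ x₃ s k
    simp only [run_left, run_right, h]

/-- Bending the first strand over to the far right exchanges the two sides of the move. The cap
weights of the inner edge of that strand cancel, and both sides are left with the same quotient of
outer ones. -/
theorem ReidemeisterThree.rotate (hq : 1 < q) {a b c e₁₂ e₁₃ e₂₃ : Bool}
    (h : ReidemeisterThree q N a b c e₁₂ e₁₃ e₂₃) :
    ReidemeisterThree q N b c (!a) e₂₃ (!e₁₂) (!e₁₃) := by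
  rw [reidemeisterThree_iff] at h ⊢
  intro x₁ x₂ x₃ y₃ y₂ y₁
  have hc : ∀ x : Fin N, capWeight q N a x ≠ 0 := fun x => by
    cases a <;> simp [capWeight, mu_ne_zero hq]
  have hw : ∀ (e b : Bool) (x y w y' : Fin N), weight q N (!e) b (!a) y w x y' =
      weight q N e a b x y y' w * (capWeight q N a w / capWeight q N a x) := by
    intro e b x y w y'
    have := weight_rotate_cap hq (!e) a b x y w y'
    rw [Bool.not_not] at this
    rw [mul_div_assoc', ← this, mul_div_cancel_right₀ _ (hc x)]
  have hl : matrixLeft q N b c (!a) e₂₃ (!e₁₂) (!e₁₃) x₁ x₂ x₃ y₃ y₂ y₁ =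
      matrixRight q N a b c e₁₂ e₁₃ e₂₃ y₃ x₁ x₂ y₂ y₁ x₃ *
        (capWeight q N a x₃ / capWeight q N a y₃) := by
    simp only [matrixLeft, matrixRight, hw, Finset.sum_mul]
    refine Finset.sum_congr rfl fun i₂ _ => Finset.sum_congr rfl fun i₁ _ =>
      Finset.sum_congr rfl fun j₃ _ => ?_
    have := hc j₃
    have := hc y₃
    field_simp
  have hr : matrixRight q N b c (!a) e₂₃ (!e₁₂) (!e₁₃) x₁ x₂ x₃ y₃ y₂ y₁ =
      matrixLeft q N a b c e₁₂ e₁₃ e₂₃ y₃ x₁ x₂ y₂ y₁ x₃ *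
        (capWeight q N a x₃ / capWeight q N a y₃) := by
    simp only [matrixLeft, matrixRight, hw, Finset.sum_mul]
    refine (Finset.sum_congr rfl fun _ _ => Finset.sum_comm).trans (Finset.sum_comm.trans ?_)
    refine Finset.sum_congr rfl fun i₂ _ => Finset.sum_congr rfl fun i₁ _ =>
      Finset.sum_congr rfl fun j₃ _ => ?_
    have := hc i₁
    have := hc y₃
    field_simp
  rw [hl, hr, h]

/-- Put the inverse of the crossing `e₁₂` before and after the given move; on each side it cancels
against `e₁₂` by the second Reidemeister move. -/
theorem ReidemeisterThree.conjugate (hq : 1 < q) {a b c e₁₂ e₁₃ e₂₃ : Bool}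
    (h : ReidemeisterThree q N a b c e₁₂ e₁₃ e₂₃) :
    ReidemeisterThree q N b a c (!e₁₂) e₂₃ e₁₃ := by
  intro x y w s k
  have h1 : ∀ (x y w : Fin N), run q N ((a, x) :: (b, y) :: (c, w) :: s)
      [⟨.cross e₂₃, 0 + 1⟩, ⟨.cross e₁₃, 0⟩] k =
      run q N ((a, x) :: (b, y) :: (c, w) :: s)
        [⟨.cross e₁₂, 0⟩, ⟨.cross e₁₃, 0 + 1⟩, ⟨.cross e₂₃, 0⟩, ⟨.cross !e₁₂, 0 + 1⟩] k := by
    intro x y w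
    have := h x y w s fun s' => run q N s' [⟨.cross !e₁₂, 0 + 1⟩] k
    rw [← run_append, ← run_append] at this
    refine Eq.trans ?_ this.symm
    simp only [List.cons_append, List.nil_append]
    simp only [run, act, actHead]
    refine Finset.sum_congr rfl fun _ _ => Finset.sum_congr rfl fun _ _ => congrArg _ ?_
    refine Finset.sum_congr rfl fun _ _ => Finset.sum_congr rfl fun _ _ => congrArg _ ?_
    exact (run_reidemeister_two hq e₁₂ _ _ _ _ _ fun o => k (_ :: o)).symm
  have h2 := run_reidemeister_two hq (!e₁₂) b a x y ((c, w) :: s) fun s' =>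
    run q N s' [⟨.cross e₁₃, 0 + 1⟩, ⟨.cross e₂₃, 0⟩, ⟨.cross !e₁₂, 0 + 1⟩] k
  refine Eq.trans ?_ h2
  rw [Bool.not_not]
  have h3 : ∀ y' x', weight q N (!e₁₂) b a x y y' x' * _ = weight q N (!e₁₂) b a x y y' x' * _ :=
    fun y' x' => congrArg _ (h1 y' x' w)
  have h4 := Finset.sum_congr (rfl : (Finset.univ : Finset (Fin N)) = _) fun y' _ =>
    Finset.sum_congr (rfl : (Finset.univ : Finset (Fin N)) = _) fun x' _ => h3 y' x'
  exact h4

/-- Rotation and conjugation lead from the single upward positive case to all eight choices of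
directions and both values of `e`; each case records a suitable word in the two operations. -/
theorem reidemeisterThree (hq : 1 < q) (a b c e : Bool) : ReidemeisterThree q N a b c e e e := by
  have h : ReidemeisterThree q N true true true true true true := reidemeisterThree_up hq
  have r : ∀ {a b c e₁₂ e₁₃ e₂₃ : Bool}, ReidemeisterThree q N a b c e₁₂ e₁₃ e₂₃ →
    ReidemeisterThree q N b c (!a) e₂₃ (!e₁₂) (!e₁₃) := fun h => h.rotate hq
  have s : ∀ {a b c e₁₂ e₁₃ e₂₃ : Bool}, ReidemeisterThree q N a b c e₁₂ e₁₃ e₂₃ →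
    ReidemeisterThree q N b a c (!e₁₂) e₂₃ e₁₃ := fun h => h.conjugate hq
  cases a <;> cases b <;> cases c <;> cases e
  · simpa only [Bool.not_true, Bool.not_false] using s (r (r (s (r (s h)))))
  · simpa only [Bool.not_true, Bool.not_false] using r (r (r h))
  · simpa only [Bool.not_true, Bool.not_false] using s (r (r (r (r h))))
  · simpa only [Bool.not_true, Bool.not_false] using r (s (r (r (s (r h)))))
  · simpa only [Bool.not_true, Bool.not_false] using r (s (r (r (r (r (r h))))))
  · simpa only [Bool.not_true, Bool.not_false] using s (r (s (r h)))
  · simpa only [Bool.not_true, Bool.not_false] using r (r (s (r (r (r h)))))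
  · simpa only [Bool.not_true, Bool.not_false] using r (s (r (s (r (r (r h))))))
  · simpa only [Bool.not_true, Bool.not_false] using r (r (s h))
  · simpa only [Bool.not_true, Bool.not_false] using r (s (r (s h)))
  · simpa only [Bool.not_true, Bool.not_false] using r (s (r (r h)))
  · simpa only [Bool.not_true, Bool.not_false] using s (r (s (r (r (r (r h))))))
  · simpa only [Bool.not_true, Bool.not_false] using s (r h)
  · simpa only [Bool.not_true, Bool.not_false] using r (r (s (r (s (r (r h))))))
  · simpa only [Bool.not_true, Bool.not_false] using r (s (r (s (r (r (s h))))))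
  · exact h

theorem agree_reidemeister_two_zero (hq : 1 < q) (e : Bool) :
    Agree q N [⟨.cross e, 0⟩, ⟨.cross !e, 0⟩] [] := by
  rintro (_ | ⟨⟨a, x⟩, _ | ⟨⟨b, y⟩, s⟩⟩) k d d' h h'
  · cases h
  · cases h
  · exact run_reidemeister_two hq ..

theorem agree_reidemeister_three_zero (hq : 1 < q) (e : Bool) :
    Agree q N [⟨.cross e, 0⟩, ⟨.cross e, 0 + 1⟩, ⟨.cross e, 0⟩]
      [⟨.cross e, 0 + 1⟩, ⟨.cross e, 0⟩, ⟨.cross e, 0 + 1⟩] := by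
  rintro (_ | ⟨⟨a, x⟩, _ | ⟨⟨b, y⟩, _ | ⟨⟨c, w⟩, s⟩⟩⟩) k d d' h h'
  · cases h
  · cases h
  · cases h
  · exact reidemeisterThree hq a b c e x y w s k

theorem agree_of_shift {f g : ℕ → List Slice} (h : Agree q N (f 0) (g 0))
    (hf : ∀ i, f (i + 1) = (f i).map Slice.shift) (hg : ∀ i, g (i + 1) = (g i).map Slice.shift)
    (i : ℕ) : Agree q N (f i) (g i) := by
  induction i with
  | zero => exact h
  | succ i ih => rw [hf, hg]; exact ih.shift

theorem agree_of_localMove (hq : 1 < q) {a b : List Slice} (h : LocalMove a b) :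
    Agree q N a b := by
  induction h with
  | interchange p r i k =>
    refine agree_of_shift (f := fun i => [⟨p, i⟩, ⟨r, i + p.outputs + k⟩])
      (g := fun i => [⟨r, i + p.inputs + k⟩, ⟨p, i⟩]) (agree_interchange_zero p r k) ?_ ?_ i <;>
    · intro i
      simp only [List.map_cons, List.map_nil, Slice.shift, List.cons.injEq, Slice.mk.injEq, and_true,
        true_and]
      omega
  | zigzag_left i b =>
    exact agree_of_shift (f := fun i => [⟨.cup b, i⟩, ⟨.cap, i + 1⟩]) (g := fun _ => [])
      (agree_zigzag_left_zero hq b) (fun _ => rfl) (fun _ => rfl) i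
  | zigzag_right i b =>
    exact agree_of_shift (f := fun i => [⟨.cup b, i + 1⟩, ⟨.cap, i⟩]) (g := fun _ => [])
      (agree_zigzag_right_zero hq b) (fun _ => rfl) (fun _ => rfl) i
  | slide_cap i e =>
    exact agree_of_shift (f := fun i => [⟨.cross e, i + 1⟩, ⟨.cap, i⟩])
      (g := fun i => [⟨.cross !e, i⟩, ⟨.cap, i + 1⟩])
      (agree_slide_cap_zero hq e) (fun _ => rfl) (fun _ => rfl) i
  | slide_cup i b e =>
    exact agree_of_shift (f := fun i => [⟨.cup b, i⟩, ⟨.cross e, i + 1⟩])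
      (g := fun i => [⟨.cup b, i + 1⟩, ⟨.cross !e, i⟩])
      (agree_slide_cup_zero hq b e) (fun _ => rfl) (fun _ => rfl) i
  | reidemeister_one_cap i e =>
    exact agree_of_shift (f := fun i => [⟨.cross e, i⟩, ⟨.cap, i⟩]) (g := fun i => [⟨.cap, i⟩])
      (agree_reidemeister_one_cap_zero hq e) (fun _ => rfl) (fun _ => rfl) i
  | reidemeister_one_cup i b e =>
    exact agree_of_shift (f := fun i => [⟨.cup b, i⟩, ⟨.cross e, i⟩])
      (g := fun i => [⟨.cup !b, i⟩])
      (agree_reidemeister_one_cup_zero hq b e) (fun _ => rfl) (fun _ => rfl) i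
  | reidemeister_two i e =>
    exact agree_of_shift (f := fun i => [⟨.cross e, i⟩, ⟨.cross !e, i⟩]) (g := fun _ => [])
      (agree_reidemeister_two_zero hq e) (fun _ => rfl) (fun _ => rfl) i
  | reidemeister_three i e =>
    exact agree_of_shift (f := fun i => [⟨.cross e, i⟩, ⟨.cross e, i + 1⟩, ⟨.cross e, i⟩])
      (g := fun i => [⟨.cross e, i + 1⟩, ⟨.cross e, i⟩, ⟨.cross e, i + 1⟩])
      (agree_reidemeister_three_zero hq e) (fun _ => rfl) (fun _ => rfl) i

/-- The state sum of a diagram. -/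
def stateSum (q : ℝ) (N : ℕ) (D : LinkDiagram) : ℝ :=
  run q N [] D.slices fun s => if s = [] then 1 else 0

theorem stateSum_eq_of_move (hq : 1 < q) {D E : LinkDiagram} (h : D.Move E) :
    stateSum q N D = stateSum q N E := by
  obtain ⟨below, above, a, b, hab, hD, hE⟩ := h
  have hd := D.dirRun_slices
  have he := E.dirRun_slices
  simp only [hD, hE, List.append_assoc, dirRun_append] at hd he
  obtain ⟨d₁, h₁, hd⟩ := Option.bind_eq_some_iff.1 hd
  obtain ⟨d₂, h₂, hd⟩ := Option.bind_eq_some_iff.1 hd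
  rw [h₁, Option.bind_some] at he
  obtain ⟨d₃, h₃, he⟩ := Option.bind_eq_some_iff.1 he
  simp only [stateSum, hD, hE, List.append_assoc, run_append]
  refine run_congr (d := d₁) h₁ fun s hs => ?_
  exact agree_of_localMove hq hab s _ d₂ d₃ (hs ▸ h₂) (hs ▸ h₃)

theorem stateSum_eq_of_isotopic (hq : 1 < q) {D E : LinkDiagram} (h : D.Isotopic E) :
    stateSum q N D = stateSum q N E := by
  induction h with
  | rel _ _ h => exact stateSum_eq_of_move hq h
  | refl _ => rfl
  | symm _ _ _ ih => exact ih.symm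
  | trans _ _ _ _ _ ih₁ ih₂ => exact ih₁.trans ih₂

end Homfly

end

noncomputable section

/-! ## Hecke algebras -/

namespace Hecke

variable {A : Type*} [Ring A] [Algebra ℝ A]

/-- Elements satisfying the relations of the generators of a Hecke algebra of type `A`. -/
structure Relations (z : ℝ) (g : ℕ → A) : Prop where
  sq : ∀ i, g i * g i = z • g i + 1
  braid : ∀ i, g i * g (i + 1) * g i = g (i + 1) * g i * g (i + 1)
  comm : ∀ i j, i + 2 ≤ j → g i * g j = g j * g i

/-- The subalgebra generated by the first `m - 1` generators. -/
def strands (g : ℕ → A) (m : ℕ) : Subalgebra ℝ A := Algebra.adjoin ℝ (g '' {i | i + 1 < m})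

theorem gen_mem_strands (g : ℕ → A) {i m : ℕ} (h : i + 1 < m) : g i ∈ strands g m :=
  Algebra.subset_adjoin ⟨i, h, rfl⟩

theorem strands_mono (g : ℕ → A) {m n : ℕ} (h : m ≤ n) : strands g m ≤ strands g n :=
  Algebra.adjoin_mono (Set.image_mono fun _ hi => lt_of_lt_of_le hi h)

theorem strands_le_bot (g : ℕ → A) {m : ℕ} (h : m ≤ 1) : strands g m = ⊥ := by
  have : {i : ℕ | i + 1 < m} = ∅ := by ext i; simp; omega
  rw [strands, this, Set.image_empty, Algebra.adjoin_empty]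

/-- The span of the elements with at most one occurrence of the last generator. -/
def oneLast (g : ℕ → A) (m : ℕ) : Submodule ℝ A :=
  Submodule.span ℝ ({u | u ∈ strands g m} ∪
    {x | ∃ u ∈ strands g m, ∃ v ∈ strands g m, x = u * g (m - 1) * v})

variable {z : ℝ} {g : ℕ → A}

theorem Relations.commute_of_mem (h : Relations z g) {m : ℕ} {u : A} (hu : u ∈ strands g m) :
    u * g m = g m * u := by
  induction hu using Algebra.adjoin_induction with
  | mem x hx =>
    obtain ⟨i, hi, rfl⟩ := hx
    exact h.comm i m (Nat.succ_le_of_lt hi)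
  | algebraMap r => exact Algebra.commutes r _
  | add x y _ _ hx hy => rw [add_mul, mul_add, hx, hy]
  | mul x y _ _ hx hy => rw [mul_assoc, hy, ← mul_assoc, hx, mul_assoc]

/-- The classical normal form: a word in the generators can be rewritten, up to linear combinations,
so that the last generator occurs at most once. It reduces the trace on `m + 1` strands to the trace
on `m` strands. -/
theorem Relations.strands_succ_le (h : Relations z g) (m : ℕ) (hm : 1 ≤ m) :
    Subalgebra.toSubmodule (strands g (m + 1)) ≤ oneLast g m := by
  induction m, hm using Nat.le_induction with
  | base =>
    have hs : g '' {i | i + 1 < 1 + 1} = {g 0} := by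
      have : {i : ℕ | i + 1 < 1 + 1} = {0} := by ext i; simp
      rw [this, Set.image_singleton]
    have h1 : (1 : A) ∈ oneLast g 1 := Submodule.subset_span (Or.inl (one_mem (strands g _)))
    have hg : g 0 ∈ oneLast g 1 :=
      Submodule.subset_span (Or.inr ⟨1, one_mem _, 1, one_mem _, by simp⟩)
    have key : ∀ x ∈ strands g (1 + 1), ∃ r s : ℝ, x = r • 1 + s • g 0 := by
      intro x hx
      rw [strands, hs] at hx
      induction hx using Algebra.adjoin_induction with
      | mem x hx => rw [Set.mem_singleton_iff.1 hx]; exact ⟨0, 1, by simp⟩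
      | algebraMap r => exact ⟨r, 0, by simp [Algebra.algebraMap_eq_smul_one]⟩
      | add x y _ _ hx hy =>
        obtain ⟨r, s, rfl⟩ := hx
        obtain ⟨r', s', rfl⟩ := hy
        exact ⟨r + r', s + s', by module⟩
      | mul x y _ _ hx hy =>
        obtain ⟨r, s, rfl⟩ := hx
        obtain ⟨r', s', rfl⟩ := hy
        refine ⟨r * r' + s * s', r * s' + s * r' + s * s' * z, ?_⟩
        simp only [add_mul, mul_add, smul_mul_assoc, mul_smul_comm, one_mul, mul_one, h.sq]
        module
    intro x hx
    obtain ⟨r, s, rfl⟩ := key x hx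
    exact add_mem (Submodule.smul_mem _ _ h1) (Submodule.smul_mem _ _ hg)
  | succ m hm ih =>
    -- The span contains 1, so stability under right multiplication by generators is enough.
    have hmul : ∀ x ∈ oneLast g (m + 1), ∀ i, i + 1 < m + 1 + 1 → x * g i ∈ oneLast g (m + 1) := by
      intro x hx i hi
      induction hx using Submodule.span_induction with
      | zero => simp
      | add x y _ _ hx hy => rw [add_mul]; exact add_mem hx hy
      | smul r x _ hx => rw [smul_mul_assoc]; exact Submodule.smul_mem _ _ hx
      | mem x hx =>
        rcases Nat.lt_or_ge i m with him | him
        · have hgi : g i ∈ strands g (m + 1) := gen_mem_strands g (by omega)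
          rcases hx with hx | ⟨u, hu, v, hv, rfl⟩
          · exact Submodule.subset_span (Or.inl (mul_mem hx hgi))
          · exact Submodule.subset_span (Or.inr ⟨u, hu, v * g i, mul_mem hv hgi, by
              simp only [mul_assoc]⟩)
        · obtain rfl : i = m := by omega
          rcases hx with hx | ⟨u, hu, v, hv, rfl⟩
          · exact Submodule.subset_span (Or.inr ⟨x, hx, 1, one_mem _, by simp⟩)
          · simp only [Nat.add_sub_cancel]
            -- The product is `u * g i * v * g i`. By induction `v` either commutes with `g i`, and
            -- the quadratic relation applies, or contains a single `g (i - 1)`, and the braid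
            -- relation leaves only one `g i`.
            have hv' := ih hv
            clear hv
            induction hv' using Submodule.span_induction with
            | zero => simp
            | add x y _ _ hx hy =>
              rw [mul_add, add_mul]; exact add_mem hx hy
            | smul r x _ hx =>
              rw [mul_smul_comm, smul_mul_assoc]; exact Submodule.smul_mem _ _ hx
            | mem v hv =>
              rcases hv with hv | ⟨a, ha, b, hb, rfl⟩
              · have hv1 : v ∈ strands g (i + 1) := strands_mono g (by omega) hv
                have : u * g i * v * g i = z • (u * v * g i * 1) + u * v := by
                  rw [mul_assoc u, ← h.commute_of_mem hv, mul_assoc, mul_assoc, h.sq]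
                  simp only [mul_add, mul_smul_comm, mul_one, mul_assoc]
                rw [this]
                exact add_mem (Submodule.smul_mem _ _ (Submodule.subset_span
                  (Or.inr ⟨u * v, mul_mem hu hv1, 1, one_mem _, rfl⟩)))
                  (Submodule.subset_span (Or.inl (mul_mem hu hv1)))
              · have ha1 : a ∈ strands g (i + 1) := strands_mono g (by omega) ha
                have hb1 : b ∈ strands g (i + 1) := strands_mono g (by omega) hb
                obtain ⟨j, rfl⟩ : ∃ j, i = j + 1 := ⟨i - 1, by omega⟩
                have hj : g j ∈ strands g (j + 1 + 1) := gen_mem_strands g (by omega)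
                have : u * g (j + 1) * (a * g (j + 1 - 1) * b) * g (j + 1) =
                    (u * a * g j) * g (j + 1) * (g j * b) := by
                  rw [Nat.add_sub_cancel]
                  calc u * g (j + 1) * (a * g j * b) * g (j + 1)
                      = u * (g (j + 1) * a) * g j * (b * g (j + 1)) := by simp only [mul_assoc]
                    _ = u * (a * g (j + 1)) * g j * (g (j + 1) * b) := by
                        rw [h.commute_of_mem ha, h.commute_of_mem hb]
                    _ = u * a * (g (j + 1) * g j * g (j + 1)) * b := by simp only [mul_assoc]
                    _ = _ := by rw [← h.braid]; simp only [mul_assoc]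
                rw [this]
                exact Submodule.subset_span (Or.inr ⟨_, mul_mem (mul_mem hu ha1) hj, _,
                  mul_mem hj hb1, rfl⟩)
    rw [strands, Algebra.adjoin_eq_span, Submodule.span_le]
    intro x hx
    induction hx using Submonoid.closure_induction_right with
    | one => exact Submodule.subset_span (Or.inl (one_mem (strands g _)))
    | mul_right x _ y hy ih' =>
      obtain ⟨i, hi, rfl⟩ := hy
      exact hmul x ih' i hi

end Hecke

/-! ## The action of the Hecke algebras on tensor powers -/

namespace Homfly

section Generator

variable {C : Type*}

/-- Exchange two neighbouring terms of a sequence. -/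
def exchange (i : ℕ) (s : ℕ → C) : ℕ → C := s ∘ Equiv.swap i (i + 1)

theorem exchange_left (i : ℕ) (s : ℕ → C) : exchange i s i = s (i + 1) := by simp [exchange]

theorem exchange_right (i : ℕ) (s : ℕ → C) : exchange i s (i + 1) = s i := by simp [exchange]

theorem exchange_of_ne {i j : ℕ} (s : ℕ → C) (h : j ≠ i) (h' : j ≠ i + 1) :
    exchange i s j = s j := by simp [exchange, Equiv.swap_apply_of_ne_of_ne h h']

theorem exchange_exchange (i : ℕ) (s : ℕ → C) : exchange i (exchange i s) = s := by
  ext j; simp [exchange]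

theorem exchange_comm {i j : ℕ} (h : i + 2 ≤ j) (s : ℕ → C) :
    exchange i (exchange j s) = exchange j (exchange i s) := by
  ext k
  simp only [exchange, Function.comp_apply]
  congr 1
  simp only [Equiv.swap_apply_def]
  split_ifs <;> omega

theorem exchange_braid (i : ℕ) (s : ℕ → C) :
    exchange i (exchange (i + 1) (exchange i s)) =
      exchange (i + 1) (exchange i (exchange (i + 1) s)) := by
  ext k
  simp only [exchange, Function.comp_apply]
  congr 1
  simp only [Equiv.swap_apply_def]
  split_ifs <;> omega

theorem exchange_of_eq {i : ℕ} {s : ℕ → C} (h : s i = s (i + 1)) : exchange i s = s := by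
  ext j
  simp only [exchange, Function.comp_apply, Equiv.swap_apply_def]
  split_ifs with h1 h2
  · rw [h1, h]
  · rw [h2, h]
  · rfl

variable [LinearOrder C]

/-- The action of a generator on functions of sequences. -/
def gen (q : ℝ) (C : Type*) [LinearOrder C] (i : ℕ) : Module.End ℝ ((ℕ → C) → ℝ) where
  toFun k s := if s i = s (i + 1) then q * k s else
    k (exchange i s) + if s i < s (i + 1) then (q - q⁻¹) * k s else 0
  map_add' k k' := by
    ext s
    simp only [Pi.add_apply]
    split_ifs <;> ring
  map_smul' r k := by
    ext s
    simp only [Pi.smul_apply, smul_eq_mul, RingHom.id_apply]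
    split_ifs <;> ring

theorem gen_apply (q : ℝ) (i : ℕ) (k : (ℕ → C) → ℝ) (s : ℕ → C) :
    gen q C i k s = if s i = s (i + 1) then q * k s else
      k (exchange i s) + if s i < s (i + 1) then (q - q⁻¹) * k s else 0 := rfl

/-- Infinite sequences let the generators of all braid groups act on one space. The quadratic and
braid relations depend only on the order of two or three neighbouring entries; if two of them
coincide, exchanging them does nothing. -/
theorem gen_relations {q : ℝ} (hq : q ≠ 0) : Hecke.Relations (q - q⁻¹) (gen q C) where
  sq i := by
    ext k s
    simp only [Module.End.mul_apply, LinearMap.add_apply, LinearMap.smul_apply,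
      Module.End.one_apply, Pi.add_apply, Pi.smul_apply, smul_eq_mul, gen_apply, exchange_left,
      exchange_right, exchange_exchange]
    rcases lt_trichotomy (s i) (s (i + 1)) with h | h | h
    · simp only [h, h.ne, h.ne', h.not_gt, if_true, if_false]
      ring
    · simp only [h, if_true]
      field_simp
      ring
    · simp only [h, h.ne, h.ne', h.not_gt, if_true, if_false]
      ring
  comm i j hij := by
    ext k s
    simp only [Module.End.mul_apply, gen_apply]
    rw [exchange_of_ne (i := i) s (j := j) (by omega) (by omega),
      exchange_of_ne (i := i) s (j := j + 1) (by omega) (by omega),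
      exchange_of_ne (i := j) s (j := i) (by omega) (by omega),
      exchange_of_ne (i := j) s (j := i + 1) (by omega) (by omega), exchange_comm hij]
    split_ifs <;> ring
  braid i := by
    ext k s
    simp only [Module.End.mul_apply, gen_apply, exchange_left, exchange_right]
    have h1 : ∀ s : ℕ → C, exchange i s (i + 1 + 1) = s (i + 1 + 1) := fun s =>
      exchange_of_ne s (by omega) (by omega)
    have h2 : ∀ s : ℕ → C, exchange (i + 1) s i = s i := fun s =>
      exchange_of_ne s (by omega) (by omega)
    simp only [h1, h2, exchange_left, exchange_right, exchange_exchange, exchange_braid]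
    have e1 : s i = s (i + 1) → exchange i s = s := exchange_of_eq
    have e2 : s (i + 1) = s (i + 1 + 1) → exchange (i + 1) s = s := exchange_of_eq
    have e3 : s i = s (i + 1 + 1) → exchange i (exchange (i + 1) (exchange i s)) =
        exchange i (exchange i s) := fun h => by
      rw [exchange_of_eq (i := i + 1)]
      rw [exchange_right, h1, h]
    rw [exchange_braid, exchange_exchange] at e3
    generalize s i = x at *
    generalize s (i + 1) = y at *
    generalize s (i + 1 + 1) = w at *
    rcases lt_trichotomy x y with a | a | a <;> rcases lt_trichotomy y w with b | b | b <;>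
      rcases lt_trichotomy x w with c | c | c <;> first
        | (exfalso; order)
        | (try have e1' := e1 a
           try have e2' := e2 b
           try have e3' := e3 c
           clear e1 e2 e3
           try subst a
           try subst b
           try subst c
           simp only [*, lt_irrefl, ne_of_lt, ne_of_gt, not_lt_of_gt, if_true, if_false]
           first | done | ring1 | (field_simp; ring1))

end Generator

end Homfly

end

/-! ### Weighted traces and the Markov property -/

noncomputable section

namespace Homfly

section Trace

variable {C : Type*}

/-- The first `n` terms of a sequence. -/
def seg (n : ℕ) (s : ℕ → C) : List C := (List.range n).map s

theorem length_seg (n : ℕ) (s : ℕ → C) : (seg n s).length = n := by simp [seg]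

theorem seg_succ (n : ℕ) (s : ℕ → C) : seg (n + 1) s = seg n s ++ [s n] := by
  simp [seg, List.range_succ]

theorem seg_congr {n : ℕ} {s s' : ℕ → C} (h : ∀ j < n, s j = s' j) : seg n s = seg n s' :=
  List.map_congr_left fun j hj => h j (List.mem_range.1 hj)

theorem eq_of_seg_eq {n : ℕ} {s s' : ℕ → C} (h : seg n s = seg n s') {j : ℕ} (hj : j < n) :
    s j = s' j :=
  List.map_inj_left.1 h j (List.mem_range.2 hj)

/-- A sequence with the given first terms. -/
def extend (d : C) (l : List C) (i : ℕ) : C := l.getD i d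

theorem seg_extend (d : C) (l : List C) : seg l.length (extend d l) = l := by
  apply List.ext_getElem
  · simp [seg]
  · intro i h1 h2
    simp [seg, extend, h2]

theorem extend_append_of_lt (d : C) (l l' : List C) {j : ℕ} (h : j < l.length) :
    extend d (l ++ l') j = extend d l j := by
  exact List.getD_append _ _ _ _ h

theorem extend_append_length (d c : C) (l : List C) : extend d (l ++ [c]) l.length = c := by
  simp [extend]

/-- Sum over all lists of length `n`. -/
def sumLists [Fintype C] : ℕ → (List C → ℝ) → ℝ
  | 0, F => F []
  | n + 1, F => sumLists n fun l => ∑ c, F (l ++ [c])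

theorem sumLists_congr [Fintype C] {n : ℕ} {F G : List C → ℝ}
    (h : ∀ l, l.length = n → F l = G l) : sumLists n F = sumLists n G := by
  induction n generalizing F G with
  | zero => exact h [] rfl
  | succ n ih => exact ih fun l hl => Finset.sum_congr rfl fun c _ => h _ (by simp [hl])

theorem sumLists_add [Fintype C] (n : ℕ) (F G : List C → ℝ) :
    sumLists n (fun l => F l + G l) = sumLists n F + sumLists n G := by
  induction n generalizing F G with
  | zero => rfl
  | succ n ih => simp only [sumLists, Finset.sum_add_distrib, ih]

theorem sumLists_mul [Fintype C] (n : ℕ) (r : ℝ) (F : List C → ℝ) :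
    sumLists n (fun l => r * F l) = r * sumLists n F := by
  induction n generalizing F with
  | zero => rfl
  | succ n ih => simp only [sumLists, ← Finset.mul_sum, ih]

theorem le_sumLists [Fintype C] {n : ℕ} {F : List C → ℝ}
    (h : ∀ l, l.length = n → 0 ≤ F l) {l : List C} (hl : l.length = n) : F l ≤ sumLists n F := by
  induction n generalizing F l with
  | zero => rw [List.length_eq_zero_iff.1 hl]; rfl
  | succ n ih =>
    obtain ⟨l, c, rfl⟩ := (List.eq_nil_or_concat' l).resolve_left (by rintro rfl; simp at hl)
    have hl : l.length = n := by simpa using hl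
    refine le_trans ?_ (ih (fun l hl => Finset.sum_nonneg fun c _ => h _ (by simp [hl])) hl)
    exact Finset.single_le_sum (f := fun c => F (l ++ [c])) (fun c _ => h _ (by simp [hl]))
      (Finset.mem_univ c)

/-- The indicator function of the sequences that start with `l`. -/
def starts [DecidableEq C] (n : ℕ) (l : List C) (s : ℕ → C) : ℝ := if seg n s = l then 1 else 0

/-- Operators that act on the first `m` terms of sequences by rearranging them. -/
structure ActsOn (m : ℕ) (x : Module.End ℝ ((ℕ → C) → ℝ)) : Prop where
  mul : ∀ φ k : (ℕ → C) → ℝ, (∀ i, i + 1 < m → ∀ s, φ (exchange i s) = φ s) →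
    x (φ * k) = φ * x k
  congr : ∀ k : (ℕ → C) → ℝ, (∀ s s', (∀ j < m, s j = s' j) → k s = k s') →
    ∀ s s', (∀ j < m, s j = s' j) → x k s = x k s'

/-- Of the two clauses of `ActsOn`, `mul` serves two purposes: functions of later entries behave
like scalars, and symmetric conditions on the first `m` entries are respected. `congr` keeps
functions of the first `m` entries among themselves. -/
theorem ActsOn.one (m : ℕ) : ActsOn m (1 : Module.End ℝ ((ℕ → C) → ℝ)) :=
  ⟨fun _ _ _ => rfl, fun _ hk => hk⟩

theorem ActsOn.smul {m : ℕ} {x : Module.End ℝ ((ℕ → C) → ℝ)} (h : ActsOn m x) (r : ℝ) :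
    ActsOn m (r • x) where
  mul φ k hφ := by simp only [LinearMap.smul_apply, h.mul φ k hφ, mul_smul_comm]
  congr k hk s s' hs := by
    simp only [LinearMap.smul_apply, Pi.smul_apply, h.congr k hk s s' hs]

theorem ActsOn.add {m : ℕ} {x y : Module.End ℝ ((ℕ → C) → ℝ)} (h : ActsOn m x) (h' : ActsOn m y) :
    ActsOn m (x + y) where
  mul φ k hφ := by simp only [LinearMap.add_apply, h.mul φ k hφ, h'.mul φ k hφ, mul_add]
  congr k hk s s' hs := by
    simp only [LinearMap.add_apply, Pi.add_apply, h.congr k hk s s' hs, h'.congr k hk s s' hs]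

theorem ActsOn.comp {m : ℕ} {x y : Module.End ℝ ((ℕ → C) → ℝ)} (h : ActsOn m x)
    (h' : ActsOn m y) : ActsOn m (x * y) where
  mul φ k hφ := by simp only [Module.End.mul_apply, h'.mul φ k hφ, h.mul φ _ hφ]
  congr k hk s s' hs := h.congr _ (fun t t' ht => h'.congr k hk t t' ht) s s' hs

theorem actsOn_gen [LinearOrder C] (q : ℝ) {i m : ℕ} (h : i + 1 < m) : ActsOn m (gen q C i) where
  mul φ k hφ := by
    ext s
    simp only [gen_apply, Pi.mul_apply, hφ i h]
    split_ifs <;> ring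
  congr k hk s s' hs := by
    have hex : k (exchange i s) = k (exchange i s') := hk _ _ fun j hj => by
      simp only [exchange, Function.comp_apply]
      apply hs
      rw [Equiv.swap_apply_def]
      split_ifs <;> omega
    simp only [gen_apply, hs i (by omega), hs (i + 1) h, hk s s' hs, hex]

variable [LinearOrder C]

theorem starts_succ (m : ℕ) (l : List C) (hl : l.length = m) (c : C) :
    starts (m + 1) (l ++ [c]) = (fun s => if s m = c then 1 else 0) * starts m l := by
  ext s
  have : seg m s ++ [s m] = l ++ [c] ↔ s m = c ∧ seg m s = l := by
    constructor
    · intro h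
      obtain ⟨h1, h2⟩ := List.append_inj h (by rw [length_seg, hl])
      exact ⟨by simpa using h2, h1⟩
    · rintro ⟨h1, h2⟩
      rw [h1, h2]
  simp only [starts, seg_succ, Pi.mul_apply, this, ite_and]
  split_ifs <;> simp

theorem starts_congr (m : ℕ) (l : List C) (s s' : ℕ → C) (h : ∀ j < m, s j = s' j) :
    starts m l s = starts m l s' := by simp only [starts, seg_congr h]

/-- The diagonal part of a generator with respect to its second term. -/
def diag (q : ℝ) (m : ℕ) (c : C) (s : ℕ → C) : ℝ :=
  if s m = c then q else if s m < c then q - q⁻¹ else 0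

/-- For a diagonal entry the last colour has to be `c` before and after. Neither `u` nor `v` touches
it, so the exchange term of the generator drops out unless the colours agree, and only its diagonal
part remains. -/
theorem apply_last (q : ℝ) {m : ℕ} {u v : Module.End ℝ ((ℕ → C) → ℝ)} (hu : ActsOn (m + 1) u)
    (hv : ActsOn (m + 1) v) (l : List C) (hl : l.length = m + 1) (c : C) (t : ℕ → C)
    (ht : t (m + 1) = c) :
    (u * gen q C m * v) (starts (m + 1 + 1) (l ++ [c])) t =
      u (diag q m c * v (starts (m + 1) l)) t := by
  set φ : (ℕ → C) → ℝ := fun s => if s (m + 1) = c then 1 else 0 with hφ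
  have hφi : ∀ i, i + 1 < m + 1 → ∀ s : ℕ → C, φ (exchange i s) = φ s := fun i hi s => by
    simp only [hφ, exchange_of_ne s (show m + 1 ≠ i by omega) (show m + 1 ≠ i + 1 by omega)]
  have h1 : φ t = 1 := by simp [hφ, ht]
  have key : ∀ k, u k t = u (φ * k) t := fun k => by
    rw [hu.mul φ k hφi, Pi.mul_apply, h1, one_mul]
  simp only [Module.End.mul_apply]
  rw [starts_succ _ _ hl, hv.mul φ _ hφi, key, key (diag q m c * _)]
  refine congrArg (fun k => u k t) ?_
  ext s
  simp only [Pi.mul_apply, gen_apply, hφ, diag, exchange_right]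
  by_cases h : s (m + 1) = c
  · subst h
    simp only [if_true]
    split_ifs <;> ring
  · simp [h]

end Trace

section PartialTrace

variable {q : ℝ} {N : ℕ}

theorem sum_mu_univ (hq : 1 < q) : (q - q⁻¹) * ∑ c, mu q N c = q ^ N - (q ^ N)⁻¹ := by
  have h0 : q ≠ 0 := by positivity
  have := sum_mu (N := N) hq (x := fun _ => True) 0 N (by omega) le_rfl (by simp)
  simp only [if_true, ← Finset.mul_sum] at this
  rw [this]
  field_simp
  ring

/-- The product of the weights of a list of colours. -/
def weightProd (q : ℝ) (N : ℕ) (l : List (Fin N)) : ℝ := (l.map (mu q N)).prod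

/-- The weighted trace on the `n`-th tensor power. -/
def wtrace (q : ℝ) (N : ℕ) [NeZero N] (n : ℕ) (x : Module.End ℝ ((ℕ → Fin N) → ℝ)) : ℝ :=
  sumLists n fun l => weightProd q N l * x (starts n l) (extend 0 l)

variable [NeZero N]

theorem wtrace_add (n : ℕ) (x y : Module.End ℝ ((ℕ → Fin N) → ℝ)) :
    wtrace q N n (x + y) = wtrace q N n x + wtrace q N n y := by
  simp only [wtrace, LinearMap.add_apply, Pi.add_apply, mul_add, sumLists_add]

theorem wtrace_smul (n : ℕ) (r : ℝ) (x : Module.End ℝ ((ℕ → Fin N) → ℝ)) :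
    wtrace q N n (r • x) = r * wtrace q N n x := by
  simp only [wtrace, LinearMap.smul_apply, Pi.smul_apply, smul_eq_mul, mul_left_comm _ r,
    sumLists_mul]

/-- An additional strand that takes no part closes up to a separate circle. -/
theorem wtrace_succ {m : ℕ} {x : Module.End ℝ ((ℕ → Fin N) → ℝ)} (hx : ActsOn m x) :
    wtrace q N (m + 1) x = (∑ c, mu q N c) * wtrace q N m x := by
  simp only [wtrace, sumLists]
  rw [← sumLists_mul]
  refine sumLists_congr fun l hl => ?_
  rw [Finset.sum_mul]
  refine Finset.sum_congr rfl fun c _ => ?_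
  have h1 : x (starts (m + 1) (l ++ [c])) (extend 0 (l ++ [c])) =
      x (starts m l) (extend 0 l) := by
    rw [starts_succ m l hl, hx.mul]
    · rw [Pi.mul_apply]
      have : extend 0 (l ++ [c]) m = c := by rw [← hl, extend_append_length]
      rw [this, if_pos rfl, one_mul]
      exact hx.congr _ (starts_congr m l) _ _ fun j hj =>
        extend_append_of_lt 0 l [c] (by omega)
    · intro i hi s
      simp only [exchange_of_ne s (show m ≠ i by omega) (show m ≠ i + 1 by omega)]
  rw [h1]
  simp only [weightProd, List.map_append, List.prod_append, List.map_cons, List.map_nil,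
    List.prod_singleton]
  ring

/-- The Markov property: closing the last strand alone turns the last generator into the scalar `q ^
N`. -/
theorem wtrace_last (hq : 1 < q) {m : ℕ} {u v : Module.End ℝ ((ℕ → Fin N) → ℝ)}
    (hu : ActsOn (m + 1) u) (hv : ActsOn (m + 1) v) :
    wtrace q N (m + 1 + 1) (u * gen q (Fin N) m * v) = q ^ N * wtrace q N (m + 1) (u * v) := by
  rw [wtrace, sumLists, wtrace, ← sumLists_mul]
  refine sumLists_congr fun l hl => ?_
  -- The same partial trace as in the first Reidemeister move, for a positive crossing and without
  -- its frame.
  have hdiag : ∀ s : ℕ → Fin N, ∑ c, mu q N c * diag q m c s = q ^ N := by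
    intro s
    have h := sum_smoothCoeff_mul_mu hq true (s m)
    simp only [frame, eigen, if_true, inv_inv] at h
    have h2 : ∑ c, mu q N c * (if s m = c then q else 0) = mu q N (s m) * q := by simp
    rw [← sub_add_cancel (q ^ N) (q * mu q N (s m)), ← h, mul_comm q, ← h2,
      ← Finset.sum_add_distrib]
    refine Finset.sum_congr rfl fun c _ => ?_
    simp only [diag, smoothCoeff, if_true]
    rcases lt_trichotomy (s m) c with h | h | h
    · simp only [h, h.ne, if_true, if_false]; ring
    · simp only [h, lt_irrefl, if_true, if_false]; ring
    · simp only [h.ne', h.not_gt, if_false]; ring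
  have h1 : ∀ c, (u * gen q (Fin N) m * v) (starts (m + 1 + 1) (l ++ [c])) (extend 0 (l ++ [c])) =
      u (diag q m c * v (starts (m + 1) l)) (extend 0 l) := by
    intro c
    rw [apply_last q hu hv l hl c _ (by rw [← hl, extend_append_length])]
    refine hu.congr _ (fun s s' h => ?_) _ _ fun j hj =>
        extend_append_of_lt 0 l [c] (by omega)
    simp only [Pi.mul_apply, diag, h m (by omega), hv.congr _ (starts_congr (m + 1) l) s s' h]
  have h2 : ∑ c, mu q N c • (diag q m c * v (starts (m + 1) l)) =
      q ^ N • v (starts (m + 1) l) := by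
    ext s
    simp only [Finset.sum_apply, Pi.smul_apply, Pi.mul_apply, smul_eq_mul, ← mul_assoc,
      ← Finset.sum_mul, hdiag]
  have h3 := congrFun (congrArg u h2) (extend 0 l)
  simp only [map_sum, map_smul, Finset.sum_apply, Pi.smul_apply, smul_eq_mul] at h3
  simp only [h1, weightProd, List.map_append, List.prod_append, List.map_cons, List.map_nil,
    List.prod_singleton, Module.End.mul_apply]
  rw [mul_left_comm, ← h3, Finset.mul_sum]
  exact Finset.sum_congr rfl fun c _ => by ring

end PartialTrace

end Homfly

end

/-! ### Dependence of the trace on the number of colours -/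

noncomputable section

namespace Homfly

/-- Families of operators on the tensor powers of spaces of all positive dimensions. -/
abbrev Family : Type := (M : ℕ) → Module.End ℝ ((ℕ → Fin (M + 1)) → ℝ)

/-- The generators acting on all tensor powers. -/
def genAll (q : ℝ) (i : ℕ) : Family := fun M => gen q (Fin (M + 1)) i

variable {q : ℝ}

theorem genAll_relations (hq : q ≠ 0) : Hecke.Relations (q - q⁻¹) (genAll q) where
  sq i := funext fun _ => (gen_relations hq).sq i
  braid i := funext fun _ => (gen_relations hq).braid i
  comm i j h := funext fun _ => (gen_relations hq).comm i j h

theorem actsOn_of_mem_strands {m : ℕ} {x : Family} (hx : x ∈ Hecke.strands (genAll q) m) (M : ℕ) :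
    ActsOn m (x M) := by
  induction hx using Algebra.adjoin_induction with
  | mem x hx =>
    obtain ⟨i, hi, rfl⟩ := hx
    exact actsOn_gen q hi
  | algebraMap r =>
    rw [Algebra.algebraMap_eq_smul_one]
    exact (ActsOn.one m).smul r
  | add x y _ _ hx hy => exact hx.add hy
  | mul x y _ _ hx hy => exact hx.comp hy

/-- The strictly decreasing sequence of all colours. -/
def decreasing (M : ℕ) (i : ℕ) : Fin (M + 1) := ⟨M - i, by omega⟩

/-- The diagonal matrix coefficient at the decreasing sequence. -/
def bottom (m M : ℕ) (x : Module.End ℝ ((ℕ → Fin (M + 1)) → ℝ)) : ℝ :=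
  x (starts m (seg m (decreasing M))) (decreasing M)

theorem bottom_succ {m M : ℕ} {x : Module.End ℝ ((ℕ → Fin (M + 1)) → ℝ)} (hx : ActsOn m x) :
    bottom (m + 1) M x = bottom m M x := by
  rw [bottom, seg_succ, starts_succ _ _ (length_seg _ _), hx.mul]
  · simp [bottom]
  · intro i hi s
    simp only [exchange_of_ne s (show m ≠ i by omega) (show m ≠ i + 1 by omega)]

/-- The last colour lies below all earlier ones, and the diagonal part of a generator vanishes when
its second colour is the smaller one. The bound `hM` ensures that the truncated subtraction in
`decreasing` is strict this far. -/
theorem bottom_last {m M : ℕ} (hM : m + 1 + 1 ≤ M + 1)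
    {u v : Module.End ℝ ((ℕ → Fin (M + 1)) → ℝ)} (hu : ActsOn (m + 1) u) (hv : ActsOn (m + 1) v) :
    bottom (m + 1 + 1) M (u * gen q (Fin (M + 1)) m * v) = 0 := by
  rw [bottom, seg_succ, apply_last q hu hv _ (length_seg _ _) _ _ rfl]
  set c := decreasing M (m + 1)
  set φ : (ℕ → Fin (M + 1)) → ℝ := fun s => if ∀ j < m + 1, c < s j then 1 else 0 with hφ
  -- The condition that the first `m + 1` colours exceed `c` is symmetric in them, so it can be
  -- pulled out of `v`.
  have h1 : starts (m + 1) (seg (m + 1) (decreasing M)) =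
      φ * starts (m + 1) (seg (m + 1) (decreasing M)) := by
    ext s
    simp only [starts, Pi.mul_apply, hφ]
    split_ifs with h2 h3
    · simp
    · refine absurd (fun j hj => ?_) h3
      rw [eq_of_seg_eq h2 hj]
      simp only [c, decreasing, Fin.mk_lt_mk]
      omega
    · simp
    · simp
  have h2 : ∀ i, i + 1 < m + 1 → ∀ s : ℕ → Fin (M + 1), φ (exchange i s) = φ s := by
    intro i hi s
    have : (∀ j < m + 1, c < exchange i s j) ↔ ∀ j < m + 1, c < s j := by
      have key : ∀ s : ℕ → Fin (M + 1), (∀ j < m + 1, c < s j) →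
          ∀ j < m + 1, c < exchange i s j := fun s h j hj => by
        apply h
        rw [Equiv.swap_apply_def]
        split_ifs <;> omega
      exact ⟨fun h => by simpa only [exchange_exchange] using key _ h, key s⟩
    simp only [hφ, this]
  have h3 : diag q m c * v (starts (m + 1) (seg (m + 1) (decreasing M))) = 0 := by
    rw [h1, hv.mul φ _ h2]
    ext s
    simp only [Pi.mul_apply, Pi.zero_apply, hφ, diag]
    by_cases h : ∀ j < m + 1, c < s j
    · have := h m (by omega)
      simp [this.ne', this.not_gt]
    · rw [if_neg h]; simp
  rw [h3]
  simp

/-- The weighted traces of a family are the values of a polynomial of small degree. -/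
def IsPolynomial (q : ℝ) (m : ℕ) (x : Family) (G : ℝ[X]) : Prop :=
  G.natDegree ≤ 2 * m ∧
    (∀ M, (q ^ (M + 1)) ^ m * wtrace q (M + 1) m (x M) = G.eval (q ^ (M + 1))) ∧
    ∀ M, m ≤ M + 1 → G.coeff 0 * (-(q - q⁻¹)) ^ m = bottom m M (x M)

theorem IsPolynomial.add {m : ℕ} {x y : Family} {G H : ℝ[X]} (hx : IsPolynomial q m x G)
    (hy : IsPolynomial q m y H) : IsPolynomial q m (x + y) (G + H) := by
  refine ⟨(natDegree_add_le _ _).trans (max_le hx.1 hy.1), fun M => ?_, fun M hM => ?_⟩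
  · rw [Pi.add_apply, wtrace_add, mul_add, hx.2.1, hy.2.1, eval_add]
  · rw [coeff_add, add_mul, hx.2.2 M hM, hy.2.2 M hM]
    rfl

theorem IsPolynomial.smul {m : ℕ} {x : Family} {G : ℝ[X]} (hx : IsPolynomial q m x G) (r : ℝ) :
    IsPolynomial q m (r • x) (r • G) := by
  refine ⟨(natDegree_smul_le _ _).trans hx.1, fun M => ?_, fun M hM => ?_⟩
  · rw [Pi.smul_apply, wtrace_smul, mul_left_comm, hx.2.1, eval_smul, smul_eq_mul]
  · rw [coeff_smul, smul_mul_assoc, hx.2.2 M hM]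
    rfl

/-- With `Q = q ^ N` the circle has the value `(Q - Q⁻¹) / (q - q⁻¹)`, and the normalisation `Q ^ m`
gains one factor `Q`. The constant coefficient is multiplied by `-(q - q⁻¹)⁻¹`, while the entry
`bottom` stays the same. -/
theorem IsPolynomial.succ (hq : 1 < q) {m : ℕ} {x : Family} {G : ℝ[X]}
    (h : x ∈ Hecke.strands (genAll q) m) (hx : IsPolynomial q m x G) :
    IsPolynomial q (m + 1) x ((q - q⁻¹)⁻¹ • ((X ^ 2 - 1) * G)) := by
  have hz : q - q⁻¹ ≠ 0 := by
    have : q⁻¹ < 1 := inv_lt_one_of_one_lt₀ hq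
    linarith
  have h0 : q ≠ 0 := by positivity
  refine ⟨(natDegree_smul_le _ _).trans ?_, fun M => ?_, fun M hM => ?_⟩
  · refine natDegree_mul_le.trans ?_
    have h1 : (X ^ 2 - 1 : ℝ[X]).natDegree ≤ 2 := by compute_degree
    have := hx.1
    omega
  · have h1 := sum_mu_univ (N := M + 1) hq
    have h2 : ∑ c, mu q (M + 1) c = (q - q⁻¹)⁻¹ * (q ^ (M + 1) - (q ^ (M + 1))⁻¹) := by
      rw [← h1, inv_mul_cancel_left₀ hz]
    rw [wtrace_succ (actsOn_of_mem_strands h M), h2]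
    simp only [eval_smul, eval_mul, eval_sub, eval_pow, eval_X, eval_one, smul_eq_mul, ← hx.2.1 M]
    have : q ^ (M + 1) ≠ 0 := pow_ne_zero _ h0
    generalize q ^ (M + 1) = Q at *
    field_simp
    ring
  · rw [bottom_succ (actsOn_of_mem_strands h M), ← hx.2.2 M (by omega)]
    simp only [coeff_smul, mul_coeff_zero, coeff_sub, coeff_X_pow, coeff_one_zero, smul_eq_mul]
    generalize q - q⁻¹ = z at *
    rw [pow_succ]
    field_simp
    norm_num

/-- One factor `X` is the Markov factor, the other comes from the normalisation. The constant
coefficient becomes 0, in accordance with `bottom_last`. -/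
theorem IsPolynomial.last (hq : 1 < q) {m : ℕ} {u v : Family} {G : ℝ[X]}
    (hu : u ∈ Hecke.strands (genAll q) (m + 1)) (hv : v ∈ Hecke.strands (genAll q) (m + 1))
    (h : IsPolynomial q (m + 1) (u * v) G) :
    IsPolynomial q (m + 1 + 1) (u * genAll q m * v) (X ^ 2 * G) := by
  refine ⟨?_, fun M => ?_, fun M hM => ?_⟩
  · refine natDegree_mul_le.trans ?_
    have := h.1
    rw [natDegree_X_pow]
    omega
  · have := h.2.1 M
    rw [Pi.mul_apply] at this
    rw [Pi.mul_apply, Pi.mul_apply, genAll,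
      wtrace_last hq (actsOn_of_mem_strands hu M) (actsOn_of_mem_strands hv M), eval_mul, ← this]
    simp only [eval_pow, eval_X]
    ring
  · rw [Pi.mul_apply, Pi.mul_apply, genAll,
      bottom_last hM (actsOn_of_mem_strands hu M) (actsOn_of_mem_strands hv M)]
    simp [mul_coeff_zero]

/-- Induction on the strands through the spanning set of `Hecke.Relations.strands_succ_le`. Working
with families ensures that one polynomial serves all numbers of colours. -/
theorem exists_isPolynomial (hq : 1 < q) (m : ℕ) {x : Family}
    (hx : x ∈ Hecke.strands (genAll q) m) : ∃ G, IsPolynomial q m x G := by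
  have h0 : q ≠ 0 := by positivity
  induction m generalizing x with
  | zero =>
    rw [Hecke.strands_le_bot _ (by omega)] at hx
    obtain ⟨r, rfl⟩ := Algebra.mem_bot.1 hx
    refine ⟨r • 1, ?_⟩
    rw [Algebra.algebraMap_eq_smul_one]
    refine IsPolynomial.smul ⟨by simp, fun M => ?_, fun M _ => ?_⟩ r
    · simp [wtrace, sumLists, weightProd, starts, seg]
    · simp [bottom, starts]
  | succ m ih =>
    rcases m with _ | m
    -- The spanning set is available only from one strand on; with zero or one strands the algebra
    -- consists of scalars.
    · rw [Hecke.strands_le_bot _ (by omega), ← Hecke.strands_le_bot (genAll q) zero_le_one] at hx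
      obtain ⟨G, hG⟩ := ih hx
      exact ⟨_, hG.succ hq hx⟩
    · have hx' := (genAll_relations h0).strands_succ_le (m + 1) (by omega) hx
      clear hx
      induction hx' using Submodule.span_induction with
      | zero => exact ⟨0, by simp, fun M => by
          simpa using Or.inr (wtrace_smul (q := q) (N := M + 1) (m + 1 + 1) 0 0),
          fun M _ => by simp [bottom]⟩
      | add x y _ _ hx hy =>
        obtain ⟨G, hG⟩ := hx
        obtain ⟨H, hH⟩ := hy
        exact ⟨_, hG.add hH⟩
      | smul r x _ hx =>
        obtain ⟨G, hG⟩ := hx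
        exact ⟨_, hG.smul r⟩
      | mem x hx =>
        rcases hx with hx | ⟨u, hu, v, hv, rfl⟩
        · obtain ⟨G, hG⟩ := ih hx
          exact ⟨_, hG.succ hq hx⟩
        · obtain ⟨G, hG⟩ := ih (mul_mem hu hv)
          exact ⟨_, hG.last hq hu hv⟩

end Homfly

end

noncomputable section

namespace Homfly

/-! ### The state sum of the closure of a braid -/

section Closure

variable {q : ℝ} {N : ℕ}

theorem act_append (p : Piece) {i : ℕ} (l s : List (Bool × Fin N)) (hl : l.length = i) (k) :
    act q N p i (l ++ s) k = act q N p 0 s fun o => k (l ++ o) := by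
  subst hl
  induction l generalizing k with
  | nil => rfl
  | cons v l ih => exact ih _

/-- Strands pointing upwards. -/
def ups (l : List (Fin N)) : List (Bool × Fin N) := l.map fun c => (true, c)

/-- Strands pointing downwards. -/
def downs (l : List (Fin N)) : List (Bool × Fin N) := l.map fun c => (false, c)

theorem run_cups (n : ℕ) (k) :
    run q N [] ((List.range n).map fun j => ⟨.cup true, j⟩) k =
      sumLists n fun l => k (ups l ++ downs l.reverse) := by
  induction n generalizing k with
  | zero => rfl
  | succ n ih =>
    rw [List.range_succ, List.map_append, run_append, ih, sumLists]
    refine sumLists_congr fun l hl => ?_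
    simp only [List.map_cons, List.map_nil, run]
    rw [act_append _ _ _ (by simp [ups, hl])]
    simp [act, actHead, cupWeight, ups, downs]

theorem run_caps (n : ℕ) (l l' : List (Fin N)) (hl : l.length = n) (hl' : l'.length = n) :
    run q N (ups l' ++ downs l.reverse) ((List.range n).reverse.map fun j => ⟨.cap, j⟩)
      (fun s => if s = [] then 1 else 0) = weightProd q N l * if l' = l then 1 else 0 := by
  induction n generalizing l l' with
  | zero =>
    rw [List.length_eq_zero_iff.1 hl, List.length_eq_zero_iff.1 hl']
    simp [run, ups, downs, weightProd]
  | succ n ih =>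
    obtain ⟨l, c, rfl⟩ := (List.eq_nil_or_concat' l).resolve_left (by rintro rfl; simp at hl)
    obtain ⟨l', c', rfl⟩ := (List.eq_nil_or_concat' l').resolve_left (by rintro rfl; simp at hl')
    have hl : l.length = n := by simpa using hl
    have hl' : l'.length = n := by simpa using hl'
    have h : (List.range (n + 1)).reverse = n :: (List.range n).reverse := by
      simp [List.range_succ]
    rw [h, List.map_cons, run]
    have h2 : ups (l' ++ [c']) ++ downs (l ++ [c]).reverse =
        ups l' ++ ((true, c') :: (false, c) :: downs l.reverse) := by simp [ups, downs]
    have h3 : l' ++ [c'] = l ++ [c] ↔ l' = l ∧ c' = c := by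
      constructor
      · intro h
        obtain ⟨h1, h2⟩ := List.append_inj h (by rw [hl, hl'])
        exact ⟨h1, by simpa using h2⟩
      · rintro ⟨rfl, rfl⟩; rfl
    simp only [h2]
    rw [act_append _ _ _ (by simp [ups, hl'])]
    simp only [act, actHead, Bool.not_true, true_and, ih l l' hl hl', h3]
    simp only [weightProd, List.map_append, List.prod_append, List.map_cons, List.map_nil,
      List.prod_singleton, capWeight, if_true]
    by_cases hc : c' = c <;> by_cases hll : l' = l <;> simp [hc, hll, mul_comm]

/-- The operator of a letter. -/
def letterOp (q : ℝ) (c : ℕ × Bool) : Family :=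
  if c.2 then genAll q c.1 else genAll q c.1 - (q - q⁻¹) • 1

/-- The operator of a braid word. -/
def wordOp (q : ℝ) {n : ℕ} (w : List (Fin (n - 1) × Bool)) : Family :=
  (w.map fun c => letterOp q (c.1, c.2)).prod

theorem seg_eq (n i : ℕ) (h : i + 1 < n) {C : Type*} (s : ℕ → C) :
    seg n s = seg i s ++ s i :: s (i + 1) :: (List.range' (i + 2) (n - 2 - i)).map s := by
  have : List.range n = List.range i ++ i :: (i + 1) :: List.range' (i + 2) (n - 2 - i) := by
    have h1 : n = i + (1 + (1 + (n - 2 - i))) := by omega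
    conv_lhs => rw [h1, List.range_eq_range', ← List.range'_append_1, ← List.range'_append_1,
      ← List.range'_append_1]
    simp [List.range_eq_range', add_assoc]
  rw [seg, this]
  simp [seg]

/-- Between upward strands a crossing acts as a Hecke generator or as its inverse `g - (q - q⁻¹)`,
apart from the frame; the returning strands `r` are spectators. -/
theorem run_letter (M : ℕ) {n : ℕ} (i : ℕ) (hi : i + 1 < n) (e : Bool) (s : ℕ → Fin (M + 1))
    (r : List (Bool × Fin (M + 1))) (k) :
    act q (M + 1) (.cross e) i (ups (seg n s) ++ r) k =
      frame q (M + 1) e * letterOp q (i, e) M (fun s' => k (ups (seg n s') ++ r)) s := by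
  have h1 : ups (seg n s) ++ r = ups (seg i s) ++ ((true, s i) :: (true, s (i + 1)) ::
      (ups ((List.range' (i + 2) (n - 2 - i)).map s) ++ r)) := by
    rw [seg_eq n i hi]; simp [ups]
  have h2 : ups (seg n (exchange i s)) ++ r = ups (seg i s) ++ ((true, s (i + 1)) ::
      (true, s i) :: (ups ((List.range' (i + 2) (n - 2 - i)).map s) ++ r)) := by
    have h3 : seg i (exchange i s) = seg i s := seg_congr fun j hj =>
      exchange_of_ne s (by omega) (by omega)
    have h4 : (List.range' (i + 2) (n - 2 - i)).map (exchange i s) =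
        (List.range' (i + 2) (n - 2 - i)).map s := List.map_congr_left fun j hj => by
      rw [List.mem_range'_1] at hj
      exact exchange_of_ne s (by omega) (by omega)
    rw [seg_eq n i hi, h3, h4, exchange_left, exchange_right]; simp [ups]
  have h5 : act q (M + 1) (.cross e) i (ups (seg n s) ++ r) k =
      frame q (M + 1) e * ((if s i = s (i + 1) then eigen q e else 1) *
        k (ups (seg n (exchange i s)) ++ r) +
        smoothCoeff q (M + 1) e (s i) (s (i + 1)) * k (ups (seg n s) ++ r)) := by
    rw [h2, h1]
    rw [act_append _ _ _ (by simp [ups, length_seg])]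
    simp only [act, actHead]
    rw [sum_weight_same e true _ _ fun y x => k (ups (seg i s) ++ ((true, y) :: (true, x) ::
      (ups ((List.range' (i + 2) (n - 2 - i)).map s) ++ r)))]
    simp
  rw [h5]
  congr 1
  rcases lt_trichotomy (s i) (s (i + 1)) with h | h | h
  · cases e
    · simp [letterOp, genAll, gen_apply, smoothCoeff, h, h.ne, h.not_gt]
    · simp [letterOp, genAll, gen_apply, smoothCoeff, h, h.ne]
  · cases e
    · simp [letterOp, genAll, gen_apply, smoothCoeff, h, exchange_of_eq h, eigen]
      ring
    · simp [letterOp, genAll, gen_apply, smoothCoeff, h, exchange_of_eq h, eigen]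
  · cases e
    · simp [letterOp, genAll, gen_apply, smoothCoeff, h, h.ne', h.not_gt]
      ring
    · simp [letterOp, genAll, gen_apply, smoothCoeff, h.ne', h.not_gt]

theorem run_word (M : ℕ) {n : ℕ} (w : List (Fin (n - 1) × Bool)) (s : ℕ → Fin (M + 1))
    (r : List (Bool × Fin (M + 1))) (k) :
    run q (M + 1) (ups (seg n s) ++ r) (w.map fun c => ⟨.cross c.2, (c.1 : ℕ)⟩) k =
      (w.map fun c => frame q (M + 1) c.2).prod *
        wordOp q w M (fun s' => k (ups (seg n s') ++ r)) s := by
  induction w generalizing s with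
  | nil => simp [run, wordOp]
  | cons c w ih =>
    have hc : (c.1 : ℕ) + 1 < n := by omega
    simp only [List.map_cons, run]
    rw [run_letter M _ hc]
    simp only [ih, wordOp, List.map_cons, List.prod_cons, Pi.mul_apply, Module.End.mul_apply]
    have := fun x : (ℕ → Fin (M + 1)) → ℝ => (letterOp q (c.1, c.2) M).map_smul
      (w.map fun c => frame q (M + 1) c.2).prod x
    have := congrFun (this ((w.map fun c => letterOp q (↑c.1, c.2)).prod M
      fun s' => k (ups (seg n s') ++ r))) s
    simp only [Pi.smul_apply, smul_eq_mul] at this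
    rw [mul_assoc, ← this]
    rfl

theorem stateSum_braidClosure (M n : ℕ) (w : List (Fin (n - 1) × Bool)) :
    stateSum q (M + 1) (braidClosure n w) =
      (w.map fun c => frame q (M + 1) c.2).prod * wtrace q (M + 1) n (wordOp q w M) := by
  simp only [stateSum, braidClosure, closureSlices, List.append_assoc]
  rw [run_append, run_cups, wtrace, ← sumLists_mul]
  refine sumLists_congr fun l hl => ?_
  rw [run_append]
  have h1 : ups l = ups (seg n (extend 0 l)) := by rw [← hl, seg_extend]
  rw [h1, run_word]
  congr 1
  -- The maxima force the final colours to equal the initial ones, so the word operator is applied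
  -- to the indicator of `l` and evaluated at `l`: a diagonal entry.
  have h2 : (fun s' : ℕ → Fin (M + 1) => run q (M + 1) (ups (seg n s') ++ downs l.reverse)
      ((List.range n).reverse.map fun j => ⟨.cap, j⟩) fun s => if s = [] then 1 else 0) =
      weightProd q (M + 1) l • starts n l := by
    ext s
    rw [run_caps n l _ hl (length_seg _ _)]
    rfl
  rw [h2, map_smul]
  rfl

end Closure

end Homfly

end

noncomputable section

namespace Homfly

/-! ### Positive braids -/

section Positive

variable {C : Type*}

theorem seg_split {n : ℕ} {s : ℕ → C} {p r : List C} {x y : C} (h : seg n s = p ++ x :: y :: r) :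
    s p.length = x ∧ s (p.length + 1) = y ∧
      seg n (exchange p.length s) = p ++ y :: x :: r := by
  have hn : p.length + 1 < n := by
    have := congrArg List.length h
    rw [length_seg] at this
    simp at this
    omega
  have h1 := seg_eq n p.length hn s
  rw [h] at h1
  obtain ⟨h2, h3⟩ := List.append_inj h1 (by rw [length_seg])
  simp only [List.cons.injEq] at h3
  obtain ⟨h3, h4, h5⟩ := h3
  refine ⟨h3.symm, h4.symm, ?_⟩
  have h6 : seg p.length (exchange p.length s) = seg p.length s := seg_congr fun j hj =>
    exchange_of_ne s (by omega) (by omega)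
  have h7 : (List.range' (p.length + 2) (n - 2 - p.length)).map (exchange p.length s) =
      (List.range' (p.length + 2) (n - 2 - p.length)).map s := List.map_congr_left fun j hj => by
    rw [List.mem_range'_1] at hj
    exact exchange_of_ne s (by omega) (by omega)
  rw [seg_eq n _ hn, h6, h7, exchange_left, exchange_right, ← h2, ← h3, ← h4, ← h5]

variable [LinearOrder C] {q : ℝ}

/-- The operator of a positive word. -/
def posOp (q : ℝ) (C : Type*) [LinearOrder C] (w : List ℕ) : Module.End ℝ ((ℕ → C) → ℝ) :=
  (w.map (gen q C)).prod

theorem posOp_cons (i : ℕ) (w : List ℕ) (k : (ℕ → C) → ℝ) :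
    posOp q C (i :: w) k = gen q C i (posOp q C w k) := by
  simp [posOp]

/-- The entries of a generator are `q`, `1`, `q - q⁻¹` and 0, none of them negative for `q > 1`;
positive words allow no cancellation. -/
theorem posOp_nonneg (hq : 1 < q) (w : List ℕ) {k : (ℕ → C) → ℝ} (hk : ∀ s, 0 ≤ k s) (s : ℕ → C) :
    0 ≤ posOp q C w k s := by
  have hz : 0 < q - q⁻¹ := by
    have : q⁻¹ < 1 := inv_lt_one_of_one_lt₀ hq
    linarith
  have h0 : 0 < q := by positivity
  induction w generalizing s with
  | nil => simpa [posOp] using hk s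
  | cons i w ih =>
    rw [posOp_cons, gen_apply]
    split_ifs
    · exact mul_nonneg h0.le (ih s)
    · exact add_nonneg (ih _) (mul_nonneg hz.le (ih s))
    · simpa using ih _

theorem posOp_const (w : List ℕ) {n : ℕ} (hw : ∀ i ∈ w, i + 1 < n) (k : (ℕ → C) → ℝ) {s : ℕ → C}
    {c : C} (hs : ∀ j < n, s j = c) : posOp q C w k s = q ^ w.length * k s := by
  induction w with
  | nil => simp [posOp]
  | cons i w ih =>
    have hi : i + 1 < n := hw i (by simp)
    rw [posOp_cons, gen_apply, if_pos (by rw [hs i (by omega), hs (i + 1) hi]),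
      ih fun j hj => hw j (by simp [hj]), List.length_cons, pow_succ']
    ring

/-- The arrangements that contribute to the action of a positive word. -/
inductive Reach : List ℕ → List C → List C → Prop
  | nil (l : List C) : Reach [] l l
  | swap (p : List C) (x y : C) (r : List C) (w : List ℕ) (l : List C) :
      Reach w (p ++ y :: x :: r) l → Reach (p.length :: w) (p ++ x :: y :: r) l
  | stay (p : List C) (x y : C) (r : List C) (w : List ℕ) (l : List C) (h : x < y) :
      Reach w (p ++ x :: y :: r) l → Reach (p.length :: w) (p ++ x :: y :: r) l

theorem Reach.trans {u v : List ℕ} {l₁ l₂ l₃ : List C} (h : Reach u l₁ l₂) (h' : Reach v l₂ l₃) :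
    Reach (u ++ v) l₁ l₃ := by
  induction h with
  | nil => exact h'
  | swap p x y r w l _ ih => exact Reach.swap p x y r _ _ (ih h')
  | stay p x y r w l hxy _ ih => exact Reach.stay p x y r _ _ hxy (ih h')

/-- A single path of positive entries makes the value positive, since all other contributions are
non-negative. -/
theorem Reach.pos (hq : 1 < q) {w : List ℕ} {l l' : List C} (h : Reach w l l') {n : ℕ}
    {k : (ℕ → C) → ℝ} (hk : ∀ s, 0 ≤ k s) (hk' : ∀ s, seg n s = l' → 0 < k s) {s : ℕ → C}
    (hs : seg n s = l) : 0 < posOp q C w k s := by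
  have hz : 0 < q - q⁻¹ := by
    have : q⁻¹ < 1 := inv_lt_one_of_one_lt₀ hq
    linarith
  have h0 : 0 < q := by positivity
  induction h generalizing s with
  | nil => simpa [posOp] using hk' s hs
  | swap p x y r w l' _ ih =>
    obtain ⟨h1, h2, h3⟩ := seg_split hs
    have h4 := ih hk' h3
    have h5 := posOp_nonneg hq w hk s
    rw [posOp_cons, gen_apply]
    split_ifs with h6 h7
    · rw [exchange_of_eq h6] at h4
      exact mul_pos h0 h4
    · exact add_pos_of_pos_of_nonneg h4 (mul_nonneg hz.le h5)
    · simpa using h4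
  | stay p x y r w l' hxy _ ih =>
    obtain ⟨h1, h2, -⟩ := seg_split hs
    have h4 := ih hk' hs
    have h5 := posOp_nonneg hq w hk (exchange p.length s)
    have h6 : s p.length < s (p.length + 1) := by rwa [h1, h2]
    rw [posOp_cons, gen_apply, if_neg h6.ne, if_pos h6]
    exact add_pos_of_nonneg_of_pos h5 (mul_pos hz h4)

theorem reach_carry (p : List C) (x : C) (r : List C) :
    Reach (List.range' p.length r.length) (p ++ x :: r) (p ++ r ++ [x]) := by
  induction r generalizing p with
  | nil => simpa using Reach.nil _
  | cons y r ih =>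
    rw [List.length_cons, List.range'_succ]
    refine Reach.swap p x y r _ _ ?_
    have := ih (p ++ [y])
    simpa using this

/-- The pass carries `x` as far as `y`, uses the permission to stay at `x < y`, and carries `y` on
to the end. -/
theorem reach_drop (x : C) (r₁ : List C) (y : C) (r₂ : List C) (h : x < y) :
    Reach (List.range (r₁.length + 1 + r₂.length)) (x :: r₁ ++ y :: r₂)
      (r₁ ++ x :: r₂ ++ [y]) := by
  have h1 := reach_carry [] x r₁
  have h2 := reach_carry (r₁ ++ [x]) y r₂
  have h3 : Reach [r₁.length] (r₁ ++ x :: y :: r₂) (r₁ ++ x :: y :: r₂) :=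
    Reach.stay r₁ x y r₂ [] _ h (Reach.nil _)
  have h4 : ∀ (p l : List C) (w : List ℕ) (t : List C), Reach w p l → Reach w (p ++ t) (l ++ t) := by
    intro p l w t h
    induction h with
    | nil => exact Reach.nil _
    | swap p x y r w l _ ih => simpa using Reach.swap p x y (r ++ t) w _ (by simpa using ih)
    | stay p x y r w l hxy _ ih => simpa using Reach.stay p x y (r ++ t) w _ hxy (by simpa using ih)
  have h5 := h4 _ _ _ (y :: r₂) h1
  have h6 : List.range (r₁.length + 1 + r₂.length) =
      List.range' 0 r₁.length ++ ([r₁.length] ++ List.range' (r₁.length + 1) r₂.length) := by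
    rw [List.range_eq_range', add_assoc, ← List.range'_append_1, ← List.range'_append_1]
    simp
  rw [h6]
  refine Reach.trans (l₂ := r₁ ++ x :: y :: r₂) ?_ (Reach.trans h3 ?_)
  · simpa using h5
  · simpa using h2

/-- After `j` passes from a decreasing arrangement, the first `j` entries may have been moved to the
end in any order. -/
theorem reach_passes {n : ℕ} {v : List C} (hn : v.length = n) (hv : v.Pairwise (· > ·)) (j : ℕ)
    (hj : j ≤ n) (l : List C) (hl : l.Perm (v.take j)) :
    Reach (List.replicate j (List.range (n - 1))).flatten v (v.drop j ++ l) := by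
  induction j generalizing l with
  | zero => simpa [List.Perm.eq_nil (by simpa using hl)] using Reach.nil v
  | succ j ih =>
    have hjn : j < v.length := by omega
    have h1 : v.take (j + 1) = v.take j ++ [v[j]] := List.take_succ_eq_append_getElem hjn
    have h2 : v.drop j = v[j] :: v.drop (j + 1) := List.drop_eq_getElem_cons hjn
    rw [h1] at hl
    have hmem : v[j] ∈ l := hl.mem_iff.2 (List.mem_append_right _ (by simp))
    obtain ⟨l₁, l₂, rfl⟩ := List.append_of_mem hmem
    have hl' : (l₁ ++ l₂).Perm (v.take j) := by
      have h3 : (v[j] :: (l₁ ++ l₂)).Perm (v[j] :: v.take j) :=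
        List.perm_middle.symm.trans (hl.trans (List.perm_append_singleton _ _))
      exact h3.cons_inv
    have hlen : l₁.length + l₂.length = j := by
      have := hl'.length_eq
      simp at this
      omega
    rw [List.replicate_succ', List.flatten_append]
    simp only [List.flatten_cons, List.flatten_nil, List.append_nil]
    -- If `v[j]` is to come last, it is carried all the way. Otherwise the preceding passes put the
    -- intended last entry `y` at its place, and the next pass drops `v[j]` there and moves `y` to
    -- the end.
    rcases List.eq_nil_or_concat' l₂ with rfl | ⟨l₂, y, rfl⟩
    · refine (ih (by omega) l₁ (by simpa using hl')).trans ?_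
      have := reach_carry [] v[j] (v.drop (j + 1) ++ l₁)
      rw [h2]
      have h4 : (v.drop (j + 1) ++ l₁).length = n - 1 := by
        simp at hlen ⊢; omega
      rw [h4] at this
      simpa [List.range_eq_range', -List.getElem_cons_drop] using this
    -- `y` precedes `v[j]` in the decreasing list, so it is larger and staying is allowed.
    · have hy : v[j] < y := by
        have : y ∈ v.take j := hl'.mem_iff.1 (by simp)
        obtain ⟨i, hi, rfl⟩ := List.mem_iff_getElem.1 this
        simp only [List.length_take, List.getElem_take] at hi ⊢
        exact List.pairwise_iff_getElem.1 hv i j _ _ (by omega)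
      refine (ih (by omega) (l₁ ++ y :: l₂) ?_).trans ?_
      · refine List.Perm.trans ?_ hl'
        exact List.Perm.append_left _ (List.perm_append_singleton y l₂).symm
      · have := reach_drop v[j] (v.drop (j + 1) ++ l₁) y l₂ hy
        rw [h2]
        have h4 : (v.drop (j + 1) ++ l₁).length + 1 + l₂.length = n - 1 := by
          simp at hlen ⊢; omega
        rw [h4] at this
        simpa [-List.getElem_cons_drop] using this

/-- Follow the permutation of the word backwards, using exchanges only. -/
theorem exists_reach (u : List ℕ) (l : List C) (hu : ∀ i ∈ u, i + 1 < l.length) :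
    ∃ l' : List C, l'.Perm l ∧ Reach u l' l := by
  induction u with
  | nil => exact ⟨l, .refl l, .nil l⟩
  | cons i u ih =>
    obtain ⟨l', hl', h⟩ := ih fun j hj => hu j (by simp [hj])
    have hi : i + 1 < l'.length := by rw [hl'.length_eq]; exact hu i (by simp)
    have h1 : l' = l'.take i ++ l'[i] :: l'[i + 1] :: l'.drop (i + 2) := by
      rw [← List.drop_eq_getElem_cons, ← List.drop_eq_getElem_cons, List.take_append_drop]
    have h2 : (l'.take i).length = i := by simp; omega
    generalize l'.take i = p at *
    generalize l'.drop (i + 2) = r at *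
    generalize l'[i] = x at *
    generalize l'[i + 1] = y at *
    subst h1
    refine ⟨p ++ y :: x :: r, ?_, ?_⟩
    · exact (List.Perm.append_left p (List.Perm.swap x y r)).trans hl'
    · have := Reach.swap p y x r u l h
      rwa [h2] at this

/-- The full twist leads from `v` to every rearrangement, in particular to the one from which `u`
leads back to `v`. This is where the full twist enters the bound on the braid index. -/
theorem reach_twist {n : ℕ} {v : List C} (hn : v.length = n) (hv : v.Pairwise (· > ·))
    (u : List ℕ) (hu : ∀ i ∈ u, i + 1 < n) :
    Reach ((List.replicate n (List.range (n - 1))).flatten ++ u) v v := by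
  obtain ⟨l, hl, h⟩ := exists_reach u v (by rwa [hn])
  refine Reach.trans ?_ h
  have := reach_passes hn hv n le_rfl l (by rwa [List.take_of_length_le hn.le])
  rwa [List.drop_of_length_le hn.le, List.nil_append] at this

end Positive

end Homfly

end

/-! ### The braid index of a twist positive closure -/

noncomputable section

namespace Homfly

variable {q : ℝ}

/-- The generators as units. -/
def genUnit (hq : q ≠ 0) (i : ℕ) : Familyˣ where
  val := genAll q i
  inv := genAll q i - (q - q⁻¹) • 1
  val_inv := by
    rw [mul_sub, (genAll_relations hq).sq, mul_smul_comm, mul_one, add_sub_cancel_left]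
  inv_val := by
    rw [sub_mul, (genAll_relations hq).sq, smul_mul_assoc, one_mul, add_sub_cancel_left]

/-- The action of the braid group on all tensor powers. -/
def braidHom (hq : q ≠ 0) (n : ℕ) : BraidGroup n →* Familyˣ :=
  PresentedGroup.toGroup (f := fun i : Fin (n - 1) => genUnit hq i) (by
    rintro r (⟨i, j, hij, rfl⟩ | ⟨i, j, hij, rfl⟩)
    · simp only [map_mul, map_inv, FreeGroup.lift_apply_of, mul_inv_eq_one]
      exact Units.ext ((genAll_relations hq).comm i j hij)
    · simp only [map_mul, map_inv, FreeGroup.lift_apply_of, mul_inv_eq_one]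
      refine Units.ext ?_
      simp only [← hij]
      exact (genAll_relations hq).braid i)

theorem braidHom_sigma (hq : q ≠ 0) {n : ℕ} (i : Fin (n - 1)) :
    braidHom hq n (BraidGroup.sigma i) = genUnit hq i := PresentedGroup.toGroup.of _

theorem braidHom_ofWord (hq : q ≠ 0) {n : ℕ} (w : List (Fin (n - 1) × Bool)) :
    (braidHom hq n (BraidGroup.ofWord w) : Family) = wordOp q w := by
  have h : braidHom hq n (BraidGroup.ofWord w) =
      (w.map fun x => cond x.2 (genUnit hq x.1) (genUnit hq x.1)⁻¹).prod := rfl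
  rw [h, wordOp, ← Units.coeHom_apply, map_list_prod, List.map_map]
  congr 1
  refine List.map_congr_left fun c _ => ?_
  rcases c with ⟨i, _ | _⟩ <;> rfl

theorem wordOp_mem_strands {n : ℕ} (w : List (Fin (n - 1) × Bool)) :
    wordOp q w ∈ Hecke.strands (genAll q) n := by
  refine list_prod_mem fun x hx => ?_
  obtain ⟨⟨i, e⟩, -, rfl⟩ := List.mem_map.1 hx
  have h := Hecke.gen_mem_strands (genAll q) (show (i : ℕ) + 1 < n by omega)
  cases e
  · exact sub_mem h (Subalgebra.smul_mem _ (one_mem _) _)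
  · exact h

theorem list_prod_apply (l : List Family) (M : ℕ) : l.prod M = (l.map (· M)).prod := by
  induction l with
  | nil => rfl
  | cons x l ih => simp [ih]

theorem exists_posOp (hq : q ≠ 0) {n : ℕ} {β : BraidGroup n} (h : β.IsTwistPositive) :
    ∃ u : List ℕ, (∀ i ∈ u, i + 1 < n) ∧ ∀ M, (braidHom hq n β : Family) M =
      posOp q (Fin (M + 1)) ((List.replicate n (List.range (n - 1))).flatten ++ u) := by
  obtain ⟨γ, hγ, rfl⟩ := h
  have h1 : ∃ u : List ℕ, (∀ i ∈ u, i + 1 < n) ∧ (braidHom hq n γ : Family) =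
      (u.map (genAll q)).prod := by
    induction hγ using Submonoid.closure_induction with
    | mem x hx =>
      obtain ⟨i, rfl⟩ := hx
      refine ⟨[i], by simp; omega, ?_⟩
      rw [braidHom_sigma]
      simp [genUnit]
    | one => exact ⟨[], by simp, by simp⟩
    | mul x y _ _ hx hy =>
      obtain ⟨u, hu, hu'⟩ := hx
      obtain ⟨v, hv, hv'⟩ := hy
      refine ⟨u ++ v, ?_, by rw [map_mul, Units.val_mul, hu', hv']; simp⟩
      intro i hi
      rcases List.mem_append.1 hi with h | h
      · exact hu i h
      · exact hv i h
  obtain ⟨u, hu, hu'⟩ := h1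
  refine ⟨u, hu, fun M => ?_⟩
  have h2 : (braidHom hq n (BraidGroup.fullTwist n) : Family) =
      ((List.replicate n (List.range (n - 1))).flatten.map (genAll q)).prod := by
    rw [BraidGroup.fullTwist, map_pow, map_list_prod, Units.val_pow_eq_pow_val,
      ← Units.coeHom_apply, map_list_prod, List.map_map, List.map_flatten, List.prod_flatten,
      List.map_map, List.map_replicate, List.prod_replicate]
    congr 2
    rw [List.map_ofFn, ← List.map_coe_finRange_eq_range, List.ofFn_eq_map, List.map_map]
    refine List.map_congr_left fun i _ => ?_
    simp only [Function.comp_apply, braidHom_sigma]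
    rfl
  rw [map_mul, Units.val_mul, hu', h2, ← List.prod_append, ← List.map_append, list_prod_apply,
    List.map_map, posOp]
  rfl

theorem seg_decreasing_pairwise {n M : ℕ} (h : n ≤ M + 1) :
    (seg n (decreasing M)).Pairwise (· > ·) := by
  rw [seg, List.pairwise_map]
  refine (List.pairwise_lt_range (n := n)).imp_of_mem ?_
  intro i j hi hj hij
  have := List.mem_range.1 hj
  simp only [decreasing, gt_iff_lt, Fin.mk_lt_mk]
  omega

theorem starts_nonneg {C : Type*} [LinearOrder C] (n : ℕ) (l : List C) (s : ℕ → C) :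
    0 ≤ starts n l s := by
  unfold starts; split_ifs <;> norm_num

theorem mu_pos (hq : 1 < q) {N : ℕ} (x : Fin N) : 0 < mu q N x := by
  have : 0 < q := by positivity
  unfold mu; positivity

theorem weightProd_pos (hq : 1 < q) {N : ℕ} (l : List (Fin N)) : 0 < weightProd q N l :=
  List.prod_pos fun x hx => by
    obtain ⟨c, -, rfl⟩ := List.mem_map.1 hx
    exact mu_pos hq c

/-- The polynomial of a positive braid with a full twist has maximal span. -/
theorem coeff_ne_zero_of_isTwistPositive (hq : 1 < q) (h0 : q ≠ 0) {n : ℕ} {β : BraidGroup n}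
    (h : β.IsTwistPositive) {G : ℝ[X]} (hG : IsPolynomial q n (braidHom h0 n β) G) :
    G.coeff 0 ≠ 0 ∧ G.natDegree = 2 * n := by
  obtain ⟨u, hu, hβ⟩ := exists_posOp h0 h
  set w := (List.replicate n (List.range (n - 1))).flatten ++ u with hw
  have hw' : ∀ i ∈ w, i + 1 < n := by
    intro i hi
    rcases List.mem_append.1 hi with h | h
    · simp only [List.mem_flatten, List.mem_replicate] at h
      obtain ⟨l, ⟨-, rfl⟩, hi⟩ := h
      have := List.mem_range.1 hi
      omega
    · exact hu i h
  constructor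
  · intro hc
    -- With `n + 1` colours there is a strictly decreasing sequence of length `n`.
    have h1 := hG.2.2 n (by omega)
    rw [hc, zero_mul, hβ, bottom] at h1
    refine h1.not_lt ?_
    refine (reach_twist (length_seg _ _) (seg_decreasing_pairwise (by omega)) u hu).pos hq
      (starts_nonneg _ _) (fun s hs => ?_) rfl
    simp [starts, hs]
  · refine le_antisymm hG.1 (not_lt.1 fun hlt => ?_)
    have hqn : Filter.Tendsto (fun M : ℕ => q ^ (M + 1)) Filter.atTop Filter.atTop :=
      (tendsto_pow_atTop_atTop_of_one_lt hq).comp (Filter.tendsto_add_atTop_nat 1)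
    have hdeg : G.degree < (X ^ (2 * n) : ℝ[X]).degree := by
      rw [degree_X_pow]
      exact lt_of_le_of_lt degree_le_natDegree (by exact_mod_cast hlt)
    have ht := (div_tendsto_atTop_zero_of_degree_lt G (X ^ (2 * n)) hdeg).comp hqn
    -- If the degree were smaller than `2 * n`, the quotient by `X ^ (2 * n)` would tend to 0 along
    -- `q ^ (M + 1)`; this bound rules that out.
    have hle : ∀ M : ℕ, (q ^ n)⁻¹ ≤
        ((fun x => eval x G / eval x (X ^ (2 * n) : ℝ[X])) ∘ fun M => q ^ (M + 1)) M := by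
      intro M
      simp only [Function.comp_apply, ← hG.2.1 M, eval_pow, eval_X, hβ]
      have h2 : (q ^ M) ^ n ≤ wtrace q (M + 1) n (posOp q (Fin (M + 1)) w) := by
        -- Keep only the colouring of all strands by the largest colour: each letter multiplies by
        -- `q`, and each strand has weight `q ^ M`.
        have h3 := le_sumLists (n := n) (F := fun l => weightProd q (M + 1) l *
          posOp q (Fin (M + 1)) w (starts n l) (extend 0 l)) (fun l _ =>
            mul_nonneg (weightProd_pos hq l).le (posOp_nonneg hq w (starts_nonneg n l) _))
            (l := List.replicate n (Fin.last M)) (by simp)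
        refine le_trans ?_ h3
        have h4 : seg n (extend 0 (List.replicate n (Fin.last M))) =
            List.replicate n (Fin.last M) := by
          simpa using seg_extend 0 (List.replicate n (Fin.last M))
        rw [posOp_const w hw' _ (c := Fin.last M) fun j hj => by simp [extend, hj]]
        have h5 : mu q (M + 1) (Fin.last M) = q ^ M := by
          simp only [mu, Fin.val_last]
          field_simp
          ring
        simp only [starts, h4, if_true, weightProd, List.map_replicate, List.prod_replicate, h5]
        have h6 : 1 ≤ q ^ w.length := one_le_pow₀ hq.le
        have h7 : 0 < (q ^ M) ^ n := by positivity
        nlinarith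
      have hQ : 0 < q ^ (M + 1) := by positivity
      rw [le_div_iff₀ (by positivity)]
      calc (q ^ n)⁻¹ * (q ^ (M + 1)) ^ (2 * n) = (q ^ (M + 1)) ^ n * (q ^ M) ^ n := by
            rw [inv_mul_eq_iff_eq_mul₀ (by positivity)]
            ring
        _ ≤ _ := by gcongr
    have := ge_of_tendsto' ht hle
    have : 0 < (q ^ n)⁻¹ := by positivity
    linarith

/-- The frames multiply to `q ^ N` to the power minus the writhe. Two natural exponents replace the
integer one, so that polynomials can be compared. -/
theorem prod_frame (hq : 1 < q) {n : ℕ} (w : List (Fin (n - 1) × Bool)) :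
    ∃ a b : ℕ, ∀ N, (w.map fun c => frame q N c.2).prod * (q ^ N) ^ a = (q ^ N) ^ b := by
  induction w with
  | nil => exact ⟨0, 0, fun N => by simp⟩
  | cons c w ih =>
    obtain ⟨a, b, h⟩ := ih
    have h0 : q ≠ 0 := by positivity
    rcases c with ⟨i, _ | _⟩
    · refine ⟨a, b + 1, fun N => ?_⟩
      rw [List.map_cons, List.prod_cons, mul_assoc, h, pow_succ']
      simp [frame]
    · refine ⟨a + 1, b, fun N => ?_⟩
      rw [List.map_cons, List.prod_cons, ← h N]
      have h1 : frame q N true * q ^ N = 1 := by simp [frame, h0]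
      linear_combination ((w.map fun c => frame q N c.2).prod * (q ^ N) ^ a) * h1

/-- Braids on fewer strands cannot have the same closure as a positive braid with a full twist. -/
theorem le_of_isClosureOf {n m : ℕ} {K : LinkDiagram} {β : BraidGroup n} {α : BraidGroup m}
    (hβ : β.IsTwistPositive) (hKβ : K.IsClosureOf β) (hKα : K.IsClosureOf α) : n ≤ m := by
  obtain ⟨q, hq⟩ : ∃ q : ℝ, 1 < q := ⟨2, by norm_num⟩
  have h0 : q ≠ 0 := by positivity
  obtain ⟨w, rfl, hw⟩ := hKβ
  obtain ⟨w', rfl, hw'⟩ := hKα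
  obtain ⟨G, hG⟩ := exists_isPolynomial hq n (wordOp_mem_strands (q := q) w)
  obtain ⟨H, hH⟩ := exists_isPolynomial hq m (wordOp_mem_strands (q := q) w')
  obtain ⟨hG0, hGn⟩ := coeff_ne_zero_of_isTwistPositive hq h0 hβ
    (by rw [braidHom_ofWord]; exact hG)
  obtain ⟨a, b, hab⟩ := prod_frame hq w
  obtain ⟨a', b', hab'⟩ := prod_frame hq w'
  -- The two closures have equal state sums for every number of colours, hence the polynomials agree
  -- at infinitely many points `q ^ (M + 1)`.
  have key : (X ^ (b + a' + m) * G : ℝ[X]) = X ^ (b' + a + n) * H := by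
    refine eq_of_infinite_eval_eq _ _ ?_
    refine Set.infinite_of_injective_forall_mem (f := fun M : ℕ => q ^ (M + 1)) ?_ ?_
    · intro M M' h
      have := pow_right_injective₀ (by positivity) hq.ne' h
      omega
    · intro M
      have h1 : stateSum q (M + 1) (braidClosure n w) = stateSum q (M + 1) (braidClosure m w') :=
        (stateSum_eq_of_isotopic hq hw).symm.trans (stateSum_eq_of_isotopic hq hw')
      rw [stateSum_braidClosure, stateSum_braidClosure] at h1
      have h2 := hab (M + 1)
      have h3 := hab' (M + 1)
      simp only [Set.mem_ofPred_eq, eval_mul, eval_pow, eval_X, ← hG.2.1 M, ← hH.2.1 M]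
      generalize q ^ (M + 1) = Q at *
      rw [pow_add, pow_add, pow_add, pow_add, ← h2, ← h3]
      linear_combination (Q ^ a * Q ^ a' * Q ^ m * Q ^ n) * h1
  have hG' : G ≠ 0 := fun h => hG0 (by simp [h])
  have hH' : H ≠ 0 := by
    rintro rfl
    rw [mul_zero] at key
    exact hG' ((mul_eq_zero.1 key).resolve_left (pow_ne_zero _ X_ne_zero))
  have hdeg := congrArg natDegree key
  rw [natDegree_mul (pow_ne_zero _ X_ne_zero) hG', natDegree_mul (pow_ne_zero _ X_ne_zero) hH',
    natDegree_X_pow, natDegree_X_pow, hGn] at hdeg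
  have hHm := hH.1
  by_contra hlt
  -- If `m < n`, the degrees force the left side to start in a lower degree than the right side,
  -- which contradicts the non-zero constant coefficient of `G`.
  have h4 : b + a' + m < b' + a + n := by omega
  have h5 := congrArg (fun p => coeff p (b + a' + m)) key
  simp only [coeff_X_pow_mul'] at h5
  rw [if_pos le_rfl, if_neg (by omega), Nat.sub_self] at h5
  exact hG0 h5

end Homfly

theorem LinkDiagram.braidIndex_eq_of_isTwistPositive {n : ℕ} {K : LinkDiagram}
    (h : K.IsTwistPositive n) : K.braidIndex = n := by
  obtain ⟨β, hβ, hK⟩ := h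
  have hmem : n ∈ {m | ∃ β : BraidGroup m, K.IsClosureOf β} := ⟨β, hK⟩
  refine le_antisymm (Nat.sInf_le hmem) ?_
  obtain ⟨α, hα⟩ := Nat.sInf_mem ⟨n, hmem⟩
  exact Homfly.le_of_isClosureOf hβ hK hα

end

noncomputable section

/-! ## Elementary ideals -/

/-- The arguments are moved from `S` into its span one at a time. It is applied to determinants, in
the rows and in the functionals. -/
theorem MultilinearMap.mem_of_mem_span {R ι V W : Type*} [CommRing R] [Fintype ι] [DecidableEq ι]
    [AddCommGroup V] [Module R V] [AddCommGroup W] [Module R W]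
    (f : MultilinearMap R (fun _ : ι => V) W) (S : Set V) (P : Submodule R W)
    (h : ∀ v : ι → V, (∀ i, v i ∈ S) → f v ∈ P) (v : ι → V)
    (hv : ∀ i, v i ∈ Submodule.span R S) : f v ∈ P := by
  have key : ∀ t : Finset ι, ∀ v : ι → V, (∀ i ∈ t, v i ∈ Submodule.span R S) →
      (∀ i ∉ t, v i ∈ S) → f v ∈ P := by
    intro t
    induction t using Finset.induction_on with
    | empty => exact fun v _ h' => h v fun i => h' i (by simp)
    | insert a t ha ih =>
      intro v hv hv'
      rw [← Function.update_eq_self a v]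
      have := hv a (by simp)
      generalize v a = x at this ⊢
      induction this using Submodule.span_induction with
      | mem x hx =>
        refine ih _ (fun i hi => ?_) (fun i hi => ?_)
        · rw [Function.update_of_ne (by rintro rfl; exact ha hi)]
          exact hv i (by simp [hi])
        · by_cases hia : i = a
          · subst hia; simpa using hx
          · rw [Function.update_of_ne hia]
            exact hv' i (by simp [hia, hi])
      | zero => rw [f.map_update_zero]; exact P.zero_mem
      | add x y _ _ hx hy => rw [f.map_update_add]; exact P.add_mem hx hy
      | smul r x _ hx => rw [f.map_update_smul]; exact P.smul_mem r hx
  exact key Finset.univ v (fun i _ => hv i) (by simp)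

namespace Submodule

variable {R : Type*} [CommRing R] {V V' : Type*} [AddCommGroup V'] [Module R V'] [AddCommGroup V]
  [Module R V]

/-- The ideal generated by the determinants of `s` elements of `K` paired with `s` functionals. -/
def minorIdeal (s : ℕ) (K : Submodule R V) : Ideal R :=
  Ideal.span {d | ∃ (κ : Fin s → V) (φ : Fin s → Module.Dual R V), (∀ i, κ i ∈ K) ∧
    d = (Matrix.of fun i j => φ j (κ i)).det}

theorem det_mem_minorIdeal {s : ℕ} {K : Submodule R V} (κ : Fin s → V)
    (φ : Fin s → Module.Dual R V) (h : ∀ i, κ i ∈ K) :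
    (Matrix.of fun i j => φ j (κ i)).det ∈ minorIdeal s K :=
  Ideal.subset_span ⟨κ, φ, h, rfl⟩

/-- Since arbitrary functionals are allowed instead of coordinates, `minorIdeal` mentions no basis
and is transported by isomorphisms. -/
theorem minorIdeal_le_map (s : ℕ) (K : Submodule R V) (e : V ≃ₗ[R] V') :
    minorIdeal s K ≤ minorIdeal s (K.map (e : V →ₗ[R] V')) := by
  refine Ideal.span_le.2 ?_
  rintro _ ⟨κ, φ, hκ, rfl⟩
  have := det_mem_minorIdeal (K := K.map (e : V →ₗ[R] V')) (fun i => e (κ i))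
    (fun j => (φ j).comp (e.symm : V' →ₗ[R] V)) (fun i => mem_map_of_mem (hκ i))
  simpa using this

theorem minorIdeal_map (s : ℕ) (K : Submodule R V) (e : V ≃ₗ[R] V') :
    minorIdeal s (K.map (e : V →ₗ[R] V')) = minorIdeal s K := by
  refine le_antisymm ?_ (minorIdeal_le_map s K e)
  have := minorIdeal_le_map s (K.map (e : V →ₗ[R] V')) e.symm
  rwa [← map_comp, LinearEquiv.comp_coe, LinearEquiv.self_trans_symm, LinearEquiv.refl_toLinearMap,
    map_id] at this

/-- A rank one perturbation changes a determinant by a combination of minors that are smaller by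
one. -/
theorem det_add_mem {s : ℕ} (J : Ideal R) (A : Matrix (Fin (s + 1)) (Fin (s + 1)) R)
    (hA : ∀ i j, (A.submatrix (Fin.succAbove i) (Fin.succAbove j)).det ∈ J)
    (y c : Fin (s + 1) → R) : (Matrix.of fun i j => A i j + y i * c j).det ∈ J := by
  have hdetA : A.det ∈ J := by
    rw [Matrix.det_succ_row_zero]
    exact J.sum_mem fun j _ => J.mul_mem_left _ (hA 0 j)
  -- Border `A` by the row `(1, -c)` and the column `(1, y)`. Clearing the column leaves `A + y c`;
  -- expanding along both borders leaves `A` itself and its minors.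
  let B : Matrix (Fin (s + 1 + 1)) (Fin (s + 1 + 1)) R :=
    Matrix.of fun i j => Fin.cases (Fin.cases 1 (fun j => -c j) j)
      (fun i => Fin.cases (y i) (fun j => A i j) j) i
  let B' : Matrix (Fin (s + 1 + 1)) (Fin (s + 1 + 1)) R :=
    Matrix.of fun i j => Fin.cases (Fin.cases 1 (fun j => -c j) j)
      (fun i => Fin.cases 0 (fun j => A i j + y i * c j) j) i
  have h1 : B.det = B'.det := by
    refine Matrix.det_eq_of_forall_row_eq_smul_add_const (Fin.cases 0 y) 0 rfl ?_
    intro i j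
    refine Fin.cases ?_ (fun i => ?_) i <;> refine Fin.cases ?_ (fun j => ?_) j <;> simp [B, B']
  have h2 : B'.det = (Matrix.of fun i j => A i j + y i * c j).det := by
    rw [Matrix.det_succ_column_zero, Fin.sum_univ_succ]
    have h3 : ∑ i : Fin (s + 1), (-1) ^ (i.succ : ℕ) * B' i.succ 0 *
        (B'.submatrix i.succ.succAbove Fin.succ).det = 0 :=
      Finset.sum_eq_zero fun i _ => by simp [B']
    rw [h3, add_zero]
    have h4 : B'.submatrix (Fin.succAbove 0) Fin.succ = Matrix.of fun i j => A i j + y i * c j := by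
      ext i j; simp [B']
    rw [h4]
    simp [B']
  rw [← h2, ← h1, Matrix.det_succ_row_zero, Fin.sum_univ_succ]
  refine J.add_mem (J.mul_mem_left _ ?_) (J.sum_mem fun j _ => J.mul_mem_left _ ?_)
  · have : B.submatrix Fin.succ (Fin.succAbove 0) = A := by ext i j; simp [B]
    rwa [this]
  · rw [Matrix.det_succ_column_zero]
    refine J.sum_mem fun i _ => J.mul_mem_left _ ?_
    convert hA i j using 2
    ext a b
    simp [B]

/-- In terms of presentations, a new generator is added together with a relation that kills it. The
extra coordinate contributes a rank one term to each matrix, so `det_add_mem` applies; conversely, a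
minor is bordered by a 1. -/
theorem minorIdeal_prod_top (s : ℕ) (K : Submodule R V) :
    minorIdeal (s + 1) (K.prod (⊤ : Submodule R R)) = minorIdeal s K := by
  apply le_antisymm
  · refine Ideal.span_le.2 ?_
    rintro _ ⟨κ, φ, hκ, rfl⟩
    have h := det_add_mem (minorIdeal s K) (Matrix.of fun i j => φ j ((κ i).1, 0)) (fun i j => ?_)
      (fun i => (κ i).2) (fun j => φ j (0, 1))
    · have h0 : (Matrix.of fun i j => φ j (κ i)) = Matrix.of fun i j =>
          (Matrix.of fun i j => φ j ((κ i).1, 0)) i j + (κ i).2 * φ j (0, 1) := ?_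
      · rw [← h0] at h
        exact h
      ext i j
      have h2 : κ i = ((κ i).1, 0) + (κ i).2 • ((0, 1) : V × R) := by ext <;> simp
      simp only [Matrix.of_apply]
      conv_lhs => rw [h2]
      rw [map_add, map_smul, smul_eq_mul]
    · exact det_mem_minorIdeal (fun a => (κ (i.succAbove a)).1)
        (fun b => (φ (j.succAbove b)).comp (LinearMap.inl R V R)) fun a => (hκ _).1
  · refine Ideal.span_le.2 ?_
    rintro _ ⟨κ, φ, hκ, rfl⟩
    have h := det_mem_minorIdeal (K := K.prod (⊤ : Submodule R R))
      (Fin.cons (0, 1) fun i => (κ i, 0))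
      (Fin.cons (LinearMap.snd R V R) fun j => (φ j).comp (LinearMap.fst R V R)) (by
        refine Fin.cases ?_ ?_
        · simp
        · intro i; simpa using hκ i)
    rw [Matrix.det_succ_row_zero, Fin.sum_univ_succ, Finset.sum_eq_zero, add_zero] at h
    · simp only [Fin.val_zero, pow_zero, one_mul, Matrix.of_apply, Fin.cons_zero,
        LinearMap.snd_apply] at h
      have h0 : (Matrix.of fun i j => φ j (κ i)) = Matrix.submatrix (Matrix.of fun i j =>
          (Fin.cons (LinearMap.snd R V R) (fun j => φ j ∘ₗ LinearMap.fst R V R) :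
            Fin (s + 1) → Module.Dual R (V × R)) j
          ((Fin.cons (0, 1) (fun i => (κ i, 0)) : Fin (s + 1) → V × R) i))
            Fin.succ (Fin.succAbove 0) := by
        ext i j
        simp
      rw [h0]
      exact h
    · intro j _
      simp

theorem minorIdeal_prod_top_pi (s n : ℕ) (K : Submodule R V) :
    minorIdeal (s + n) (K.prod (⊤ : Submodule R (Fin n → R))) = minorIdeal s K := by
  induction n with
  | zero =>
    rw [add_zero, ← minorIdeal_map s K
      (LinearEquiv.prodUnique (R := R) (M := V) (M₂ := Fin 0 → R)).symm]
    congr 1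
    ext x
    simp only [mem_prod, mem_top, and_true, mem_map]
    constructor
    · exact fun h => ⟨x.1, h, Prod.ext rfl (Subsingleton.elim _ _)⟩
    · rintro ⟨y, hy, rfl⟩
      simpa using hy
  | succ n ih =>
    let e : ((V × (Fin n → R)) × R) ≃ₗ[R] (V × (Fin (n + 1) → R)) :=
      LinearEquiv.ofLinearMap
        (LinearMap.prod ((LinearMap.fst R V _).comp (LinearMap.fst R _ R))
          (LinearMap.pi (Fin.cons (LinearMap.snd R _ R) fun i =>
            (LinearMap.proj i).comp ((LinearMap.snd R V _).comp (LinearMap.fst R _ R)))))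
        (LinearMap.prod (LinearMap.prod (LinearMap.fst R V _)
          (LinearMap.pi fun i => (LinearMap.proj i.succ).comp (LinearMap.snd R V _)))
          ((LinearMap.proj 0).comp (LinearMap.snd R V _)))
        (by
          refine LinearMap.ext fun x => Prod.ext rfl (funext fun i => ?_)
          refine Fin.cases ?_ (fun i => ?_) i <;> simp)
        (by
          refine LinearMap.ext fun x => Prod.ext (Prod.ext rfl (funext fun i => ?_)) ?_ <;> simp)
    have h := minorIdeal_prod_top (s + n) (K.prod (⊤ : Submodule R (Fin n → R)))
    rw [← ih, ← add_assoc, ← h, ← minorIdeal_map _ _ e]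
    congr 1
    ext x
    simp only [mem_prod, mem_top, and_true, mem_map]
    constructor
    · exact fun h => ⟨e.symm x, h, e.apply_symm_apply x⟩
    · rintro ⟨y, hy, rfl⟩
      exact hy

variable {M : Type*} [AddCommGroup M] [Module R M]

/-- Redundant generators do no harm: lift `π'` through `π` and shear by the lift; the kernel becomes
`ker π` times everything. -/
theorem minorIdeal_ker_coprod (s n : ℕ) (π : V →ₗ[R] M) (hπ : Function.Surjective π)
    (π' : (Fin n → R) →ₗ[R] M) :
    minorIdeal (s + n) (LinearMap.ker (π.coprod π')) = minorIdeal s (LinearMap.ker π) := by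
  obtain ⟨L, hL⟩ := Module.projective_lifting_property π π' hπ
  have hL' : ∀ y, π (L y) = π' y := fun y => by rw [← hL]; rfl
  let e : (V × (Fin n → R)) ≃ₗ[R] (V × (Fin n → R)) :=
    LinearEquiv.ofLinearMap
      (LinearMap.prod (LinearMap.fst R _ _ + L.comp (LinearMap.snd R _ _)) (LinearMap.snd R _ _))
      (LinearMap.prod (LinearMap.fst R _ _ - L.comp (LinearMap.snd R _ _)) (LinearMap.snd R _ _))
      (by refine LinearMap.ext fun x => Prod.ext ?_ rfl; simp)
      (by refine LinearMap.ext fun x => Prod.ext ?_ rfl; simp)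
  have he : ∀ x, e x = (x.1 + L x.2, x.2) := fun x => rfl
  rw [← minorIdeal_prod_top_pi s n, ← minorIdeal_map _ _ e]
  congr 1
  ext x
  simp only [mem_prod, mem_top, and_true, mem_map, LinearMap.mem_ker]
  constructor
  · rintro ⟨y, hy, rfl⟩
    simpa [he, hL'] using hy
  · intro hx
    refine ⟨e.symm x, ?_, e.apply_symm_apply x⟩
    obtain ⟨y, rfl⟩ := e.surjective x
    rw [e.symm_apply_apply]
    simpa [he, hL'] using hx

/-- The first elementary ideal of a module does not depend on its presentation. -/
theorem minorIdeal_eq_of_surjective {n n' : ℕ} (hn : 1 ≤ n) (hn' : 1 ≤ n')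
    (π : (Fin n → R) →ₗ[R] M) (hπ : Function.Surjective π) (π' : (Fin n' → R) →ₗ[R] M)
    (hπ' : Function.Surjective π') :
    minorIdeal (n - 1) (LinearMap.ker π) = minorIdeal (n' - 1) (LinearMap.ker π') := by
  -- Both presentations are compared with the one on the union of their generators. The bounds `1 ≤
  -- n` and `1 ≤ n'` make the two sizes equal despite truncated subtraction.
  rw [← minorIdeal_ker_coprod (n - 1) n' π hπ π', ← minorIdeal_ker_coprod (n' - 1) n π' hπ' π,
    show n - 1 + n' = n' - 1 + n by omega,
    ← minorIdeal_map _ _ (LinearEquiv.prodComm R (Fin n → R) (Fin n' → R))]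
  congr 1
  ext x
  simp only [mem_map, LinearMap.mem_ker]
  constructor
  · rintro ⟨y, hy, rfl⟩
    simpa [add_comm] using hy
  · intro hx
    exact ⟨(x.2, x.1), by simpa [add_comm] using hx, rfl⟩

/-- Multilinearity in the functionals reduces to coordinates, multilinearity in the rows to the
generators. -/
theorem minorIdeal_span {ι : Type*} (s n : ℕ) (r : ι → Fin n → R) :
    minorIdeal s (span R (Set.range r)) =
      Ideal.span {d | ∃ (f : Fin s → ι) (g : Fin s → Fin n),
        d = (Matrix.submatrix r f g).det} := by
  set J := Ideal.span {d | ∃ (f : Fin s → ι) (g : Fin s → Fin n),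
    d = (Matrix.submatrix r f g).det} with hJ
  apply le_antisymm
  · have h1 : ∀ (φ : Fin s → Module.Dual R (Fin n → R)) (f : Fin s → ι),
        (Matrix.of fun i j => φ j (r (f i))).det ∈ J := by
      intro φ f
      let F : MultilinearMap R (fun _ : Fin s => Module.Dual R (Fin n → R)) R :=
        (Matrix.detRowAlternating (R := R) (n := Fin s)).toMultilinearMap.compLinearMap fun _ =>
          LinearMap.pi fun i => Module.Dual.eval R _ (r (f i))
      have hF : ∀ φ, F φ = (Matrix.of fun i j => φ j (r (f i))).det := fun φ => by
        rw [← Matrix.det_transpose]; rfl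
      rw [← hF]
      refine F.mem_of_mem_span (Set.range fun b : Fin n => (LinearMap.proj b : (Fin n → R) →ₗ[R] R))
        J ?_ φ fun j => ?_
      · intro ψ hψ
        choose g hg using hψ
        rw [hF]
        refine Ideal.subset_span ⟨f, g, ?_⟩
        congr 1
        ext i j
        simp [← hg]
        rfl
      · have : φ j = ∑ b, φ j (Pi.single b 1) • (LinearMap.proj b : (Fin n → R) →ₗ[R] R) := by
          refine LinearMap.pi_ext' fun b => LinearMap.ext_ring ?_
          simp [Pi.single_apply]
        rw [this]
        exact sum_mem fun b _ => smul_mem _ _ (subset_span ⟨b, rfl⟩)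
    refine Ideal.span_le.2 ?_
    rintro _ ⟨κ, φ, hκ, rfl⟩
    let F : MultilinearMap R (fun _ : Fin s => Fin n → R) R :=
      (Matrix.detRowAlternating (R := R) (n := Fin s)).toMultilinearMap.compLinearMap fun _ =>
        LinearMap.pi φ
    have hF : ∀ κ, F κ = (Matrix.of fun i j => φ j (κ i)).det := fun κ => rfl
    rw [← hF]
    refine F.mem_of_mem_span (Set.range r) J ?_ κ hκ
    intro v hv
    choose f hf using hv
    have := h1 φ f
    simp only [hf] at this
    exact this
  · refine Ideal.span_le.2 ?_
    rintro _ ⟨f, g, rfl⟩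
    exact det_mem_minorIdeal (fun i => r (f i)) (fun j => LinearMap.proj (g j))
      fun i => subset_span ⟨f i, rfl⟩

end Submodule

end

noncomputable section

/-! ## The Alexander module of a diagram -/

/-- A module with a list of directed strands coloured by its elements. -/
structure Marked : Type 1 where
  M : Type
  [grp : AddCommGroup M]
  [mod : Module ℤ[T;T⁻¹] M]
  strands : List (Bool × M)

attribute [instance] Marked.grp Marked.mod

namespace Marked

section

variable {M M' M'' : Type} [AddCommGroup M''] [Module ℤ[T;T⁻¹] M''] [AddCommGroup M']
  [Module ℤ[T;T⁻¹] M'] [AddCommGroup M] [Module ℤ[T;T⁻¹] M]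

/-- The colour of an arc after passing under an arc of colour `o`; `s` tells whether it passes from
the left to the right of that arc. -/
def under (s : Bool) (o u : M) : M :=
  (1 - T (if s then 1 else -1) : ℤ[T;T⁻¹]) • o + (T (if s then 1 else -1) : ℤ[T;T⁻¹]) • u

theorem map_under (f : M →ₗ[ℤ[T;T⁻¹]] M') (s : Bool) (o u : M) :
    f (under s o u) = under s (f o) (f u) := by
  simp [under]

theorem map_under' (f : M ≃ₗ[ℤ[T;T⁻¹]] M') (s : Bool) (o u : M) :
    f (under s o u) = under s (f o) (f u) := map_under (f : M →ₗ[ℤ[T;T⁻¹]] M') s o u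

theorem under_self (s : Bool) (o : M) : under s o o = o := by
  rw [under, ← add_smul, sub_add_cancel, one_smul]

theorem T_mul_T_not (s : Bool) :
    (T (if s then 1 else -1) * T (if !s then 1 else -1) : ℤ[T;T⁻¹]) = 1 := by
  rw [← T_add, ← T_zero]; cases s <;> rfl

theorem under_under_not (s : Bool) (o u : M) : under s o (under (!s) o u) = u := by
  have h := T_mul_T_not s
  simp only [under, smul_add, smul_smul, mul_sub, h, mul_one]
  module

theorem under_not_under (s : Bool) (o u : M) : under (!s) o (under s o u) = u := by
  simpa using under_under_not (!s) o u

/-- Self-distributivity of the Alexander quandle, which is the third Reidemeister move. -/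
theorem under_distrib (s s' : Bool) (o p u : M) :
    under s o (under s' p u) = under s' (under s o p) (under s o u) := by
  simp only [under]
  module

/-- Change the colours of strands by a linear map. -/
def mapS (f : M →ₗ[ℤ[T;T⁻¹]] M') (l : List (Bool × M)) : List (Bool × M') :=
  l.map fun v => (v.1, f v.2)

@[simp] theorem mapS_nil (f : M →ₗ[ℤ[T;T⁻¹]] M') : mapS f [] = [] := rfl

@[simp] theorem mapS_cons (f : M →ₗ[ℤ[T;T⁻¹]] M') (v : Bool × M) (l : List (Bool × M)) :
    mapS f (v :: l) = (v.1, f v.2) :: mapS f l := rfl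

@[simp] theorem mapS_append (f : M →ₗ[ℤ[T;T⁻¹]] M') (l r : List (Bool × M)) :
    mapS f (l ++ r) = mapS f l ++ mapS f r := List.map_append

@[simp] theorem length_mapS (f : M →ₗ[ℤ[T;T⁻¹]] M') (l : List (Bool × M)) :
    (mapS f l).length = l.length := List.length_map _

theorem mapS_mapS (g : M' →ₗ[ℤ[T;T⁻¹]] M'') (f : M →ₗ[ℤ[T;T⁻¹]] M') (l : List (Bool × M)) :
    mapS g (mapS f l) = mapS (g.comp f) l := by
  simp [mapS, Function.comp_def]

theorem mapS_id (l : List (Bool × M)) : mapS LinearMap.id l = l := by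
  simp [mapS]

theorem map_fst_mapS (f : M →ₗ[ℤ[T;T⁻¹]] M') (l : List (Bool × M)) :
    (mapS f l).map Prod.fst = l.map Prod.fst := by
  simp [mapS, Function.comp_def]

/-- The effect of a piece with the strands `l` on its left: a minimum adds a free generator, a
maximum identifies two colours, and a crossing changes the colour of the strand below. -/
def head : Piece → (l r : List (Bool × M)) → Marked
  | .cup b, l, r =>
      ⟨M × ℤ[T;T⁻¹], mapS (LinearMap.inl _ _ _) l ++ (b, (0, 1)) :: (!b, (0, 1)) ::
        mapS (LinearMap.inl _ _ _) r⟩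
  | .cap, l, (_, x) :: (_, y) :: r =>
      ⟨M ⧸ Submodule.span ℤ[T;T⁻¹] {x - y}, mapS (Submodule.mkQ _) (l ++ r)⟩
  | .cross true, l, (a, x) :: (b, y) :: r => ⟨M, l ++ (b, under (!a) x y) :: (a, x) :: r⟩
  | .cross false, l, (a, x) :: (b, y) :: r => ⟨M, l ++ (b, y) :: (a, under b y x) :: r⟩
  | _, l, r => ⟨M, l ++ r⟩

/-- Two marked modules are isomorphic. -/
def Iso (X Y : Marked) : Prop :=
  ∃ e : X.M ≃ₗ[ℤ[T;T⁻¹]] Y.M, mapS (e : X.M →ₗ[ℤ[T;T⁻¹]] Y.M) X.strands = Y.strands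

theorem Iso.refl (X : Marked) : Iso X X := ⟨LinearEquiv.refl _ _, mapS_id _⟩

theorem Iso.of_eq {X Y : Marked} (h : X = Y) : Iso X Y := h ▸ Iso.refl X

theorem Iso.trans {X Y Z : Marked} (h : Iso X Y) (h' : Iso Y Z) : Iso X Z := by
  obtain ⟨e, he⟩ := h
  obtain ⟨e', he'⟩ := h'
  exact ⟨e.trans e', by rw [← he', ← he, mapS_mapS]; rfl⟩

theorem Iso.symm {X Y : Marked} (h : Iso X Y) : Iso Y X := by
  obtain ⟨e, he⟩ := h
  refine ⟨e.symm, ?_⟩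
  rw [← he, mapS_mapS, LinearEquiv.comp_coe, LinearEquiv.self_trans_symm,
    LinearEquiv.refl_toLinearMap, mapS_id]

theorem iso_of_ker {K : Submodule ℤ[T;T⁻¹] M} (f : M →ₗ[ℤ[T;T⁻¹]] M')
    (hf : Function.Surjective f) (hK : LinearMap.ker f = K) (s : List (Bool × M)) :
    Iso ⟨M ⧸ K, mapS K.mkQ s⟩ ⟨M', mapS f s⟩ := by
  subst hK
  exact ⟨f.quotKerEquivOfSurjective hf, by rw [mapS_mapS]; rfl⟩

theorem iso_of_equiv (e : M ≃ₗ[ℤ[T;T⁻¹]] M') {s : List (Bool × M)} {s' : List (Bool × M')}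
    (h : mapS (e : M →ₗ[ℤ[T;T⁻¹]] M') s = s') : Iso ⟨M, s⟩ ⟨M', s'⟩ := ⟨e, h⟩

theorem head_map (p : Piece) (e : M ≃ₗ[ℤ[T;T⁻¹]] M') (l r : List (Bool × M)) :
    Iso (head p l r) (head p (mapS (e : M →ₗ[ℤ[T;T⁻¹]] M') l)
      (mapS (e : M →ₗ[ℤ[T;T⁻¹]] M') r)) := by
  have key (s : List (Bool × M)) :
    Iso ⟨M, s⟩ ⟨M', mapS (e : M →ₗ[ℤ[T;T⁻¹]] M') s⟩ := ⟨e, rfl⟩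
  rcases p with b | _ | c
  · refine iso_of_equiv (e.prodCongr (LinearEquiv.refl _ _)) ?_
    simp only [mapS_append, mapS_cons, mapS_mapS]
    refine congrArg₂ _ ?_ (congrArg₂ _ ?_ (congrArg₂ _ ?_ ?_))
    · congr 1
    · simp
    · simp
    · congr 1
  · rcases r with _ | ⟨⟨a, x⟩, _ | ⟨⟨b, y⟩, r⟩⟩
    · simpa [head] using key l
    · simpa [head] using key (l ++ [(a, x)])
    · simp only [head, mapS_cons, ← mapS_append]
      rw [mapS_mapS]
      refine iso_of_ker _ (by
        rw [LinearMap.coe_comp]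
        exact (Submodule.mkQ_surjective _).comp e.surjective) ?_ _
      ext z
      simp only [LinearMap.mem_ker, LinearMap.comp_apply, Submodule.mkQ_apply,
        Submodule.Quotient.mk_eq_zero, Submodule.mem_span_singleton, LinearEquiv.coe_coe]
      simp only [← map_sub, ← map_smul, e.injective.eq_iff]
  · rcases r with _ | ⟨⟨a, x⟩, _ | ⟨⟨b, y⟩, r⟩⟩
    · simpa [head] using key l
    · simpa [head] using key (l ++ [(a, x)])
    · cases c
      · simpa [head, map_under'] using
          key (l ++ (b, y) :: (a, under b y x) :: r)
      · simpa [head, map_under'] using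
          key (l ++ (b, under (!a) x y) :: (a, x) :: r)

end

/-- The effect of a slice. -/
def step (X : Marked) (e : Slice) : Marked :=
  head e.piece (X.strands.take e.pos) (X.strands.drop e.pos)

/-- The effect of a list of slices. -/
def run : Marked → List Slice → Marked
  | X, [] => X
  | X, e :: w => (X.step e).run w

theorem run_append (X : Marked) (u v : List Slice) : X.run (u ++ v) = (X.run u).run v := by
  induction u generalizing X with
  | nil => rfl
  | cons e u ih => exact ih _

theorem step_eq {X : Marked} {p : Piece} {i : ℕ} {l r : List (Bool × X.M)}
    (h : X.strands = l ++ r) (hi : i = l.length) : X.step ⟨p, i⟩ = head p l r := by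
  subst hi
  simp [step, h]

theorem Iso.step {X Y : Marked} (h : Iso X Y) (e : Slice) : Iso (X.step e) (Y.step e) := by
  obtain ⟨f, hf⟩ := h
  have := head_map e.piece f (X.strands.take e.pos) (X.strands.drop e.pos)
  rwa [mapS, mapS, List.map_take, List.map_drop, ← mapS, hf] at this

theorem Iso.run {X Y : Marked} (h : Iso X Y) (w : List Slice) : Iso (X.run w) (Y.run w) := by
  induction w generalizing X Y with
  | nil => exact h
  | cons e w ih => exact ih (h.step e)

end Marked

end

/-! ### Tietze isomorphisms and interchanges of minima and maxima -/

noncomputable section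

theorem Piece.exists_split {M : Type} {p : Piece} {i : ℕ} {s : List (Bool × M)} {d : List Bool}
    (h : p.dirAct i (s.map Prod.fst) = some d) :
    ∃ l r : List (Bool × M), ∃ d', s = l ++ r ∧ i = l.length ∧
      p.dirHead (r.map Prod.fst) = some d' ∧ d = l.map Prod.fst ++ d' := by
  induction i generalizing s d with
  | zero => exact ⟨[], s, d, rfl, rfl, h, rfl⟩
  | succ i ih =>
    cases s with
    | nil => simp [Piece.dirAct] at h
    | cons v s =>
      simp only [List.map_cons, Piece.dirAct, Option.map_eq_some_iff] at h
      obtain ⟨d', hd', rfl⟩ := h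
      obtain ⟨l, r, d'', rfl, rfl, h1, rfl⟩ := ih hd'
      exact ⟨v :: l, r, d'', rfl, rfl, h1, rfl⟩

theorem Piece.exists_split_inputs {M : Type} {p : Piece} {i : ℕ} {s : List (Bool × M)}
    {d : List Bool} (h : p.dirAct i (s.map Prod.fst) = some d) :
    ∃ l P r : List (Bool × M), s = l ++ (P ++ r) ∧ l.length = i ∧ P.length = p.inputs := by
  obtain ⟨l, r, d', rfl, rfl, h', rfl⟩ := Piece.exists_split h
  clear h
  rcases p with b | _ | e
  · exact ⟨l, [], r, rfl, rfl, rfl⟩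
  all_goals
    rcases r with _ | ⟨v, _ | ⟨v', r⟩⟩
    · simp [Piece.dirHead] at h'
    · simp [Piece.dirHead] at h'
    · exact ⟨l, [v, v'], r, rfl, rfl, rfl⟩

namespace Marked

theorem head_strands {M : Type} [AddCommGroup M] [Module ℤ[T;T⁻¹] M] {p : Piece}
    {l r : List (Bool × M)} {d : List Bool} (h : p.dirHead (r.map Prod.fst) = some d) :
    (head p l r).strands.map Prod.fst = l.map Prod.fst ++ d := by
  rcases p with b | _ | e
  · simp only [Piece.dirHead, Option.some.injEq] at h
    subst h
    simp only [head, List.map_append, List.map_cons, map_fst_mapS]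
  · rcases r with _ | ⟨⟨a, x⟩, _ | ⟨⟨b, y⟩, r⟩⟩
    · simp [Piece.dirHead] at h
    · simp [Piece.dirHead] at h
    · simp only [Piece.dirHead, List.map_cons] at h
      split at h
      · simp at h
      · cases h
        simp only [head, map_fst_mapS, List.map_append]
  · rcases r with _ | ⟨⟨a, x⟩, _ | ⟨⟨b, y⟩, r⟩⟩
    · simp [Piece.dirHead] at h
    · simp [Piece.dirHead] at h
    · simp only [Piece.dirHead, List.map_cons] at h
      cases h
      cases e <;> simp [head]

theorem step_strands {X : Marked} {e : Slice} {d : List Bool}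
    (h : e.piece.dirAct e.pos (X.strands.map Prod.fst) = some d) :
    (X.step e).strands.map Prod.fst = d := by
  obtain ⟨l, r, d', h1, h2, h3, rfl⟩ := Piece.exists_split h
  rw [show e = ⟨e.piece, e.pos⟩ from rfl, step_eq h1 h2, head_strands h3]

theorem run_strands {X : Marked} {w : List Slice} {d : List Bool}
    (h : dirRun (X.strands.map Prod.fst) w = some d) : (X.run w).strands.map Prod.fst = d := by
  induction w generalizing X with
  | nil => exact Option.some.inj h
  | cons e w ih =>
    simp only [dirRun] at h
    obtain ⟨d', hd', h⟩ := Option.bind_eq_some_iff.1 h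
    exact ih (by rwa [step_strands hd'])

section

variable {M M' : Type} [AddCommGroup M] [Module ℤ[T;T⁻¹] M] [AddCommGroup M']
  [Module ℤ[T;T⁻¹] M'] {i : ℕ} {a b e : Bool} {x y : M} {s : List (Bool × M)}

theorem step_cup (l r : List (Bool × M)) (h : s = l ++ r) (hi : i = l.length) :
    step ⟨M, s⟩ ⟨.cup b, i⟩ = ⟨M × ℤ[T;T⁻¹], mapS (LinearMap.inl _ _ _) l ++ (b, (0, 1)) ::
      (!b, (0, 1)) :: mapS (LinearMap.inl _ _ _) r⟩ := step_eq h hi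

theorem step_cap (l r : List (Bool × M)) (h : s = l ++ (a, x) :: (b, y) :: r)
    (hi : i = l.length) :
    step ⟨M, s⟩ ⟨.cap, i⟩ =
      ⟨M ⧸ Submodule.span ℤ[T;T⁻¹] {x - y}, mapS (Submodule.mkQ _) (l ++ r)⟩ := (step_eq h hi).trans rfl

theorem step_cross_true (l r : List (Bool × M)) (h : s = l ++ (a, x) :: (b, y) :: r)
    (hi : i = l.length) :
    step ⟨M, s⟩ ⟨.cross true, i⟩ = ⟨M, l ++ (b, under (!a) x y) :: (a, x) :: r⟩ :=
  (step_eq h hi).trans rfl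

theorem step_cross_false (l r : List (Bool × M)) (h : s = l ++ (a, x) :: (b, y) :: r)
    (hi : i = l.length) :
    step ⟨M, s⟩ ⟨.cross false, i⟩ = ⟨M, l ++ (b, y) :: (a, under b y x) :: r⟩ :=
  (step_eq h hi).trans rfl

theorem quot_congr {u v : M} (h : Submodule.span ℤ[T;T⁻¹] {u} = Submodule.span ℤ[T;T⁻¹] {v})
    (s : List (Bool × M)) :
    (⟨M ⧸ Submodule.span ℤ[T;T⁻¹] {u}, mapS (Submodule.mkQ _) s⟩ : Marked) =
      ⟨M ⧸ Submodule.span ℤ[T;T⁻¹] {v}, mapS (Submodule.mkQ _) s⟩ := by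
  rw [h]

/-- Powers of `t` are units, so relations may be scaled by them. -/
theorem span_T_smul (b : Bool) (u : M) :
    Submodule.span ℤ[T;T⁻¹] {(T (if b then 1 else -1) : ℤ[T;T⁻¹]) • u} =
      Submodule.span ℤ[T;T⁻¹] {u} :=
  Submodule.span_singleton_smul_eq (IsUnit.of_mul_eq_one _ (T_mul_T_not b)) u

theorem quot_quot (u v : M) (s : List (Bool × M)) :
    Iso ⟨M ⧸ (Submodule.span ℤ[T;T⁻¹] {u} ⊔ Submodule.span ℤ[T;T⁻¹] {v}), mapS (Submodule.mkQ _) s⟩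
      ⟨(M ⧸ Submodule.span ℤ[T;T⁻¹] {u}) ⧸
        Submodule.span ℤ[T;T⁻¹] {(Submodule.mkQ (Submodule.span ℤ[T;T⁻¹] {u})) v},
        mapS (Submodule.mkQ _) (mapS (Submodule.mkQ _) s)⟩ := by
  rw [mapS_mapS]
  refine iso_of_ker _ (by
    rw [LinearMap.coe_comp]
    exact (Submodule.mkQ_surjective _).comp (Submodule.mkQ_surjective _)) ?_ _
  rw [LinearMap.ker_comp, Submodule.ker_mkQ, ← Set.image_singleton, ← Submodule.map_span,
    Submodule.comap_map_mkQ]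

theorem prod_quot (u : M) (s : List (Bool × (M × ℤ[T;T⁻¹]))) :
    Iso ⟨(M × ℤ[T;T⁻¹]) ⧸ Submodule.span ℤ[T;T⁻¹] {((u, 0) : M × ℤ[T;T⁻¹])},
        mapS (Submodule.mkQ _) s⟩
      ⟨(M ⧸ Submodule.span ℤ[T;T⁻¹] {u}) × ℤ[T;T⁻¹],
        mapS (LinearMap.prodMap (Submodule.mkQ _) LinearMap.id) s⟩ := by
  refine iso_of_ker _ (by
    rw [LinearMap.coe_prodMap]
    exact (Submodule.mkQ_surjective _).prodMap Function.surjective_id) ?_ _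
  ext ⟨m, t⟩
  simp only [LinearMap.mem_ker, LinearMap.prodMap_apply, Submodule.mkQ_apply, LinearMap.id_apply,
    Prod.mk_eq_zero, Submodule.Quotient.mk_eq_zero, Submodule.mem_span_singleton, Prod.smul_mk,
    smul_zero, Prod.mk.injEq]
  constructor
  · rintro ⟨⟨c, hc⟩, rfl⟩; exact ⟨c, hc, rfl⟩
  · rintro ⟨c, hc, rfl⟩; exact ⟨⟨c, hc⟩, rfl⟩

/-- A Tietze move: the relation solves for the new generator, which is replaced by `z`. -/
theorem prod_quot_generator (z : M) (u : M × ℤ[T;T⁻¹]) (hu : u = (z, -1) ∨ u = (-z, 1))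
    (s : List (Bool × (M × ℤ[T;T⁻¹]))) :
    Iso ⟨(M × ℤ[T;T⁻¹]) ⧸ Submodule.span ℤ[T;T⁻¹] {u}, mapS (Submodule.mkQ _) s⟩
      ⟨M, mapS (LinearMap.coprod LinearMap.id (LinearMap.toSpanSingleton _ _ z)) s⟩ := by
  refine iso_of_ker _ (fun m => ⟨(m, 0), by simp⟩) ?_ _
  ext ⟨m, t⟩
  simp only [LinearMap.mem_ker, LinearMap.coprod_apply, LinearMap.id_apply,
    LinearMap.toSpanSingleton_apply, Submodule.mem_span_singleton]
  rcases hu with rfl | rfl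
  · constructor
    · exact fun h => ⟨-t, by simp [eq_neg_of_add_eq_zero_left h]⟩
    · rintro ⟨c, hc⟩
      simp only [Prod.smul_mk, Prod.mk.injEq] at hc
      rw [← hc.1, ← hc.2]; simp
  · constructor
    · exact fun h => ⟨t, by simp [eq_neg_of_add_eq_zero_left h]⟩
    · rintro ⟨c, hc⟩
      simp only [Prod.smul_mk, Prod.mk.injEq] at hc
      rw [← hc.1, ← hc.2]; simp

theorem iso_cup_cup {b b' : Bool} (l m r : List (Bool × M)) :
    Iso (run ⟨M, l ++ (m ++ r)⟩ [⟨.cup b, l.length⟩, ⟨.cup b', l.length + 2 + m.length⟩])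
      (run ⟨M, l ++ (m ++ r)⟩ [⟨.cup b', l.length + m.length⟩, ⟨.cup b, l.length⟩]) := by
  simp only [run]
  rw [step_cup l (m ++ r) rfl rfl, step_cup (l ++ m) r (by simp) (by simp),
    step_cup (mapS (LinearMap.inl _ _ _) l ++ (b, (0, 1)) :: (!b, (0, 1)) ::
      mapS (LinearMap.inl _ _ _) m) (mapS (LinearMap.inl _ _ _) r) (by simp) (by simp; omega),
    step_cup (mapS (LinearMap.inl _ _ _) l) (mapS (LinearMap.inl _ _ _) m ++ (b', (0, 1)) ::
      (!b', (0, 1)) :: mapS (LinearMap.inl _ _ _) r) (by simp) (by simp)]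
  -- The two new free generators appear in opposite orders.
  let e : ((M × ℤ[T;T⁻¹]) × ℤ[T;T⁻¹]) ≃ₗ[ℤ[T;T⁻¹]] ((M × ℤ[T;T⁻¹]) × ℤ[T;T⁻¹]) :=
    LinearEquiv.ofLinearMap
      (LinearMap.prod (LinearMap.prod (LinearMap.fst _ _ _ ∘ₗ LinearMap.fst _ _ _)
        (LinearMap.snd _ _ _)) (LinearMap.snd _ _ _ ∘ₗ LinearMap.fst _ _ _))
      (LinearMap.prod (LinearMap.prod (LinearMap.fst _ _ _ ∘ₗ LinearMap.fst _ _ _)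
        (LinearMap.snd _ _ _)) (LinearMap.snd _ _ _ ∘ₗ LinearMap.fst _ _ _))
      (LinearMap.ext fun _ => rfl) (LinearMap.ext fun _ => rfl)
  refine iso_of_equiv e ?_
  have he : ∀ v, e v = ((v.1.1, v.2), v.1.2) := fun _ => rfl
  have h2 : (e : _ →ₗ[ℤ[T;T⁻¹]] _) ∘ₗ (LinearMap.inl ℤ[T;T⁻¹] (M × ℤ[T;T⁻¹]) ℤ[T;T⁻¹]) ∘ₗ
    (LinearMap.inl ℤ[T;T⁻¹] M ℤ[T;T⁻¹]) = (LinearMap.inl ℤ[T;T⁻¹] (M × ℤ[T;T⁻¹]) ℤ[T;T⁻¹]) ∘ₗ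
    (LinearMap.inl ℤ[T;T⁻¹] M ℤ[T;T⁻¹]) := LinearMap.ext fun _ => rfl
  simp [mapS_mapS, he, h2]

theorem iso_cup_cap {b c d : Bool} {x y : M} (l m r : List (Bool × M)) :
    Iso (run ⟨M, l ++ (m ++ (c, x) :: (d, y) :: r)⟩
        [⟨.cup b, l.length⟩, ⟨.cap, l.length + 2 + m.length⟩])
      (run ⟨M, l ++ (m ++ (c, x) :: (d, y) :: r)⟩
        [⟨.cap, l.length + m.length⟩, ⟨.cup b, l.length⟩]) := by
  simp only [run]
  rw [step_cup l (m ++ (c, x) :: (d, y) :: r) rfl rfl,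
    step_cap (a := c) (b := d) (x := x) (y := y) (l ++ m) r (by simp) (by simp),
    step_cap (a := c) (b := d) (x := (x, 0)) (y := (y, 0))
      (mapS (LinearMap.inl _ _ _) l ++ (b, (0, 1)) :: (!b, (0, 1)) ::
      mapS (LinearMap.inl _ _ _) m) (mapS (LinearMap.inl _ _ _) r) (by simp) (by simp; omega),
    step_cup (mapS (Submodule.mkQ _) l) (mapS (Submodule.mkQ _) (m ++ r)) (by simp) (by simp)]
  rw [show (x, (0 : ℤ[T;T⁻¹])) - (y, 0) = (x - y, 0) by simp]
  refine (prod_quot _ _).trans (Iso.of_eq ?_)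
  congr 1
  simp only [mapS_append, mapS_cons, mapS_mapS, List.append_assoc, List.cons_append]
  refine congrArg₂ _ ?_ (congrArg₂ _ ?_ (congrArg₂ _ ?_ (congrArg₂ _ ?_ ?_))) <;>
    first | simp | congr 1

theorem iso_cap_cup {b c d : Bool} {x y : M} (l m r : List (Bool × M)) :
    Iso (run ⟨M, l ++ (c, x) :: (d, y) :: (m ++ r)⟩
        [⟨.cap, l.length⟩, ⟨.cup b, l.length + m.length⟩])
      (run ⟨M, l ++ (c, x) :: (d, y) :: (m ++ r)⟩
        [⟨.cup b, l.length + 2 + m.length⟩, ⟨.cap, l.length⟩]) := by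
  simp only [run]
  rw [step_cup (l ++ (c, x) :: (d, y) :: m) r (by simp) (by simp; omega),
    step_cap (a := c) (b := d) (x := x) (y := y) l (m ++ r) (by simp) (by simp),
    step_cap (a := c) (b := d) (x := (x, 0)) (y := (y, 0))
      (mapS (LinearMap.inl _ _ _) l) (mapS (LinearMap.inl _ _ _) m ++ (b, (0, 1)) ::
      (!b, (0, 1)) :: mapS (LinearMap.inl _ _ _) r) (by simp) (by simp),
    step_cup (mapS (Submodule.mkQ _) (l ++ m)) (mapS (Submodule.mkQ _) r) (by simp) (by simp)]
  rw [show (x, (0 : ℤ[T;T⁻¹])) - (y, 0) = (x - y, 0) by simp]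
  refine ((prod_quot _ _).trans (Iso.of_eq ?_)).symm
  congr 1
  simp only [mapS_append, mapS_cons, mapS_mapS, List.append_assoc]
  refine congrArg₂ _ ?_ (congrArg₂ _ ?_ (congrArg₂ _ ?_ (congrArg₂ _ ?_ ?_))) <;>
    first | simp | congr 1

theorem iso_cap_cap {a b c d : Bool} {x y z t : M} (l m r : List (Bool × M)) :
    Iso (run ⟨M, l ++ (a, x) :: (b, y) :: (m ++ (c, z) :: (d, t) :: r)⟩
        [⟨.cap, l.length⟩, ⟨.cap, l.length + m.length⟩])
      (run ⟨M, l ++ (a, x) :: (b, y) :: (m ++ (c, z) :: (d, t) :: r)⟩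
        [⟨.cap, l.length + 2 + m.length⟩, ⟨.cap, l.length⟩]) := by
  simp only [run]
  rw [step_cap (a := a) (b := b) (x := x) (y := y) l (m ++ (c, z) :: (d, t) :: r) rfl rfl,
    step_cap (a := c) (b := d) (x := z) (y := t) (l ++ (a, x) :: (b, y) :: m) r
      (by simp) (by simp; omega),
    step_cap (a := c) (b := d) (x := Submodule.mkQ _ z) (y := Submodule.mkQ _ t)
      (mapS (Submodule.mkQ _) (l ++ m)) (mapS (Submodule.mkQ _) r) (by simp) (by simp),
    step_cap (a := a) (b := b) (x := Submodule.mkQ _ x) (y := Submodule.mkQ _ y)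
      (mapS (Submodule.mkQ _) l) (mapS (Submodule.mkQ _) (m ++ r)) (by simp) (by simp),
    ← map_sub, ← map_sub, ← mapS_append, ← mapS_append, List.append_assoc]
  refine (quot_quot _ _ _).symm.trans (Iso.trans (Iso.of_eq ?_) (quot_quot _ _ _))
  rw [sup_comm]

end

end Marked

end

/-! ### Interchanges with crossings -/

noncomputable section

namespace Marked

section

variable {M : Type} [AddCommGroup M] [Module ℤ[T;T⁻¹] M]

theorem iso_cup_cross {b e c d : Bool} {x y : M} (l m r : List (Bool × M)) :
    Iso (run ⟨M, l ++ (m ++ (c, x) :: (d, y) :: r)⟩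
        [⟨.cup b, l.length⟩, ⟨.cross e, l.length + 2 + m.length⟩])
      (run ⟨M, l ++ (m ++ (c, x) :: (d, y) :: r)⟩
        [⟨.cross e, l.length + m.length⟩, ⟨.cup b, l.length⟩]) := by
  simp only [run]
  rw [step_cup l (m ++ (c, x) :: (d, y) :: r) rfl rfl]
  cases e
  · rw [step_cross_false (a := c) (b := d) (x := x) (y := y) (l ++ m) r (by simp) (by simp),
      step_cross_false (a := c) (b := d) (x := (x, 0)) (y := (y, 0))
        (mapS (LinearMap.inl _ _ _) l ++ (b, (0, 1)) :: (!b, (0, 1)) ::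
        mapS (LinearMap.inl _ _ _) m) (mapS (LinearMap.inl _ _ _) r) (by simp) (by simp; omega),
      step_cup l (m ++ (d, y) :: (c, under d y x) :: r) (by simp) rfl]
    refine Iso.of_eq ?_
    simp [under]
  · rw [step_cross_true (a := c) (b := d) (x := x) (y := y) (l ++ m) r (by simp) (by simp),
      step_cross_true (a := c) (b := d) (x := (x, 0)) (y := (y, 0))
        (mapS (LinearMap.inl _ _ _) l ++ (b, (0, 1)) :: (!b, (0, 1)) ::
        mapS (LinearMap.inl _ _ _) m) (mapS (LinearMap.inl _ _ _) r) (by simp) (by simp; omega),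
      step_cup l (m ++ (d, under (!c) x y) :: (c, x) :: r) (by simp) rfl]
    refine Iso.of_eq ?_
    simp [under]

theorem iso_cross_cup {b e c d : Bool} {x y : M} (l m r : List (Bool × M)) :
    Iso (run ⟨M, l ++ (c, x) :: (d, y) :: (m ++ r)⟩
        [⟨.cross e, l.length⟩, ⟨.cup b, l.length + 2 + m.length⟩])
      (run ⟨M, l ++ (c, x) :: (d, y) :: (m ++ r)⟩
        [⟨.cup b, l.length + 2 + m.length⟩, ⟨.cross e, l.length⟩]) := by
  simp only [run]
  rw [step_cup (l ++ (c, x) :: (d, y) :: m) r (by simp) (by simp; omega)]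
  cases e
  · rw [step_cross_false (a := c) (b := d) (x := x) (y := y) l (m ++ r) (by simp) (by simp),
      step_cross_false (a := c) (b := d) (x := (x, 0)) (y := (y, 0))
        (mapS (LinearMap.inl _ _ _) l) (mapS (LinearMap.inl _ _ _) m ++ (b, (0, 1)) ::
        (!b, (0, 1)) :: mapS (LinearMap.inl _ _ _) r) (by simp) (by simp),
      step_cup (l ++ (d, y) :: (c, under d y x) :: m) r (by simp) (by simp; omega)]
    refine Iso.of_eq ?_
    simp [under]
  · rw [step_cross_true (a := c) (b := d) (x := x) (y := y) l (m ++ r) (by simp) (by simp),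
      step_cross_true (a := c) (b := d) (x := (x, 0)) (y := (y, 0))
        (mapS (LinearMap.inl _ _ _) l) (mapS (LinearMap.inl _ _ _) m ++ (b, (0, 1)) ::
        (!b, (0, 1)) :: mapS (LinearMap.inl _ _ _) r) (by simp) (by simp),
      step_cup (l ++ (d, under (!c) x y) :: (c, x) :: m) r (by simp) (by simp; omega)]
    refine Iso.of_eq ?_
    simp [under]

theorem iso_cap_cross {a b c d e : Bool} {x y z t : M} (l m r : List (Bool × M)) :
    Iso (run ⟨M, l ++ (a, x) :: (b, y) :: (m ++ (c, z) :: (d, t) :: r)⟩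
        [⟨.cap, l.length⟩, ⟨.cross e, l.length + m.length⟩])
      (run ⟨M, l ++ (a, x) :: (b, y) :: (m ++ (c, z) :: (d, t) :: r)⟩
        [⟨.cross e, l.length + 2 + m.length⟩, ⟨.cap, l.length⟩]) := by
  simp only [run]
  rw [step_cap (a := a) (b := b) (x := x) (y := y) l (m ++ (c, z) :: (d, t) :: r) rfl rfl]
  cases e
  · rw [step_cross_false (a := c) (b := d) (x := z) (y := t) (l ++ (a, x) :: (b, y) :: m) r
        (by simp) (by simp; omega),
      step_cross_false (a := c) (b := d) (x := Submodule.mkQ _ z) (y := Submodule.mkQ _ t)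
        (mapS (Submodule.mkQ _) (l ++ m)) (mapS (Submodule.mkQ _) r) (by simp) (by simp),
      step_cap (a := a) (b := b) (x := x) (y := y) l (m ++ (d, t) :: (c, under d t z) :: r)
        (by simp) rfl]
    refine Iso.of_eq ?_
    simp [under]
  · rw [step_cross_true (a := c) (b := d) (x := z) (y := t) (l ++ (a, x) :: (b, y) :: m) r
        (by simp) (by simp; omega),
      step_cross_true (a := c) (b := d) (x := Submodule.mkQ _ z) (y := Submodule.mkQ _ t)
        (mapS (Submodule.mkQ _) (l ++ m)) (mapS (Submodule.mkQ _) r) (by simp) (by simp),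
      step_cap (a := a) (b := b) (x := x) (y := y) l (m ++ (d, under (!c) z t) :: (c, z) :: r)
        (by simp) rfl]
    refine Iso.of_eq ?_
    simp [under]

theorem iso_cross_cap {a b c d e : Bool} {x y z t : M} (l m r : List (Bool × M)) :
    Iso (run ⟨M, l ++ (a, x) :: (b, y) :: (m ++ (c, z) :: (d, t) :: r)⟩
        [⟨.cross e, l.length⟩, ⟨.cap, l.length + 2 + m.length⟩])
      (run ⟨M, l ++ (a, x) :: (b, y) :: (m ++ (c, z) :: (d, t) :: r)⟩
        [⟨.cap, l.length + 2 + m.length⟩, ⟨.cross e, l.length⟩]) := by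
  simp only [run]
  rw [step_cap (a := c) (b := d) (x := z) (y := t) (l ++ (a, x) :: (b, y) :: m) r (by simp)
    (by simp; omega)]
  cases e
  · rw [step_cross_false (a := a) (b := b) (x := x) (y := y) l (m ++ (c, z) :: (d, t) :: r)
        rfl rfl,
      step_cross_false (a := a) (b := b) (x := Submodule.mkQ _ x) (y := Submodule.mkQ _ y)
        (mapS (Submodule.mkQ _) l) (mapS (Submodule.mkQ _) (m ++ r)) (by simp) (by simp),
      step_cap (a := c) (b := d) (x := z) (y := t) (l ++ (b, y) :: (a, under b y x) :: m) r
        (by simp) (by simp; omega)]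
    refine Iso.of_eq ?_
    simp [under]
  · rw [step_cross_true (a := a) (b := b) (x := x) (y := y) l (m ++ (c, z) :: (d, t) :: r)
        rfl rfl,
      step_cross_true (a := a) (b := b) (x := Submodule.mkQ _ x) (y := Submodule.mkQ _ y)
        (mapS (Submodule.mkQ _) l) (mapS (Submodule.mkQ _) (m ++ r)) (by simp) (by simp),
      step_cap (a := c) (b := d) (x := z) (y := t) (l ++ (b, under (!a) x y) :: (a, x) :: m) r
        (by simp) (by simp; omega)]
    refine Iso.of_eq ?_
    simp [under]

theorem iso_cross_cross {a b c d e e' : Bool} {x y z t : M} (l m r : List (Bool × M)) :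
    Iso (run ⟨M, l ++ (a, x) :: (b, y) :: (m ++ (c, z) :: (d, t) :: r)⟩
        [⟨.cross e, l.length⟩, ⟨.cross e', l.length + 2 + m.length⟩])
      (run ⟨M, l ++ (a, x) :: (b, y) :: (m ++ (c, z) :: (d, t) :: r)⟩
        [⟨.cross e', l.length + 2 + m.length⟩, ⟨.cross e, l.length⟩]) := by
  simp only [run]
  -- The new colours at a crossing do not depend on the other strands or on the position.
  have key (f : Bool) (x y : M) (a b : Bool) : ∃ x' y' : M, ∀ (s l r : List (Bool × M)) (i : ℕ),
      s = l ++ (a, x) :: (b, y) :: r → i = l.length →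
      step ⟨M, s⟩ ⟨.cross f, i⟩ = ⟨M, l ++ (b, y') :: (a, x') :: r⟩ := by
    cases f
    · exact ⟨_, _, fun s l r i h hi => step_cross_false l r h hi⟩
    · exact ⟨_, _, fun s l r i h hi => step_cross_true l r h hi⟩
  obtain ⟨x', y', h⟩ := key e x y a b
  obtain ⟨z', t', h'⟩ := key e' z t c d
  rw [h _ l (m ++ (c, z) :: (d, t) :: r) _ rfl rfl,
    h' _ (l ++ (b, y') :: (a, x') :: m) r _ (by simp) (by simp; omega),
    h' _ (l ++ (a, x) :: (b, y) :: m) r _ (by simp) (by simp; omega),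
    h _ l (m ++ (d, t') :: (c, z') :: r) _ (by simp) rfl]
  exact Iso.of_eq (by simp)

end

/-- Both orders must fit: one shows the strands used by `p`, the other those used by `q`, all in the
same state. -/
theorem iso_interchange (X : Marked) (p q : Piece) (i k : ℕ) {d d' : List Bool}
    (h : dirRun (X.strands.map Prod.fst) [⟨p, i⟩, ⟨q, i + p.outputs + k⟩] = some d)
    (h' : dirRun (X.strands.map Prod.fst) [⟨q, i + p.inputs + k⟩, ⟨p, i⟩] = some d') :
    Iso (X.run [⟨p, i⟩, ⟨q, i + p.outputs + k⟩]) (X.run [⟨q, i + p.inputs + k⟩, ⟨p, i⟩]) := by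
  obtain ⟨M, s⟩ := X
  simp only [dirRun] at h h'
  obtain ⟨_, h, -⟩ := Option.bind_eq_some_iff.1 h
  obtain ⟨_, h', -⟩ := Option.bind_eq_some_iff.1 h'
  obtain ⟨l, P, r, hs, rfl, hP⟩ := Piece.exists_split_inputs h
  obtain ⟨L, Q, R, hs', hL, hQ⟩ := Piece.exists_split_inputs h'
  clear h h'
  -- `m` consists of the `k` strands between the two pieces.
  obtain ⟨m, rfl, hm⟩ : ∃ m, r = m ++ (Q ++ R) ∧ k = m.length := by
    refine ⟨L.drop (l.length + P.length), ?_, by simp [hL, hP]⟩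
    have h1 := congrArg (List.drop (l.length + P.length)) (hs.symm.trans hs')
    rwa [List.drop_append_of_le_length (l₁ := L) (by omega), ← List.append_assoc,
      List.drop_left' (by simp)] at h1
  clear hs' hL
  subst hs hm
  have two {l : List (Bool × M)} (h : l.length = 2) : ∃ a x b y, l = [(a, x), (b, y)] := by
    obtain ⟨v, w, rfl⟩ := List.length_eq_two.1 h
    exact ⟨v.1, v.2, w.1, w.2, rfl⟩
  rcases p with b | _ | e <;> rcases q with b' | _ | e' <;>
    simp only [Piece.inputs, Piece.outputs, add_zero] at hP hQ ⊢
  · obtain rfl := List.length_eq_zero_iff.1 hP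
    obtain rfl := List.length_eq_zero_iff.1 hQ
    exact iso_cup_cup l m R
  · obtain rfl := List.length_eq_zero_iff.1 hP
    obtain ⟨a, x, b, y, rfl⟩ := two hQ
    exact iso_cup_cap l m R
  · obtain rfl := List.length_eq_zero_iff.1 hP
    obtain ⟨a, x, b, y, rfl⟩ := two hQ
    exact iso_cup_cross l m R
  · obtain rfl := List.length_eq_zero_iff.1 hQ
    obtain ⟨a, x, b, y, rfl⟩ := two hP
    exact iso_cap_cup l m R
  · obtain ⟨a, x, b, y, rfl⟩ := two hP
    obtain ⟨a, x, b, y, rfl⟩ := two hQ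
    exact iso_cap_cap l m R
  · obtain ⟨a, x, b, y, rfl⟩ := two hP
    obtain ⟨a, x, b, y, rfl⟩ := two hQ
    exact iso_cap_cross l m R
  · obtain rfl := List.length_eq_zero_iff.1 hQ
    obtain ⟨a, x, b, y, rfl⟩ := two hP
    exact iso_cross_cup l m R
  · obtain ⟨a, x, b, y, rfl⟩ := two hP
    obtain ⟨a, x, b, y, rfl⟩ := two hQ
    exact iso_cross_cap l m R
  · obtain ⟨a, x, b, y, rfl⟩ := two hP
    obtain ⟨a, x, b, y, rfl⟩ := two hQ
    exact iso_cross_cross l m R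

end Marked

end

/-! ### Invariance of the Alexander module -/

noncomputable section

theorem Piece.cup_split {M : Type} {b : Bool} {i : ℕ} {s : List (Bool × M)} {d : List Bool}
    (h : (Piece.cup b).dirAct i (s.map Prod.fst) = some d) :
    ∃ l r : List (Bool × M), s = l ++ r ∧ i = l.length ∧
      d = (l.map Prod.fst) ++ b :: (!b) :: r.map Prod.fst := by
  obtain ⟨l, r, d', rfl, rfl, h', rfl⟩ := Piece.exists_split h
  cases h'
  exact ⟨l, r, rfl, rfl, rfl⟩

theorem Piece.cap_split {M : Type} {i : ℕ} {s : List (Bool × M)} {d : List Bool}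
    (h : Piece.cap.dirAct i (s.map Prod.fst) = some d) :
    ∃ (l r : List (Bool × M)) (a : Bool) (x y : M), s = l ++ (a, x) :: (!a, y) :: r ∧
      i = l.length ∧ d = (l ++ r).map Prod.fst := by
  obtain ⟨l, r, d', rfl, rfl, h', rfl⟩ := Piece.exists_split h
  clear h
  rcases r with _ | ⟨⟨a, x⟩, _ | ⟨⟨b, y⟩, r⟩⟩
  · simp [Piece.dirHead] at h'
  · simp [Piece.dirHead] at h'
  · simp only [Piece.dirHead, List.map_cons] at h'
    split at h'
    · simp at h'
    · rename_i hab
      cases h'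
      refine ⟨l, r, a, x, y, ?_, rfl, by simp⟩
      rw [show b = !a by cases a <;> cases b <;> simp_all]

theorem Piece.cross_split {M : Type} {e : Bool} {i : ℕ} {s : List (Bool × M)} {d : List Bool}
    (h : (Piece.cross e).dirAct i (s.map Prod.fst) = some d) :
    ∃ (l r : List (Bool × M)) (a b : Bool) (x y : M), s = l ++ (a, x) :: (b, y) :: r ∧
      i = l.length ∧ d = l.map Prod.fst ++ b :: a :: r.map Prod.fst := by
  obtain ⟨l, r, d', rfl, rfl, h', rfl⟩ := Piece.exists_split h
  clear h
  rcases r with _ | ⟨⟨a, x⟩, _ | ⟨⟨b, y⟩, r⟩⟩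
  · simp [Piece.dirHead] at h'
  · simp [Piece.dirHead] at h'
  · cases h'
    exact ⟨l, r, a, b, x, y, rfl, rfl, rfl⟩

theorem List.exists_eq_append_singleton {α : Type*} {l : List α} {i : ℕ} (h : i + 1 = l.length) :
    ∃ l' a, l = l' ++ [a] ∧ i = l'.length := by
  rcases List.eq_nil_or_concat l with rfl | ⟨l', a, rfl⟩
  · simp at h
  · exact ⟨l', a, by simp, by simpa using h⟩

namespace Marked

section

variable {M : Type} [AddCommGroup M] [Module ℤ[T;T⁻¹] M]

theorem iso_zigzag_left {b : Bool} {x : M} (l r : List (Bool × M)) :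
    Iso (run ⟨M, l ++ (b, x) :: r⟩ [⟨.cup b, l.length⟩, ⟨.cap, l.length + 1⟩])
      ⟨M, l ++ (b, x) :: r⟩ := by
  simp only [run]
  rw [step_cup l ((b, x) :: r) rfl rfl,
    step_cap (a := !b) (b := b) (x := (0, 1)) (y := (x, 0))
      (mapS (LinearMap.inl _ _ _) l ++ [(b, (0, 1))]) (mapS (LinearMap.inl _ _ _) r)
      (by simp) (by simp)]
  refine (prod_quot_generator x _ (Or.inr (by simp)) _).trans (Iso.of_eq ?_)
  simp [mapS_mapS, mapS_id]

theorem iso_zigzag_right {b : Bool} {x : M} (l r : List (Bool × M)) :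
    Iso (run ⟨M, l ++ (!b, x) :: r⟩ [⟨.cup b, l.length + 1⟩, ⟨.cap, l.length⟩])
      ⟨M, l ++ (!b, x) :: r⟩ := by
  simp only [run]
  rw [step_cup (l ++ [(!b, x)]) r (by simp) (by simp),
    step_cap (a := !b) (b := b) (x := (x, 0)) (y := (0, 1))
      (mapS (LinearMap.inl _ _ _) l) ((!b, (0, 1)) :: mapS (LinearMap.inl _ _ _) r)
      (by simp) (by simp)]
  refine (prod_quot_generator x _ (Or.inl (by simp)) _).trans (Iso.of_eq ?_)
  simp [mapS_mapS, mapS_id]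

theorem iso_slide_cap {a b e : Bool} {x y z : M} (l r : List (Bool × M)) :
    Iso (run ⟨M, l ++ (a, x) :: (b, y) :: (!a, z) :: r⟩
        [⟨.cross e, l.length + 1⟩, ⟨.cap, l.length⟩])
      (run ⟨M, l ++ (a, x) :: (b, y) :: (!a, z) :: r⟩
        [⟨.cross !e, l.length⟩, ⟨.cap, l.length + 1⟩]) := by
  simp only [run]
  cases e
  · rw [Bool.not_false, step_cross_false (a := b) (b := !a) (x := y) (y := z) (l ++ [(a, x)]) r
        (by simp) (by simp),
      step_cross_true (a := a) (b := b) (x := x) (y := y) l ((!a, z) :: r) rfl rfl,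
      step_cap (a := a) (b := !a) (x := x) (y := z) l ((b, under (!a) z y) :: r) (by simp) rfl,
      step_cap (a := a) (b := !a) (x := x) (y := z) (l ++ [(b, under (!a) x y)]) r (by simp)
        (by simp)]
    refine Iso.of_eq ?_
    have : (Submodule.mkQ (Submodule.span ℤ[T;T⁻¹] {x - z})) x = Submodule.mkQ _ z :=
      (Submodule.Quotient.eq _).2 (Submodule.mem_span_singleton_self _)
    simp only [mapS_append, mapS_cons, map_under, this, List.append_assoc, List.cons_append,
      List.nil_append]
  · rw [Bool.not_true, step_cross_true (a := b) (b := !a) (x := y) (y := z) (l ++ [(a, x)]) r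
        (by simp) (by simp),
      step_cross_false (a := a) (b := b) (x := x) (y := y) l ((!a, z) :: r) rfl rfl,
      step_cap (a := a) (b := !a) (x := x) (y := under (!b) y z) l ((b, y) :: r) (by simp) rfl,
      step_cap (a := a) (b := !a) (x := under b y x) (y := z) (l ++ [(b, y)]) r (by simp)
        (by simp)]
    refine Iso.of_eq ?_
    rw [List.append_assoc]
    refine quot_congr ?_ _
    -- Applying `under b y` to both ends of one relation gives the other, up to a power of `t`.
    rw [← span_T_smul b]
    congr 2
    have h : z = under b y (under (!b) y z) := (under_under_not _ _ _).symm
    nth_rewrite 2 [h]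
    generalize under (!b) y z = z'
    simp only [under]
    module

theorem iso_slide_cup {b c e : Bool} {z : M} (l r : List (Bool × M)) :
    Iso (run ⟨M, l ++ (c, z) :: r⟩ [⟨.cup b, l.length⟩, ⟨.cross e, l.length + 1⟩])
      (run ⟨M, l ++ (c, z) :: r⟩ [⟨.cup b, l.length + 1⟩, ⟨.cross !e, l.length⟩]) := by
  simp only [run]
  rw [step_cup l ((c, z) :: r) rfl rfl, step_cup (l ++ [(c, z)]) r (by simp) (by simp)]
  cases e
  · rw [Bool.not_false, step_cross_false (a := !b) (b := c) (x := (0, 1)) (y := (z, 0))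
        (mapS (LinearMap.inl _ _ _) l ++ [(b, (0, 1))]) (mapS (LinearMap.inl _ _ _) r) (by simp)
        (by simp),
      step_cross_true (a := c) (b := b) (x := (z, 0)) (y := (0, 1))
        (mapS (LinearMap.inl _ _ _) l) ((!b, (0, 1)) :: mapS (LinearMap.inl _ _ _) r) (by simp)
        (by simp)]
    -- The new generators of the two diagrams are the two sides of one underpass. `F s` fixes `M`
    -- and sends the generator to its colour after passing under `z`; `F (!s)` undoes this.
    let F (s : Bool) : (M × ℤ[T;T⁻¹]) →ₗ[ℤ[T;T⁻¹]] (M × ℤ[T;T⁻¹]) :=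
      LinearMap.coprod (LinearMap.inl _ _ _)
        (LinearMap.toSpanSingleton _ _ (under s ((z, 0) : M × ℤ[T;T⁻¹]) (0, 1)))
    have hz (s) : F s (z, 0) = (z, 0) := by simp [F]
    have hg (s) : F s (0, 1) = under s (z, 0) (0, 1) := by simp [F]
    have hF (s) : F (!s) ∘ₗ F s = LinearMap.id := by
      refine LinearMap.prod_ext (LinearMap.ext fun m => by simp [F]) (LinearMap.ext_ring ?_)
      simp only [LinearMap.comp_apply, LinearMap.inr_apply, hg, map_under, hz, LinearMap.id_apply]
      exact under_under_not _ _ _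
    let E : (M × ℤ[T;T⁻¹]) ≃ₗ[ℤ[T;T⁻¹]] (M × ℤ[T;T⁻¹]) :=
      LinearEquiv.ofLinearMap (F (!c)) (F c) (hF c) (by simpa using hF (!c))
    refine iso_of_equiv E ?_
    rw [show (E : (M × ℤ[T;T⁻¹]) →ₗ[ℤ[T;T⁻¹]] (M × ℤ[T;T⁻¹])) = F (!c) from rfl]
    have hl : F (!c) ∘ₗ LinearMap.inl ℤ[T;T⁻¹] M ℤ[T;T⁻¹] = LinearMap.inl _ _ _ := by simp [F]
    simp only [mapS_append, mapS_cons, mapS_mapS, hl, hg, hz, map_under, under_under_not,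
      List.append_assoc, List.cons_append, List.nil_append]
  · rw [Bool.not_true, step_cross_true (a := !b) (b := c) (x := (0, 1)) (y := (z, 0))
        (mapS (LinearMap.inl _ _ _) l ++ [(b, (0, 1))]) (mapS (LinearMap.inl _ _ _) r) (by simp)
        (by simp),
      step_cross_false (a := c) (b := b) (x := (z, 0)) (y := (0, 1))
        (mapS (LinearMap.inl _ _ _) l) ((!b, (0, 1)) :: mapS (LinearMap.inl _ _ _) r) (by simp)
        (by simp)]
    refine Iso.of_eq ?_
    simp

/-- The relation imposed above the kink is `x - y` times a unit `-t^(±1)`. -/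
theorem iso_reidemeister_one_cap {a b e : Bool} {x y : M} (l r : List (Bool × M)) :
    Iso (run ⟨M, l ++ (a, x) :: (b, y) :: r⟩ [⟨.cross e, l.length⟩, ⟨.cap, l.length⟩])
      (run ⟨M, l ++ (a, x) :: (b, y) :: r⟩ [⟨.cap, l.length⟩]) := by
  simp only [run]
  rw [step_cap (a := a) (b := b) (x := x) (y := y) l r rfl rfl]
  cases e
  · rw [step_cross_false (a := a) (b := b) (x := x) (y := y) l r rfl rfl,
      step_cap (a := b) (b := a) (x := y) (y := under b y x) l r rfl rfl]
    refine Iso.of_eq (quot_congr ?_ _)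
    rw [← span_T_smul b (x - y), ← Submodule.span_neg]
    simp only [Set.neg_singleton]
    congr 2
    simp only [under]
    module
  · rw [step_cross_true (a := a) (b := b) (x := x) (y := y) l r rfl rfl,
      step_cap (a := b) (b := a) (x := under (!a) x y) (y := x) l r rfl rfl]
    refine Iso.of_eq (quot_congr ?_ _)
    rw [← span_T_smul (!a) (x - y), ← Submodule.span_neg]
    simp only [Set.neg_singleton]
    congr 2
    simp only [under]
    module

theorem iso_reidemeister_one_cup {b e : Bool} (l r : List (Bool × M)) :
    Iso (run ⟨M, l ++ r⟩ [⟨.cup b, l.length⟩, ⟨.cross e, l.length⟩])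
      (run ⟨M, l ++ r⟩ [⟨.cup !b, l.length⟩]) := by
  simp only [run]
  rw [step_cup l r rfl rfl, step_cup l r rfl rfl]
  cases e
  · rw [step_cross_false (M := M × ℤ[T;T⁻¹]) (a := b) (b := !b) (x := (0, 1)) (y := (0, 1))
      (mapS (LinearMap.inl _ _ _) l) (mapS (LinearMap.inl _ _ _) r) rfl (by simp)]
    exact Iso.of_eq (by rw [under_self]; simp)
  · rw [step_cross_true (M := M × ℤ[T;T⁻¹]) (a := b) (b := !b) (x := (0, 1)) (y := (0, 1))
      (mapS (LinearMap.inl _ _ _) l) (mapS (LinearMap.inl _ _ _) r) rfl (by simp)]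
    exact Iso.of_eq (by rw [under_self]; simp)

theorem iso_reidemeister_two {a b e : Bool} {x y : M} (l r : List (Bool × M)) :
    Iso (run ⟨M, l ++ (a, x) :: (b, y) :: r⟩ [⟨.cross e, l.length⟩, ⟨.cross !e, l.length⟩])
      ⟨M, l ++ (a, x) :: (b, y) :: r⟩ := by
  simp only [run]
  cases e
  · rw [Bool.not_false, step_cross_false (a := a) (b := b) (x := x) (y := y) l r rfl rfl,
      step_cross_true (a := b) (b := a) (x := y) (y := under b y x) l r rfl rfl, under_not_under]
    exact Iso.refl _
  · rw [Bool.not_true, step_cross_true (a := a) (b := b) (x := x) (y := y) l r rfl rfl,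
      step_cross_false (a := b) (b := a) (x := under (!a) x y) (y := x) l r rfl rfl,
      under_under_not]
    exact Iso.refl _

theorem iso_reidemeister_three {a b c e : Bool} {x y z : M} (l r : List (Bool × M)) :
    Iso (run ⟨M, l ++ (a, x) :: (b, y) :: (c, z) :: r⟩
        [⟨.cross e, l.length⟩, ⟨.cross e, l.length + 1⟩, ⟨.cross e, l.length⟩])
      (run ⟨M, l ++ (a, x) :: (b, y) :: (c, z) :: r⟩
        [⟨.cross e, l.length + 1⟩, ⟨.cross e, l.length⟩, ⟨.cross e, l.length + 1⟩]) := by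
  simp only [run]
  cases e
  · rw [step_cross_false (a := a) (b := b) (x := x) (y := y) l ((c, z) :: r) rfl rfl,
      step_cross_false (a := a) (b := c) (x := under b y x) (y := z) (l ++ [(b, y)]) r
        (by simp) (by simp),
      step_cross_false (a := b) (b := c) (x := y) (y := z) l ((a, under c z (under b y x)) :: r)
        (by simp) rfl,
      step_cross_false (a := b) (b := c) (x := y) (y := z) (l ++ [(a, x)]) r (by simp) (by simp),
      step_cross_false (a := a) (b := c) (x := x) (y := z) l ((b, under c z y) :: r)
        (by simp) rfl,
      step_cross_false (a := a) (b := b) (x := under c z x) (y := under c z y) (l ++ [(c, z)]) r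
        (by simp) (by simp)]
    exact Iso.of_eq (by rw [under_distrib]; simp)
  · rw [step_cross_true (a := a) (b := b) (x := x) (y := y) l ((c, z) :: r) rfl rfl,
      step_cross_true (a := a) (b := c) (x := x) (y := z) (l ++ [(b, under (!a) x y)]) r
        (by simp) (by simp),
      step_cross_true (a := b) (b := c) (x := under (!a) x y) (y := under (!a) x z) l ((a, x) :: r)
        (by simp) rfl,
      step_cross_true (a := b) (b := c) (x := y) (y := z) (l ++ [(a, x)]) r (by simp) (by simp),
      step_cross_true (a := a) (b := c) (x := x) (y := under (!b) y z) l ((b, y) :: r)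
        (by simp) rfl,
      step_cross_true (a := a) (b := b) (x := x) (y := y) (l ++ [(c, under (!a) x (under (!b) y z))])
        r (by simp) (by simp)]
    exact Iso.of_eq (by rw [← under_distrib (!a) (!b)]; simp)

end

theorem iso_of_localMove {u v : List Slice} (h : LocalMove u v) (X : Marked) {d d' : List Bool}
    (hu : dirRun (X.strands.map Prod.fst) u = some d)
    (hv : dirRun (X.strands.map Prod.fst) v = some d') : Iso (X.run u) (X.run v) := by
  cases h with
  | interchange p q i k => exact iso_interchange X p q i k hu hv
  | zigzag_left i b =>
    obtain ⟨M, s⟩ := X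
    simp only [dirRun] at hu
    obtain ⟨_, h, hu⟩ := Option.bind_eq_some_iff.1 hu
    obtain ⟨_, h', -⟩ := Option.bind_eq_some_iff.1 hu
    obtain ⟨l, r, rfl, rfl, rfl⟩ := Piece.cup_split h
    rw [show l.length + 1 = (l.map Prod.fst ++ [b]).length by simp,
      show l.map Prod.fst ++ b :: (!b) :: r.map Prod.fst =
        (l.map Prod.fst ++ [b]) ++ (!b) :: r.map Prod.fst by simp, Piece.dirAct_append] at h'
    rcases r with _ | ⟨⟨c, x⟩, r⟩
    · simp [Piece.dirAct, Piece.dirHead] at h'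
    · obtain rfl : c = b := by
        cases b <;> cases c <;> simp [Piece.dirAct, Piece.dirHead] at h' ⊢
      exact iso_zigzag_left l r
  | zigzag_right i b =>
    obtain ⟨M, s⟩ := X
    simp only [dirRun] at hu
    obtain ⟨_, h, hu⟩ := Option.bind_eq_some_iff.1 hu
    obtain ⟨_, h', -⟩ := Option.bind_eq_some_iff.1 hu
    obtain ⟨l, r, rfl, hi, rfl⟩ := Piece.cup_split h
    obtain ⟨l, ⟨c, x⟩, rfl, rfl⟩ := List.exists_eq_append_singleton hi
    rw [show (l ++ [(c, x)]).map Prod.fst ++ b :: (!b) :: r.map Prod.fst =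
        l.map Prod.fst ++ c :: b :: (!b) :: r.map Prod.fst by simp,
      ← List.length_map Prod.fst (as := l), Piece.dirAct_append] at h'
    obtain rfl : c = !b := by
      cases b <;> cases c <;> simp [Piece.dirAct, Piece.dirHead] at h' ⊢
    rw [List.append_assoc]
    exact iso_zigzag_right l r
  | slide_cap i e =>
    obtain ⟨M, s⟩ := X
    simp only [dirRun] at hu
    obtain ⟨_, h, hu⟩ := Option.bind_eq_some_iff.1 hu
    obtain ⟨_, h', -⟩ := Option.bind_eq_some_iff.1 hu
    obtain ⟨l, r, b, c, y, z, rfl, hi, rfl⟩ := Piece.cross_split h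
    obtain ⟨l, ⟨a, x⟩, rfl, rfl⟩ := List.exists_eq_append_singleton hi
    rw [show (l ++ [(a, x)]).map Prod.fst ++ c :: b :: r.map Prod.fst =
        l.map Prod.fst ++ a :: c :: b :: r.map Prod.fst by simp,
      ← List.length_map Prod.fst (as := l), Piece.dirAct_append] at h'
    obtain rfl : c = !a := by
      cases a <;> cases c <;> simp [Piece.dirAct, Piece.dirHead] at h' ⊢
    rw [List.append_assoc]
    exact iso_slide_cap l r
  | slide_cup i b e =>
    obtain ⟨M, s⟩ := X
    simp only [dirRun] at hv
    obtain ⟨_, h, -⟩ := Option.bind_eq_some_iff.1 hv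
    obtain ⟨l, r, rfl, hi, -⟩ := Piece.cup_split h
    obtain ⟨l, ⟨c, z⟩, rfl, rfl⟩ := List.exists_eq_append_singleton hi
    rw [List.append_assoc]
    exact iso_slide_cup l r
  | reidemeister_one_cap i e =>
    obtain ⟨M, s⟩ := X
    simp only [dirRun] at hv
    obtain ⟨_, h, -⟩ := Option.bind_eq_some_iff.1 hv
    obtain ⟨l, r, a, x, y, rfl, rfl, -⟩ := Piece.cap_split h
    exact iso_reidemeister_one_cap l r
  | reidemeister_one_cup i b e =>
    obtain ⟨M, s⟩ := X
    simp only [dirRun] at hv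
    obtain ⟨_, h, -⟩ := Option.bind_eq_some_iff.1 hv
    obtain ⟨l, r, rfl, rfl, -⟩ := Piece.cup_split h
    exact iso_reidemeister_one_cup l r
  | reidemeister_two i e =>
    obtain ⟨M, s⟩ := X
    simp only [dirRun] at hu
    obtain ⟨_, h, -⟩ := Option.bind_eq_some_iff.1 hu
    obtain ⟨l, r, a, b, x, y, rfl, rfl, -⟩ := Piece.cross_split h
    exact iso_reidemeister_two l r
  | reidemeister_three i e =>
    obtain ⟨M, s⟩ := X
    simp only [dirRun] at hv
    obtain ⟨_, h, -⟩ := Option.bind_eq_some_iff.1 hv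
    obtain ⟨l, r, b, c, y, z, rfl, hi, -⟩ := Piece.cross_split h
    obtain ⟨l, ⟨a, x⟩, rfl, rfl⟩ := List.exists_eq_append_singleton hi
    rw [List.append_assoc]
    exact iso_reidemeister_three l r

/-- The empty diagram. -/
def start : Marked := ⟨Fin 0 → ℤ[T;T⁻¹], []⟩

end Marked

namespace LinkDiagram

/-- The Alexander module of a diagram. -/
def marked (D : LinkDiagram) : Marked := Marked.start.run D.slices

theorem iso_marked_of_isotopic {D E : LinkDiagram} (h : D.Isotopic E) :
    Marked.Iso D.marked E.marked := by
  induction h with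
  | rel D E h =>
    obtain ⟨u, v, a, b, h, hD, hE⟩ := h
    have h1 := D.dirRun_slices
    have h2 := E.dirRun_slices
    rw [marked, marked, hD, hE, Marked.run_append, Marked.run_append, Marked.run_append,
      Marked.run_append]
    rw [hD, dirRun_append, dirRun_append] at h1
    rw [hE, dirRun_append, dirRun_append] at h2
    obtain ⟨d, h1, -⟩ := Option.bind_eq_some_iff.1 h1
    obtain ⟨d', h1, h3⟩ := Option.bind_eq_some_iff.1 h1
    rw [h1] at h2
    obtain ⟨d'', h2, -⟩ := Option.bind_eq_some_iff.1 h2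
    have h4 : (Marked.start.run u).strands.map Prod.fst = d' := Marked.run_strands h1
    exact (Marked.iso_of_localMove h _ (h4 ▸ h3) (h4 ▸ h2)).run v
  | refl D => exact Marked.Iso.refl _
  | symm D E _ h => exact h.symm
  | trans D E F _ _ h h' => exact h.trans h'

end LinkDiagram

end

/-! ### The Wirtinger presentation of the Alexander module -/

noncomputable section

namespace Relator

variable {M M' : Type} [AddCommGroup M'] [Module ℤ[T;T⁻¹] M'] [AddCommGroup M] [Module ℤ[T;T⁻¹] M]

/-- A colouring of the arcs satisfies a relator. -/
def Holds (c : ℕ → M) : Relator → Prop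
  | .crossing o l r => c r = Marked.under true (c o) (c l)
  | .join a b => c a = c b

/-- The arcs in a relator are smaller than `n`. -/
def Bounded (n : ℕ) : Relator → Prop
  | .crossing o l r => o < n ∧ l < n ∧ r < n
  | .join a b => a < n ∧ b < n

theorem Bounded.mono {n m : ℕ} (h : n ≤ m) {ρ : Relator} (hρ : ρ.Bounded n) : ρ.Bounded m := by
  cases ρ <;> simp only [Bounded] at hρ ⊢ <;> omega

theorem Holds.congr {n : ℕ} {c c' : ℕ → M} {ρ : Relator} (hρ : ρ.Bounded n)
    (h : ∀ j < n, c j = c' j) (hc : ρ.Holds c) : ρ.Holds c' := by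
  cases ρ with
  | crossing o l r => simpa only [Holds, h o hρ.1, h l hρ.2.1, h r hρ.2.2] using hc
  | join a b => simpa only [Holds, h a hρ.1, h b hρ.2] using hc

theorem Holds.map {c : ℕ → M} {ρ : Relator} (f : M →ₗ[ℤ[T;T⁻¹]] M') (h : ρ.Holds c) :
    ρ.Holds fun j => f (c j) := by
  cases ρ with
  | crossing o l r => simp only [Holds] at h ⊢; rw [h, Marked.map_under]
  | join a b => simp only [Holds] at h ⊢; rw [h]

/-- The Fox derivatives of a relator are the coefficients of the linear equation that it imposes on
colours. -/
theorem sum_row_smul {n : ℕ} {ρ : Relator} (hρ : ρ.Bounded n) (c : ℕ → M) :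
    ∑ j : Fin n, ρ.row j • c j = 0 ↔ ρ.Holds c := by
  have key (o : ℕ) (ho : o < n) (t : ℤ[T;T⁻¹]) :
      ∑ j : Fin n, (if (j : ℕ) = o then t else 0) • c j = t • c o := by
    rw [Fin.sum_univ_eq_sum_range fun j => (if j = o then t else 0) • c j]
    simp [ite_smul, ho]
  cases ρ with
  | crossing o l r =>
    simp only [row, sub_smul, add_smul, Finset.sum_sub_distrib, Finset.sum_add_distrib,
      key o hρ.1, key l hρ.2.1, key r hρ.2.2, Holds, Marked.under, if_true]
    rw [sub_eq_zero, one_smul, eq_comm]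
    simp
  | join a b =>
    simp only [row, sub_smul, Finset.sum_sub_distrib, key a hρ.1, key b hρ.2, Holds, one_smul,
      sub_eq_zero]

end Relator

/-- The module of `X` is presented by the arcs and relators of `S`, the arcs being sent to `c`. -/
structure Presents (S : Scan) (X : Marked) (c : ℕ → X.M) : Prop where
  lt : ∀ v ∈ S.strands, v.2 < S.arcs
  bounded : ∀ ρ ∈ S.relators, ρ.Bounded S.arcs
  strands : X.strands = S.strands.map fun v => (v.1, c v.2)
  sat : ∀ ρ ∈ S.relators, ρ.Holds c
  gen : Submodule.span ℤ[T;T⁻¹] (c '' {j | j < S.arcs}) = ⊤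
  lift : ∀ (A : Type) [AddCommGroup A] [Module ℤ[T;T⁻¹] A] (a : ℕ → A),
    (∀ ρ ∈ S.relators, ρ.Holds a) → ∃ f : X.M →ₗ[ℤ[T;T⁻¹]] A, ∀ j < S.arcs, f (c j) = a j

namespace Presents

variable {M : Type} [AddCommGroup M] [Module ℤ[T;T⁻¹] M] {c : ℕ → M} {l r : List (Bool × ℕ)}
  {n : ℕ} {R : List Relator} {s : List (Bool × M)}

theorem start : Presents Scan.start Marked.start fun _ => 0 where
  lt := by simp [Scan.start]
  bounded := by simp [Scan.start]
  strands := rfl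
  sat := by simp [Scan.start]
  gen := by
    rw [eq_top_iff]
    intro x _
    rw [show x = 0 from funext fun i => i.elim0]
    exact Submodule.zero_mem _
  lift := fun A _ _ a _ => ⟨0, by simp [Scan.start]⟩

theorem cup (h : Presents ⟨l ++ r, n, R⟩ ⟨M, s⟩ c) (b : Bool) :
    ∃ c', Presents ⟨l ++ (b, n) :: (!b, n) :: r, n + 1, R⟩
      (Marked.step ⟨M, s⟩ ⟨.cup b, l.length⟩) c' := by
  have hs := h.strands
  simp only [List.map_append] at hs
  rw [Marked.step_cup _ _ hs (by simp)]
  let c' : ℕ → M × ℤ[T;T⁻¹] := fun j => if j < n then (c j, 0) else (0, 1)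
  have hc' : ∀ j < n, c' j = LinearMap.inl ℤ[T;T⁻¹] _ _ (c j) := fun j hj => if_pos hj
  have hn : c' n = (0, 1) := if_neg (lt_irrefl n)
  refine ⟨c', ⟨?_, ?_, ?_, ?_, ?_, ?_⟩⟩
  · intro v hv
    simp only [List.mem_append, List.mem_cons] at hv
    have := h.lt v
    simp only [List.mem_append] at this
    rcases hv with hv | rfl | rfl | hv
    · exact (this (Or.inl hv)).trans (Nat.lt_succ_self _)
    · exact Nat.lt_succ_self _
    · exact Nat.lt_succ_self _
    · exact (this (Or.inr hv)).trans (Nat.lt_succ_self _)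
  · exact fun ρ hρ => (h.bounded ρ hρ).mono (Nat.le_succ n)
  · have key : ∀ u : List (Bool × ℕ), (∀ v ∈ u, v.2 < n) →
        Marked.mapS (LinearMap.inl ℤ[T;T⁻¹] M ℤ[T;T⁻¹]) (u.map fun v => (v.1, c v.2)) =
          u.map fun v => (v.1, c' v.2) := by
      intro u hu
      simp only [Marked.mapS, List.map_map]
      exact List.map_congr_left fun v hv => by simp [hc' _ (hu v hv)]
    simp only [List.map_append, List.map_cons, hn]
    rw [key l fun v hv => h.lt v (by simp [hv]), key r fun v hv => h.lt v (by simp [hv])]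
  · exact fun ρ hρ => ((h.sat ρ hρ).map (LinearMap.inl ℤ[T;T⁻¹] M ℤ[T;T⁻¹])).congr
      (h.bounded ρ hρ) fun j hj => (hc' j hj).symm
  · have hsub : Submodule.map (LinearMap.inl ℤ[T;T⁻¹] M ℤ[T;T⁻¹]) ⊤ ≤
        Submodule.span ℤ[T;T⁻¹] (c' '' {j | j < n + 1}) := by
      rw [← h.gen, Submodule.map_span]
      refine Submodule.span_mono ?_
      rintro _ ⟨_, ⟨j, hj, rfl⟩, rfl⟩
      exact ⟨j, Nat.lt_succ_of_lt hj, hc' j hj⟩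
    rw [eq_top_iff]
    rintro ⟨m, t⟩ -
    rw [show (m, t) = LinearMap.inl ℤ[T;T⁻¹] M ℤ[T;T⁻¹] m + t • c' n by simp [hn]]
    exact Submodule.add_mem _ (hsub ⟨m, trivial, rfl⟩)
      (Submodule.smul_mem _ _ (Submodule.subset_span ⟨n, Nat.lt_succ_self n, rfl⟩))
  · intro A _ _ a ha
    obtain ⟨f, hf⟩ := h.lift A a ha
    refine ⟨f.coprod (LinearMap.toSpanSingleton _ _ (a n)), fun j hj => ?_⟩
    rcases Nat.lt_succ_iff_lt_or_eq.1 hj with hj | rfl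
    · rw [hc' j hj]; simpa using hf j hj
    · rw [hn]; simp

theorem cap {a b : Bool} {x y : ℕ} (h : Presents ⟨l ++ (a, x) :: (b, y) :: r, n, R⟩ ⟨M, s⟩ c) :
    ∃ c', Presents ⟨l ++ r, n, .join x y :: R⟩ (Marked.step ⟨M, s⟩ ⟨.cap, l.length⟩) c' := by
  have hs := h.strands
  simp only [List.map_append, List.map_cons] at hs
  rw [Marked.step_cap _ _ hs (by simp)]
  refine ⟨fun j => Submodule.mkQ _ (c j), ⟨?_, ?_, ?_, ?_, ?_, ?_⟩⟩
  · intro v hv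
    refine h.lt v ?_
    simp only [List.mem_append, List.mem_cons] at hv ⊢
    tauto
  · intro ρ hρ
    rcases List.mem_cons.1 hρ with rfl | hρ
    · exact ⟨h.lt (a, x) (by simp), h.lt (b, y) (by simp)⟩
    · exact h.bounded ρ hρ
  · simp only [Marked.mapS, List.map_append, List.map_map, Function.comp_def]
  · intro ρ hρ
    rcases List.mem_cons.1 hρ with rfl | hρ
    · exact (Submodule.Quotient.eq _).2 (Submodule.mem_span_singleton_self _)
    · exact (h.sat ρ hρ).map _
  · have := congrArg (Submodule.map (Submodule.mkQ (Submodule.span ℤ[T;T⁻¹] {c x - c y}))) h.gen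
    rwa [Submodule.map_span, Submodule.map_top, Submodule.range_mkQ, Set.image_image] at this
  · intro A _ _ g hg
    obtain ⟨f, hf⟩ := h.lift A g fun ρ hρ => hg ρ (List.mem_cons_of_mem _ hρ)
    have hle : Submodule.span ℤ[T;T⁻¹] {c x - c y} ≤ LinearMap.ker f := ?_
    · exact ⟨Submodule.liftQ _ f hle, fun j hj => hf j hj⟩
    rw [Submodule.span_singleton_le_iff_mem, LinearMap.mem_ker, map_sub,
      hf x (h.lt (a, x) (by simp)), hf y (h.lt (b, y) (by simp)), sub_eq_zero]
    exact hg (.join x y) (by simp)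

/-- Add an arc whose colour is determined by a new relator. -/
theorem add_arc {S : Scan} {X : Marked} {c : ℕ → X.M} (h : Presents S X c) (ρ : Relator)
    (z : X.M) (strands : List (Bool × ℕ)) (hlt : ∀ v ∈ strands, v.2 < S.arcs + 1)
    (hρ : ρ.Bounded (S.arcs + 1))
    (hz : ∀ (A : Type) [AddCommGroup A] [Module ℤ[T;T⁻¹] A] (f : X.M →ₗ[ℤ[T;T⁻¹]] A) (a : ℕ → A),
      (∀ j < S.arcs, f (c j) = a j) → (ρ.Holds a ↔ a S.arcs = f z)) :
    Presents ⟨strands, S.arcs + 1, ρ :: S.relators⟩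
      ⟨X.M, strands.map fun v => (v.1, Function.update c S.arcs z v.2)⟩
      (Function.update c S.arcs z) := by
  have hc : ∀ j < S.arcs, Function.update c S.arcs z j = c j :=
    fun j hj => Function.update_of_ne hj.ne _ _
  refine ⟨hlt, ?_, rfl, ?_, ?_, ?_⟩
  · intro τ hτ
    rcases List.mem_cons.1 hτ with rfl | hτ
    · exact hρ
    · exact (h.bounded τ hτ).mono (Nat.le_succ _)
  · intro τ hτ
    rcases List.mem_cons.1 hτ with rfl | hτ
    · exact (hz X.M LinearMap.id _ fun j hj => (hc j hj).symm).2 (by simp)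
    · exact (h.sat τ hτ).congr (h.bounded τ hτ) fun j hj => (hc j hj).symm
  · rw [eq_top_iff, ← h.gen]
    refine Submodule.span_mono ?_
    rintro _ ⟨j, hj, rfl⟩
    exact ⟨j, Nat.lt_succ_of_lt hj, hc j hj⟩
  · intro A _ _ a ha
    obtain ⟨f, hf⟩ := h.lift A a fun τ hτ => ha τ (List.mem_cons_of_mem _ hτ)
    refine ⟨f, fun j hj => ?_⟩
    rcases Nat.lt_succ_iff_lt_or_eq.1 hj with hj | rfl
    · rw [hc j hj, hf j hj]
    · rw [Function.update_self]
      exact ((hz A f a hf).1 (ha ρ (by simp))).symm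

theorem step {S S' : Scan} {X : Marked} {c : ℕ → X.M} (h : Presents S X c) {e : Slice}
    (he : S.step e = some S') : ∃ c', Presents S' (X.step e) c' := by
  obtain ⟨p, i⟩ := e
  obtain ⟨u, n, R⟩ := S
  obtain ⟨M, s⟩ := X
  simp only [Scan.step] at he
  split at he
  · simp at he
  rename_i hi
  have hi : i ≤ u.length := by simpa using hi
  obtain ⟨l, r, rfl, rfl⟩ : ∃ l r, u = l ++ r ∧ i = l.length :=
    ⟨u.take i, u.drop i, by simp, by simp [hi]⟩
  simp only [List.drop_left, List.take_left] at he
  have hcongr : ∀ z : M, ∀ v : List (Bool × ℕ), (∀ w ∈ v, w.2 < n) →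
      v.map (fun w => (w.1, Function.update c n z w.2)) = v.map fun w => (w.1, c w.2) :=
    fun z v hv => List.map_congr_left fun w hw => by rw [Function.update_of_ne (hv w hw).ne]
  have hs := h.strands
  split at he
  · cases he
    exact h.cup _
  · split at he
    · simp at he
    · cases he
      exact h.cap
  · rename_i a x b y r _
    cases he
    simp only [List.map_append, List.map_cons] at hs
    have hx : x < n := h.lt (a, x) (by simp)
    have hy : y < n := h.lt (b, y) (by simp)
    have key := h.add_arc (if a then .crossing x n y else .crossing x y n)
      (Marked.under (!a) (c x) (c y)) (l ++ (b, n) :: (a, x) :: r) ?_ ?_ ?_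
    · rw [Marked.step_cross_true _ _ hs (by simp)]
      refine ⟨Function.update c n (Marked.under (!a) (c x) (c y)), ?_⟩
      convert key using 3
      rw [List.map_append, List.map_cons, List.map_cons,
        hcongr _ l fun w hw => h.lt w (by simp [hw]), hcongr _ r fun w hw => h.lt w (by simp [hw])]
      simp [Function.update_of_ne hx.ne]
    · intro v hv
      simp only [List.mem_append, List.mem_cons] at hv
      have := h.lt v
      simp only [List.mem_append, List.mem_cons] at this
      rcases hv with hv | rfl | hv | hv
      · exact (this (by tauto)).trans (Nat.lt_succ_self _)
      · exact Nat.lt_succ_self _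
      · exact (this (by tauto)).trans (Nat.lt_succ_self _)
      · exact (this (by tauto)).trans (Nat.lt_succ_self _)
    · cases a <;> simp [Relator.Bounded] <;> omega
    · intro A _ _ f g hg
      rw [Marked.map_under, hg x hx, hg y hy]
      -- For an overpass directed downwards the relator defines the new arc directly; otherwise the
      -- new arc is the one on its left, and the relator is solved backwards.
      cases a
      · exact Iff.rfl
      · simp only [if_true, Relator.Holds, Bool.not_true]
        constructor
        · intro h; rw [h]; exact (Marked.under_not_under true _ _).symm
        · intro h; rw [h]; exact (Marked.under_under_not true _ _).symm
  · rename_i a x b y r _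
    cases he
    simp only [List.map_append, List.map_cons] at hs
    have hx : x < n := h.lt (a, x) (by simp)
    have hy : y < n := h.lt (b, y) (by simp)
    have key := h.add_arc (if b then .crossing y x n else .crossing y n x)
      (Marked.under b (c y) (c x)) (l ++ (b, y) :: (a, n) :: r) ?_ ?_ ?_
    · rw [Marked.step_cross_false _ _ hs (by simp)]
      refine ⟨Function.update c n (Marked.under b (c y) (c x)), ?_⟩
      convert key using 3
      rw [List.map_append, List.map_cons, List.map_cons,
        hcongr _ l fun w hw => h.lt w (by simp [hw]), hcongr _ r fun w hw => h.lt w (by simp [hw])]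
      simp [Function.update_of_ne hy.ne]
    · intro v hv
      simp only [List.mem_append, List.mem_cons] at hv
      have := h.lt v
      simp only [List.mem_append, List.mem_cons] at this
      rcases hv with hv | hv | rfl | hv
      · exact (this (by tauto)).trans (Nat.lt_succ_self _)
      · exact (this (by tauto)).trans (Nat.lt_succ_self _)
      · exact Nat.lt_succ_self _
      · exact (this (by tauto)).trans (Nat.lt_succ_self _)
    · cases b <;> simp [Relator.Bounded] <;> omega
    · intro A _ _ f g hg
      rw [Marked.map_under, hg x hx, hg y hy]
      cases b
      · simp only [Relator.Holds, Bool.false_eq_true, if_false]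
        constructor
        · intro h; rw [h]; exact (Marked.under_not_under true _ _).symm
        · intro h; rw [h]; exact (Marked.under_under_not true _ _).symm
      · exact Iff.rfl
  · simp at he

theorem run {S S' : Scan} {X : Marked} {c : ℕ → X.M} (h : Presents S X c) {w : List Slice}
    (hw : S.run w = some S') : ∃ c', Presents S' (X.run w) c' := by
  induction w generalizing S X with
  | nil => cases hw; exact ⟨c, h⟩
  | cons e w ih =>
    simp only [Scan.run] at hw
    obtain ⟨S₁, h₁, hw⟩ := Option.bind_eq_some_iff.1 hw
    obtain ⟨c₁, h₁⟩ := h.step h₁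
    exact ih h₁ hw

theorem surjective {S : Scan} {X : Marked} {c : ℕ → X.M} (h : Presents S X c) :
    Function.Surjective (Fintype.linearCombination ℤ[T;T⁻¹] fun j : Fin S.arcs => c j) := by
  rw [← LinearMap.range_eq_top, Fintype.range_linearCombination, ← h.gen]
  congr 1
  ext x
  constructor
  · rintro ⟨j, rfl⟩; exact ⟨j, j.2, rfl⟩
  · rintro ⟨j, hj, rfl⟩; exact ⟨⟨j, hj⟩, rfl⟩

/-- The universal property, tested on the cokernel of the Alexander matrix, shows that there are no
further relations. -/
theorem ker_eq {S : Scan} {X : Marked} {c : ℕ → X.M} (h : Presents S X c) :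
    LinearMap.ker (Fintype.linearCombination ℤ[T;T⁻¹] fun j : Fin S.arcs => c j) =
      Submodule.span ℤ[T;T⁻¹] (Set.range fun (i : Fin S.relators.length) (j : Fin S.arcs) =>
        (S.relators.get i).row j) := by
  set N := Submodule.span ℤ[T;T⁻¹] (Set.range fun (i : Fin S.relators.length) (j : Fin S.arcs) =>
        (S.relators.get i).row j) with hN
  apply le_antisymm
  · let a : ℕ → (Fin S.arcs → ℤ[T;T⁻¹]) ⧸ N :=
      fun j => if hj : j < S.arcs then N.mkQ (Pi.single ⟨j, hj⟩ 1) else 0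
    have ha : ∀ j : Fin S.arcs, a j = N.mkQ (Pi.single j 1) := fun j => dif_pos j.2
    have hsum : ∀ v : Fin S.arcs → ℤ[T;T⁻¹], ∑ j, v j • a j = N.mkQ v := by
      intro v
      simp only [ha, ← map_smul, ← map_sum]
      congr 1
      ext j
      simp [Finset.sum_apply, Pi.single_apply]
    obtain ⟨f, hf⟩ := h.lift _ a fun ρ hρ => by
      rw [← Relator.sum_row_smul (h.bounded ρ hρ), hsum fun j => ρ.row j, Submodule.mkQ_apply,
        Submodule.Quotient.mk_eq_zero]
      obtain ⟨i, rfl⟩ := List.mem_iff_get.1 hρ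
      exact Submodule.subset_span ⟨i, rfl⟩
    intro v hv
    rw [LinearMap.mem_ker, Fintype.linearCombination_apply] at hv
    have h1 := congrArg f hv
    simp only [map_sum, map_smul, map_zero, fun j : Fin S.arcs => hf j j.2, hsum] at h1
    rwa [Submodule.mkQ_apply, Submodule.Quotient.mk_eq_zero] at h1
  · rw [hN, Submodule.span_le]
    rintro _ ⟨i, rfl⟩
    have hρ : S.relators.get i ∈ S.relators := List.get_mem _ _
    simp only [SetLike.mem_coe, LinearMap.mem_ker, Fintype.linearCombination_apply]
    exact (Relator.sum_row_smul (h.bounded _ hρ) c).2 (h.sat _ hρ)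

end Presents

namespace LinkDiagram

theorem exists_presents (D : LinkDiagram) : ∃ c, Presents D.scan D.marked c :=
  Presents.start.run D.closed.choose_spec.1

theorem alexanderIdeal_eq (D : LinkDiagram) {c : ℕ → D.marked.M} (h : Presents D.scan D.marked c) :
    D.alexanderIdeal = Submodule.minorIdeal (D.scan.arcs - 1)
      (LinearMap.ker (Fintype.linearCombination ℤ[T;T⁻¹] fun j : Fin D.scan.arcs => c j)) := by
  rw [h.ker_eq, Submodule.minorIdeal_span]
  rfl

end LinkDiagram

end

noncomputable section

/-! ## The Burau representation -/

namespace Burau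

section

variable {R : Type*} [CommRing R] {n : ℕ} {M : Type*} [AddCommGroup M] [Module R M]

/-- The action of a matrix on tuples of module elements. -/
def smulVec (A : Matrix (Fin n) (Fin n) R) (y : Fin n → M) : Fin n → M := fun i => ∑ j, A i j • y j

theorem smulVec_mul (A B : Matrix (Fin n) (Fin n) R) (y : Fin n → M) :
    smulVec (A * B) y = smulVec A (smulVec B y) := by
  ext i
  simp only [smulVec, Matrix.mul_apply, Finset.sum_smul, Finset.smul_sum, mul_smul]
  exact Finset.sum_comm

theorem smulVec_one (y : Fin n → M) : smulVec (1 : Matrix (Fin n) (Fin n) R) y = y := by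
  ext i
  simp [smulVec, Matrix.one_apply, ite_smul]

/-- The action of a generator on vectors is a short formula with three cases, which makes relations
easier to check than on matrix entries. -/
theorem ext_smulVec {A B : Matrix (Fin n) (Fin n) R}
    (h : ∀ y : Fin n → R, smulVec A y = smulVec B y) : A = B := by
  ext i j
  have := congrFun (h (Pi.single j 1)) i
  simpa [smulVec, Pi.single_apply] using this

/-- The left strand of a generator. -/
def lo (i : Fin (n - 1)) : Fin n := ⟨i, by omega⟩

/-- The right strand of a generator. -/
def hi (i : Fin (n - 1)) : Fin n := ⟨i + 1, by omega⟩

theorem lo_ne_hi (i : Fin (n - 1)) : lo i ≠ hi i := by simp [lo, hi]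

/-- The matrix of an Artin generator: it expresses the colours of the strands below the crossing by
those above it. -/
def gen (t : R) (i : Fin (n - 1)) : Matrix (Fin n) (Fin n) R :=
  Matrix.of fun a b => if a = lo i then (if b = hi i then 1 else 0) else
    if a = hi i then (if b = lo i then t else if b = hi i then 1 - t else 0) else
      if a = b then 1 else 0

/-- The inverse of the matrix of an Artin generator, for the inverse parameter. -/
def genInv (t : R) (i : Fin (n - 1)) : Matrix (Fin n) (Fin n) R :=
  Matrix.of fun a b => if a = lo i then (if b = hi i then t else if b = lo i then 1 - t else 0) else
    if a = hi i then (if b = lo i then 1 else 0) else if a = b then 1 else 0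

theorem smulVec_gen (t : R) (i : Fin (n - 1)) (y : Fin n → M) (a : Fin n) :
    smulVec (gen t i) y a = if a = lo i then y (hi i) else
      if a = hi i then t • y (lo i) + (1 - t) • y (hi i) else y a := by
  simp only [smulVec, gen, Matrix.of_apply]
  split_ifs
  · simp [ite_smul]
  · rw [Finset.sum_eq_add (lo i) (hi i) (lo_ne_hi i)] <;> simp +contextual [(lo_ne_hi i).symm]
  · simp [ite_smul]

theorem smulVec_genInv (t : R) (i : Fin (n - 1)) (y : Fin n → M) (a : Fin n) :
    smulVec (genInv t i) y a = if a = lo i then (1 - t) • y (lo i) + t • y (hi i) else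
      if a = hi i then y (lo i) else y a := by
  simp only [smulVec, genInv, Matrix.of_apply]
  split_ifs
  · rw [Finset.sum_eq_add (lo i) (hi i) (lo_ne_hi i)] <;> simp +contextual [lo_ne_hi i]
  · simp [ite_smul]
  · simp [ite_smul]

theorem gen_mul_genInv {t s : R} (h : t * s = 1) (i : Fin (n - 1)) : gen t i * genInv s i = 1 := by
  refine ext_smulVec fun y => ?_
  ext a
  rw [smulVec_mul, smulVec_one, smulVec_gen]
  simp only [smulVec_genInv, if_true, (lo_ne_hi i).symm, if_false, smul_eq_mul]
  split_ifs with h1 h2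
  · rw [h1]
  · rw [h2]; linear_combination (y (hi i) - y (lo i)) * h
  · rfl

theorem genInv_mul_gen {t s : R} (h : t * s = 1) (i : Fin (n - 1)) : genInv s i * gen t i = 1 := by
  refine ext_smulVec fun y => ?_
  ext a
  rw [smulVec_mul, smulVec_one, smulVec_genInv]
  simp only [smulVec_gen, if_true, (lo_ne_hi i).symm, if_false, smul_eq_mul]
  split_ifs with h1 h2
  · rw [h1]; linear_combination (y (lo i) - y (hi i)) * h
  · rw [h2]
  · rfl

theorem gen_comm (t : R) {i j : Fin (n - 1)} (h : (i : ℕ) + 2 ≤ j) :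
    gen t i * gen t j = gen t j * gen t i := by
  refine ext_smulVec fun y => ?_
  have h1 : lo i ≠ lo j := by simp [lo]; omega
  have h2 : lo i ≠ hi j := by simp [lo, hi]; omega
  have h3 : hi i ≠ lo j := by simp [lo, hi]; omega
  have h4 : hi i ≠ hi j := by simp [hi]; omega
  ext a
  simp only [smulVec_mul, smulVec_gen, h1, h2, h3, h4, h1.symm, h2.symm, h3.symm, h4.symm, if_false]
  split_ifs <;> simp_all

theorem gen_braid (t : R) {i j : Fin (n - 1)} (h : (i : ℕ) + 1 = j) :
    gen t i * gen t j * gen t i = gen t j * gen t i * gen t j := by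
  refine ext_smulVec fun y => ?_
  have h1 : lo j = hi i := by simp [lo, hi]; omega
  have h2 : lo i ≠ hi j := by simp [lo, hi]; omega
  have h4 : hi i ≠ hi j := by simp [hi]; omega
  have h5 := lo_ne_hi i
  ext a
  simp only [smulVec_mul, smulVec_gen, h1, h2, h4, h5, h2.symm, h4.symm, h5.symm, if_true,
    if_false, smul_eq_mul]
  split_ifs <;> first | ring1 | simp_all

theorem map_gen {R' : Type*} [CommRing R'] (f : R →+* R') (t : R) (i : Fin (n - 1)) :
    (gen t i).map f = gen (f t) i := by
  ext a b
  simp only [gen, Matrix.map_apply, Matrix.of_apply, apply_ite f, map_one, map_zero, map_sub]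

end

variable {n : ℕ}

theorem T_mul_T_neg : (T 1 * T (-1) : ℤ[T;T⁻¹]) = 1 := by rw [← T_add, ← T_zero]; rfl

/-- The matrix of an Artin generator as a unit. -/
def genUnit (i : Fin (n - 1)) : (Matrix (Fin n) (Fin n) ℤ[T;T⁻¹])ˣ :=
  ⟨gen (T 1) i, genInv (T (-1)) i, gen_mul_genInv T_mul_T_neg i, genInv_mul_gen T_mul_T_neg i⟩

/-- The Burau representation. -/
def hom (n : ℕ) : BraidGroup n →* (Matrix (Fin n) (Fin n) ℤ[T;T⁻¹])ˣ :=
  PresentedGroup.toGroup (f := genUnit) (by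
    rintro r (⟨i, j, h, rfl⟩ | ⟨i, j, h, rfl⟩)
    · simp only [map_mul, map_inv, FreeGroup.lift_apply_of, mul_inv_eq_one]
      exact Units.ext (gen_comm _ h)
    · simp only [map_mul, map_inv, FreeGroup.lift_apply_of, mul_inv_eq_one]
      exact Units.ext (gen_braid _ h))

theorem hom_sigma (i : Fin (n - 1)) : (hom n (BraidGroup.sigma i)).1 = gen (T 1) i := by
  rw [hom, BraidGroup.sigma, PresentedGroup.toGroup.of]
  rfl

theorem hom_ofWord_nil : hom n (BraidGroup.ofWord []) = 1 := map_one _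

theorem hom_ofWord_cons (c : Fin (n - 1) × Bool) (w : List (Fin (n - 1) × Bool)) :
    (hom n (BraidGroup.ofWord (c :: w))).1 =
      (if c.2 then gen (T 1) c.1 else genInv (T (-1)) c.1) * (hom n (BraidGroup.ofWord w)).1 := by
  have h : BraidGroup.ofWord (c :: w) = BraidGroup.ofWord [c] * BraidGroup.ofWord w := by
    rw [BraidGroup.ofWord, BraidGroup.ofWord, BraidGroup.ofWord, ← map_mul, FreeGroup.mul_mk]
    rfl
  rw [h, map_mul, Units.val_mul]
  congr 1
  obtain ⟨i, b⟩ := c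
  cases b
  · have : BraidGroup.ofWord [(i, false)] = (BraidGroup.sigma i)⁻¹ := rfl
    rw [this, map_inv, hom, BraidGroup.sigma, PresentedGroup.toGroup.of]
    rfl
  · exact hom_sigma i

theorem ofFn_split {α : Type*} (i : Fin (n - 1)) (g : Fin n → α) :
    List.ofFn g = (List.ofFn fun k : Fin i => g ⟨k, by omega⟩) ++ g (lo i) :: g (hi i) ::
      List.ofFn fun k : Fin (n - 2 - i) => g ⟨i + 2 + k, by omega⟩ := by
  refine List.ext_getElem (by simp; omega) fun k h1 h2 => ?_
  simp only [List.getElem_ofFn, List.getElem_append, List.getElem_cons, List.length_ofFn, lo, hi]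
  split_ifs <;> congr 2 <;> omega

section

variable {M : Type} [AddCommGroup M] [Module ℤ[T;T⁻¹] M]

theorem step_cross (c : Fin (n - 1) × Bool) (x : Fin n → M) (r : List (Bool × M)) :
    ∃ y : Fin n → M, Marked.step ⟨M, (List.ofFn fun i => (true, x i)) ++ r⟩
        ⟨.cross c.2, (c.1 : ℕ)⟩ = ⟨M, (List.ofFn fun i => (true, y i)) ++ r⟩ ∧
      x = smulVec (if c.2 then gen (T 1) c.1 else genInv (T (-1)) c.1 :
        Matrix (Fin n) (Fin n) ℤ[T;T⁻¹]) y := by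
  obtain ⟨i, e⟩ := c
  have hne := lo_ne_hi i
  have h1 : ∀ k : Fin (i : ℕ), (⟨k, by omega⟩ : Fin n) ≠ lo i ∧ (⟨k, by omega⟩ : Fin n) ≠ hi i :=
    fun k => by simp only [lo, hi, ne_eq, Fin.mk.injEq]; omega
  have h2 : ∀ k : Fin (n - 2 - (i : ℕ)), (⟨i + 2 + k, by omega⟩ : Fin n) ≠ lo i ∧
      (⟨i + 2 + k, by omega⟩ : Fin n) ≠ hi i :=
    fun k => by simp only [lo, hi, ne_eq, Fin.mk.injEq]; omega
  have key : ∀ u v : M, ∀ y : Fin n → M,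
      y = (fun k => if k = lo i then u else if k = hi i then v else x k) →
      (List.ofFn fun i => (true, y i)) = (List.ofFn fun k : Fin i => (true, x ⟨k, by omega⟩)) ++
        (true, u) :: (true, v) ::
          List.ofFn fun k : Fin (n - 2 - i) => (true, x ⟨i + 2 + k, by omega⟩) := by
    rintro u v y rfl
    rw [ofFn_split i]
    simp [h1, h2, hne.symm]
  have hs := ofFn_split i fun i => (true, x i)
  cases e
  · refine ⟨fun k => if k = lo i then x (hi i) else
      if k = hi i then Marked.under true (x (hi i)) (x (lo i)) else x k, ?_, ?_⟩
    · rw [key _ _ _ rfl, hs, Marked.step_cross_false _ _ (by rw [List.append_assoc]; rfl) (by simp)]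
      simp
    · ext a
      simp only [Bool.false_eq_true, if_false, smulVec_genInv, if_true, hne.symm, Marked.under]
      split_ifs with h3 h4
      · have h := T_mul_T_neg
        rw [h3, smul_add, smul_smul, smul_smul, mul_sub, mul_comm (T (-1)) (T 1), h]
        module
      · rw [h4]
      · rfl
  · refine ⟨fun k => if k = lo i then Marked.under false (x (lo i)) (x (hi i)) else
      if k = hi i then x (lo i) else x k, ?_, ?_⟩
    · rw [key _ _ _ rfl, hs, Marked.step_cross_true _ _ (by rw [List.append_assoc]; rfl) (by simp)]
      simp
    · ext a
      simp only [Bool.false_eq_true, if_false, smulVec_gen, if_true, hne.symm, Marked.under]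
      split_ifs with h3 h4
      · rw [h3]
      · have h := T_mul_T_neg
        rw [h4, smul_add, smul_smul, smul_smul, mul_sub, h]
        module
      · rfl

/-- Expressing the lower colours by the upper ones makes the matrices multiply in the order of the
word. -/
theorem run_crossings (w : List (Fin (n - 1) × Bool)) (x : Fin n → M) (r : List (Bool × M)) :
    ∃ y : Fin n → M, Marked.run ⟨M, (List.ofFn fun i => (true, x i)) ++ r⟩
        (w.map fun c => ⟨.cross c.2, (c.1 : ℕ)⟩) = ⟨M, (List.ofFn fun i => (true, y i)) ++ r⟩ ∧
      x = smulVec (hom n (BraidGroup.ofWord w)).1 y := by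
  induction w generalizing x with
  | nil => exact ⟨x, rfl, by rw [hom_ofWord_nil, Units.val_one, smulVec_one]⟩
  | cons c w ih =>
    obtain ⟨y, hy, hxy⟩ := step_cross c x r
    obtain ⟨z, hz, hyz⟩ := ih y
    refine ⟨z, ?_, ?_⟩
    · rw [List.map_cons, Marked.run, hy, hz]
    · rw [hom_ofWord_cons, smulVec_mul, ← hyz, ← hxy]

end

/-- The final module is an iterated quotient, one step for each maximum; the surjection from `M`
collects all relations into one kernel. -/
theorem run_caps (n : ℕ) {M : Type} [AddCommGroup M] [Module ℤ[T;T⁻¹] M] (x y : Fin n → M) :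
    ∃ f : M →ₗ[ℤ[T;T⁻¹]] (Marked.run ⟨M, (List.ofFn fun i => (true, y i)) ++
        (List.ofFn fun i => (false, x i)).reverse⟩
          ((List.range n).reverse.map fun k => ⟨.cap, k⟩)).M,
      Function.Surjective f ∧
        LinearMap.ker f = Submodule.span ℤ[T;T⁻¹] (Set.range fun i => y i - x i) := by
  induction n generalizing M with
  | zero =>
    refine ⟨LinearMap.id, Function.surjective_id, ?_⟩
    rw [Set.range_eq_empty, Submodule.span_empty]
    exact LinearMap.ker_id
  | succ n ih =>
    rw [List.range_succ, List.reverse_append, List.reverse_singleton, List.singleton_append,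
      List.map_cons, Marked.run, List.ofFn_succ_last, List.ofFn_succ_last, List.reverse_append,
      List.reverse_singleton, List.singleton_append, List.append_assoc, List.singleton_append,
      Marked.step_cap _ _ rfl (by simp), Marked.mapS_append]
    set N := Submodule.span ℤ[T;T⁻¹] {y (Fin.last n) - x (Fin.last n)} with hN
    obtain ⟨f, hf, hk⟩ := ih (fun i => N.mkQ (x i.castSucc)) (fun i => N.mkQ (y i.castSucc))
    have e1 : Marked.mapS N.mkQ (List.ofFn fun i : Fin n => (true, y i.castSucc)) =
        List.ofFn fun i => (true, N.mkQ (y i.castSucc)) := by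
      simp [Marked.mapS, List.map_ofFn, Function.comp_def]
    have e2 : Marked.mapS N.mkQ (List.ofFn fun i : Fin n => (false, x i.castSucc)).reverse =
        (List.ofFn fun i => (false, N.mkQ (x i.castSucc))).reverse := by
      simp [Marked.mapS, List.map_ofFn, Function.comp_def]
    rw [e1, e2]
    refine ⟨f ∘ₗ N.mkQ, ?_, ?_⟩
    · rw [LinearMap.coe_comp]; exact hf.comp N.mkQ_surjective
    · rw [LinearMap.ker_comp, hk]
      simp only [← map_sub]
      rw [Set.range_comp' N.mkQ, ← Submodule.map_span, Submodule.comap_map_mkQ, hN,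
        ← Submodule.span_union]
      congr 1
      ext z
      simp [Fin.exists_fin_succ', or_comm, eq_comm]

theorem scan_cups (n : ℕ) : Scan.start.run ((List.range n).map fun k => ⟨.cup true, k⟩) =
    some ⟨(List.ofFn fun i : Fin n => (true, (i : ℕ))) ++
      (List.ofFn fun i : Fin n => (false, (i : ℕ))).reverse, n, []⟩ := by
  induction n with
  | zero => rfl
  | succ n ih =>
    rw [List.range_succ, List.map_append, Scan.run_append, ih, List.ofFn_succ_last,
      List.ofFn_succ_last]
    simp [Scan.run, Scan.step]

/-- The presentation of the Alexander module of a closed braid by its Burau matrix. -/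
theorem exists_surjective (n : ℕ) (w : List (Fin (n - 1) × Bool)) :
    ∃ π : (Fin n → ℤ[T;T⁻¹]) →ₗ[ℤ[T;T⁻¹]] (braidClosure n w).marked.M, Function.Surjective π ∧
      LinearMap.ker π = Submodule.span ℤ[T;T⁻¹]
        (Set.range (1 - (hom n (BraidGroup.ofWord w)).1).row) := by
  have h := Presents.start.run (scan_cups n)
  rw [show (braidClosure n w).marked = Marked.start.run (closureSlices n w) from rfl,
    closureSlices, Marked.run_append, Marked.run_append]
  generalize Marked.start.run ((List.range n).map fun k => ⟨.cup true, k⟩) = X at h ⊢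
  obtain ⟨M, s⟩ := X
  obtain ⟨c, h⟩ := h
  let x : Fin n → M := fun i => c i
  have hs := h.strands
  simp only [List.map_append, List.map_reverse, List.map_ofFn, Function.comp_def] at hs
  obtain ⟨y, hy, hxy⟩ := run_crossings w x (List.ofFn fun i => (false, x i)).reverse
  rw [hs, hy]
  obtain ⟨f, hf, hk⟩ := run_caps n x y
  let πx := Fintype.linearCombination ℤ[T;T⁻¹] x
  let πy := Fintype.linearCombination ℤ[T;T⁻¹] y
  have hx : Function.Surjective πx := h.surjective
  -- Minima create no relators, so the kernel is spanned by an empty family and `x` is a basis.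
  have hx' : Function.Injective πx := by
    rw [← LinearMap.ker_eq_bot]
    refine h.ker_eq.trans ?_
    rw [Submodule.span_eq_bot]
    rintro _ ⟨i, rfl⟩
    exact i.elim0
  have hy : Function.Surjective πy := by
    rw [← LinearMap.range_eq_top, eq_top_iff, ← LinearMap.range_eq_top.2 hx,
      Fintype.range_linearCombination, Fintype.range_linearCombination, Submodule.span_le]
    rintro _ ⟨i, rfl⟩
    rw [hxy]
    exact Submodule.sum_mem _ fun j _ => Submodule.smul_mem _ _ (Submodule.subset_span ⟨j, rfl⟩)
  have hy' : Function.Injective πy := by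
    let e := LinearEquiv.ofBijective πx ⟨hx', hx⟩
    -- `y` generates because `x` is expressed by it; a surjective endomorphism of a finitely
    -- generated module is injective, so `y` is a basis too.
    have := OrzechProperty.injective_of_surjective_endomorphism (e.symm.toLinearMap ∘ₗ πy)
      (by rw [LinearMap.coe_comp]; exact e.symm.surjective.comp hy)
    rw [LinearMap.coe_comp] at this
    exact this.of_comp
  refine ⟨f ∘ₗ πy, by rw [LinearMap.coe_comp]; exact hf.comp hy, ?_⟩
  rw [LinearMap.ker_comp, hk]
  have h1 : (fun i => y i - x i) =
      fun i => πy ((1 - (hom n (BraidGroup.ofWord w)).1).row i) := by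
    ext i
    have h2 : πy ((1 : Matrix (Fin n) (Fin n) ℤ[T;T⁻¹]).row i) = y i :=
      congrFun (smulVec_one (R := ℤ[T;T⁻¹]) y) i
    have h3 : πy ((hom n (BraidGroup.ofWord w)).1.row i) = x i := (congrFun hxy i).symm
    rw [show (1 - (hom n (BraidGroup.ofWord w)).1).row i =
      (1 : Matrix (Fin n) (Fin n) ℤ[T;T⁻¹]).row i - (hom n (BraidGroup.ofWord w)).1.row i from rfl,
      map_sub, h2, h3]
  rw [h1, Set.range_comp' πy, ← Submodule.map_span, Submodule.comap_map_eq_of_injective hy']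

end Burau

end

/-! ### Determinants and the Burau matrices of positive braids -/

noncomputable section

namespace Matrix

variable {R : Type*} [CommRing R]

/-- `A` is strictly triangular with respect to `ρ`. A non-trivial permutation with a non-zero term
in the Leibniz formula would increase the sum of `ρ`, which permutations preserve. -/
theorem det_one_sub_eq_one {ι : Type*} [Fintype ι] [DecidableEq ι] (ρ : ι → ℕ) (A : Matrix ι ι R)
    (h : ∀ a b, A a b ≠ 0 → ρ b < ρ a) : (1 - A).det = 1 := by
  rw [det_apply, Finset.sum_eq_single 1]
  · have : ∀ a, A a a = 0 := fun a => by
      by_contra h'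
      exact lt_irrefl _ (h a a h')
    simp [this]
  · intro σ _ hσ
    have : ∃ a, (1 - A) (σ a) a = 0 := by
      by_contra! hne
      have h1 : ∀ a, σ a ≠ a → ρ a < ρ (σ a) := fun a ha => h _ _ fun h0 => hne a (by
        rw [sub_apply, one_apply_ne ha, h0, sub_zero])
      have h2 : ∃ a, σ a ≠ a := by
        by_contra! h3
        exact hσ (Equiv.ext h3)
      obtain ⟨a, ha⟩ := h2
      have h3 : ∑ a, ρ a < ∑ a, ρ (σ a) := by
        refine Finset.sum_lt_sum (fun b _ => ?_) ⟨a, Finset.mem_univ _, h1 a ha⟩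
        by_cases hb : σ b = b
        · rw [hb]
        · exact (h1 b hb).le
      rw [Equiv.sum_comp] at h3
      exact lt_irrefl _ h3
    obtain ⟨a, ha⟩ := this
    rw [Finset.prod_eq_zero (f := fun i => (1 - A) (σ i) i) (Finset.mem_univ a) ha, smul_zero]
  · simp

/-- If the rows of a matrix sum to zero, and so do the columns with suitable weights, then its
first elementary ideal is principal. -/
theorem minorIdeal_eq_span_det {m : ℕ} (D : Matrix (Fin (m + 1)) (Fin (m + 1)) R)
    (hrow : ∀ i, ∑ j, D i j = 0) (w : Fin (m + 1) → R) (hw : w (Fin.last m) = 1)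
    (hcol : ∀ j, ∑ i, w i * D i j = 0) :
    Submodule.minorIdeal m (Submodule.span R (Set.range D.row)) =
      Ideal.span {(D.submatrix Fin.castSucc Fin.castSucc).det} := by
  -- The weight of the last row is 1, so this row is a combination of the others.
  have h1 : Submodule.span R (Set.range D.row) =
      Submodule.span R (Set.range fun i : Fin m => D.row i.castSucc) := by
    apply le_antisymm
    · rw [Submodule.span_le]
      rintro _ ⟨i, rfl⟩
      refine Fin.lastCases ?_ (fun i => Submodule.subset_span ⟨i, rfl⟩) i
      have : D.row (Fin.last m) = -∑ i : Fin m, w i.castSucc • D.row i.castSucc := by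
        ext j
        have := hcol j
        rw [Fin.sum_univ_castSucc, hw, one_mul] at this
        simp only [Pi.neg_apply, Finset.sum_apply, Pi.smul_apply, smul_eq_mul, row_apply]
        linear_combination this
      rw [this]
      exact Submodule.neg_mem _ (Submodule.sum_mem _ fun i _ =>
        Submodule.smul_mem _ _ (Submodule.subset_span ⟨i, rfl⟩))
    · refine Submodule.span_mono ?_
      rintro _ ⟨i, rfl⟩
      exact ⟨_, rfl⟩
  rw [h1, Submodule.minorIdeal_span]
  apply le_antisymm
  · rw [Ideal.span_le]
    rintro _ ⟨f, g, rfl⟩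
    let E : Matrix (Fin m) (Fin m) R := (1 : Matrix (Fin m) (Fin m) R).submatrix f id
    -- `Q` writes the chosen columns in terms of the first `m`; the last column is minus their sum.
    let Q : Matrix (Fin m) (Fin m) R := of fun j b =>
      Fin.lastCases (motive := fun _ => R) (-1) (fun c => if j = c then 1 else 0) (g b)
    have h2 : submatrix (fun i : Fin m => D.row i.castSucc) f g =
        E * D.submatrix Fin.castSucc Fin.castSucc * Q := by
      have h3 : E * D.submatrix Fin.castSucc Fin.castSucc =
          (D.submatrix Fin.castSucc Fin.castSucc).submatrix f id := by
        ext i j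
        simp [E, mul_apply, one_apply]
      rw [h3]
      ext i b
      rw [show submatrix (fun i : Fin m => D.row i.castSucc) f g i b = D (f i).castSucc (g b) from rfl]
      simp only [submatrix_apply, mul_apply, Q, of_apply, id]
      generalize g b = c
      refine Fin.lastCases ?_ (fun c => ?_) c
      · have := hrow (f i).castSucc
        rw [Fin.sum_univ_castSucc] at this
        simp only [Fin.lastCases_last, mul_neg, mul_one, Finset.sum_neg_distrib]
        linear_combination this
      · simp
    rw [h2, det_mul, det_mul]
    exact Ideal.mul_mem_right _ _ (Ideal.mul_mem_left _ _ (Ideal.mem_span_singleton_self _))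
  · rw [Ideal.span_singleton_le_iff_mem]
    exact Ideal.subset_span ⟨id, Fin.castSucc, rfl⟩

end Matrix

namespace Burau

variable {R : Type*} [CommRing R] {n : ℕ}

/-- The matrix of a positive braid. -/
def posMat (t : R) (u : List (Fin (n - 1))) : Matrix (Fin n) (Fin n) R := (u.map (gen t)).prod

theorem map_posMat {R' : Type*} [CommRing R'] (f : R →+* R') (t : R) (u : List (Fin (n - 1))) :
    (posMat t u).map f = posMat (f t) u := by
  rw [posMat, ← RingHom.mapMatrix_apply, map_list_prod, List.map_map]
  congr 2
  ext i : 1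
  exact map_gen f t i

theorem posMat_cons (t : R) (i : Fin (n - 1)) (u : List (Fin (n - 1))) :
    posMat t (i :: u) = gen t i * posMat t u := by simp [posMat]

theorem posMat_nil (t : R) : posMat t ([] : List (Fin (n - 1))) = 1 := rfl

/-- The weights fixed by the Burau representation. -/
def weightVec (n : ℕ) (t : R) (a : Fin n) : R := t ^ (n - 1 - (a : ℕ))

/-- Giving all arcs the same colour is always consistent. -/
theorem posMat_sum_row (t : R) (u : List (Fin (n - 1))) (a : Fin n) :
    ∑ b, posMat t u a b = 1 := by
  suffices h : smulVec (posMat t u) (fun _ => (1 : R)) = fun _ => 1 by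
    simpa [smulVec] using congrFun h a
  induction u with
  | nil => rw [posMat_nil, smulVec_one]
  | cons i u ih =>
    rw [posMat_cons, smulVec_mul, ih]
    ext a
    rw [smulVec_gen]
    simp

theorem weightVec_lo (t : R) (i : Fin (n - 1)) :
    weightVec n t (lo i) = t * weightVec n t (hi i) := by
  simp only [weightVec, lo, hi]
  rw [← pow_succ']
  congr 1
  omega

theorem weightVec_gen (t : R) (i : Fin (n - 1)) (b : Fin n) :
    ∑ a, weightVec n t a * gen t i a b = weightVec n t b := by
  have hne := lo_ne_hi i
  by_cases h1 : b = lo i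
  · subst h1
    rw [Finset.sum_eq_single (hi i)]
    · simp [gen, hne.symm, weightVec_lo, mul_comm]
    · intro a _ ha
      by_cases h : a = lo i <;> simp [gen, ha, h, hne]
    · simp
  by_cases h2 : b = hi i
  · subst h2
    rw [Finset.sum_eq_add (lo i) (hi i) hne]
    · simp [gen, hne.symm, weightVec_lo]
      ring
    · rintro a _ ⟨h, h'⟩
      simp [gen, h, h']
    · simp
    · simp
  · rw [Finset.sum_eq_single b]
    · simp [gen, h1, h2]
    · intro a _ ha
      simp [gen, h1, h2, ha]
    · simp

theorem weightVec_posMat (t : R) (u : List (Fin (n - 1))) (b : Fin n) :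
    ∑ a, weightVec n t a * posMat t u a b = weightVec n t b := by
  induction u with
  | nil => simp [posMat_nil, Matrix.one_apply]
  | cons i u ih =>
    simp only [posMat_cons, Matrix.mul_apply, Finset.mul_sum, ← mul_assoc]
    rw [Finset.sum_comm]
    simp only [← Finset.sum_mul, weightVec_gen, ih]

/-- A partial pass, starting at strand `m`: entry `m` receives the last one, and the later entries
are shifted by one place and mixed with it. The tail `drop m` permits induction from the right end.
-/
theorem smulVec_drop (t : R) (Y : ℕ → R) {m : ℕ} (hm : m ≤ n - 1) (a : Fin n) :
    smulVec ((List.ofFn (gen t : Fin (n - 1) → Matrix (Fin n) (Fin n) R)).drop m).prod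
      (fun i => Y i) a = if (a : ℕ) < m then Y a else if (a : ℕ) = m then Y (n - 1) else
        t * Y (a - 1) + (1 - t) * Y (n - 1) := by
  induction hm using Nat.decreasingInduction generalizing a with
  | self =>
    rw [List.drop_of_length_le (by simp), List.prod_nil, smulVec_one]
    split_ifs with h1 h2
    · rfl
    · rw [h2]
    · omega
  | of_succ m hm ih =>
    rw [List.drop_eq_getElem_cons (by simpa using hm), List.prod_cons, smulVec_mul, List.getElem_ofFn,
      smulVec_gen, ih, ih, ih]
    have e1 : ((lo ⟨m, hm⟩ : Fin n) : ℕ) = m := rfl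
    have e2 : ((hi ⟨m, hm⟩ : Fin n) : ℕ) = m + 1 := rfl
    simp only [Fin.ext_iff, e1, e2, smul_eq_mul]
    split_ifs <;> first | omega | rfl | skip
    all_goals simp_all

/-- Each pass is a cyclic shift times `t` plus `1 - t` times the current last entry; the entry that
comes around obeys the same formula because `t + (1 - t) = 1`. -/
theorem smulVec_pow (t : R) (Y : ℕ → R) {k : ℕ} (hk : k ≤ n) (a : Fin n) :
    smulVec ((List.ofFn (gen t : Fin (n - 1) → Matrix (Fin n) (Fin n) R)).prod ^ k)
      (fun i => Y i) a = t ^ k * Y ((a + (n - k)) % n) +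
        (1 - t) * ∑ j ∈ Finset.range k, t ^ j * Y (n - 1 - j) := by
  induction k generalizing a with
  | zero => simp [smulVec_one, Nat.mod_eq_of_lt a.2]
  | succ k ih =>
    have hn : 0 < n := by omega
    have h0 := smulVec_drop t (fun a => t ^ k * Y ((a + (n - k)) % n) +
        (1 - t) * ∑ j ∈ Finset.range k, t ^ j * Y (n - 1 - j)) (Nat.zero_le (n - 1)) a
    rw [List.drop_zero] at h0
    rw [pow_succ', smulVec_mul, funext (ih (by omega)), h0]
    have h1 : (n - 1 + (n - k)) % n = n - 1 - k := by
      rw [show n - 1 + (n - k) = n + (n - 1 - k) by omega, Nat.add_mod_left,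
        Nat.mod_eq_of_lt (by omega)]
    rw [if_neg (by omega), Finset.sum_range_succ, h1]
    split_ifs with ha
    · rw [ha, zero_add, Nat.mod_eq_of_lt (by omega), show n - (k + 1) = n - 1 - k by omega]
      ring
    · rw [show (a : ℕ) - 1 + (n - k) = a + (n - (k + 1)) by omega]
      ring

/-- After `n` passes the shift is the identity, and the accumulated sum is the pairing with
`weightVec`: a scalar plus a rank one matrix. -/
theorem fullTwist_apply (t : R) (a b : Fin n) :
    ((List.ofFn (gen t : Fin (n - 1) → Matrix (Fin n) (Fin n) R)).prod ^ n) a b =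
      t ^ n * (1 : Matrix (Fin n) (Fin n) R) a b + (1 - t) * weightVec n t b := by
  have h := smulVec_pow t (fun k => if k = (b : ℕ) then 1 else 0) le_rfl a
  have h1 : (fun i : Fin n => if (i : ℕ) = (b : ℕ) then (1 : R) else 0) = Pi.single b 1 := by
    ext i
    simp [Pi.single_apply, Fin.ext_iff]
  rw [h1] at h
  have h2 : smulVec ((List.ofFn (gen t : Fin (n - 1) → Matrix (Fin n) (Fin n) R)).prod ^ n)
      (Pi.single b 1) a =
      ((List.ofFn (gen t : Fin (n - 1) → Matrix (Fin n) (Fin n) R)).prod ^ n) a b := by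
    simp [smulVec, Pi.single_apply]
  rw [← h2, h, Nat.sub_self, add_zero, Nat.mod_eq_of_lt a.2]
  congr 2
  · simp [Matrix.one_apply, Fin.ext_iff]
  · rw [Finset.sum_eq_single (n - 1 - (b : ℕ))]
    · rw [if_pos (by omega), mul_one, weightVec]
    · intro j hj hjb
      rw [Finset.mem_range] at hj
      rw [if_neg (by omega), mul_zero]
    · intro h
      rw [Finset.mem_range] at h
      omega

/-- The matrix of the full twist followed by a positive braid. -/
theorem fullTwist_mul_apply (t : R) (u : List (Fin (n - 1))) (a b : Fin n) :
    ((List.ofFn (gen t : Fin (n - 1) → Matrix (Fin n) (Fin n) R)).prod ^ n * posMat t u) a b =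
      t ^ n * posMat t u a b + (1 - t) * weightVec n t b := by
  rw [Matrix.mul_apply]
  simp only [fullTwist_apply, add_mul, Finset.sum_add_distrib, mul_assoc, ← Finset.mul_sum,
    weightVec_posMat]
  simp [Matrix.one_apply]

theorem exists_posMat {β : BraidGroup n} (h : β.IsTwistPositive) :
    ∃ u : List (Fin (n - 1)), (hom n β).1 = Matrix.map
      ((List.ofFn (gen (X : ℤ[X]) : Fin (n - 1) → Matrix (Fin n) (Fin n) ℤ[X])).prod ^ n *
        posMat X u) toLaurent := by
  obtain ⟨γ, hγ, rfl⟩ := h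
  have hgen (i : Fin (n - 1)) :
      (hom n (BraidGroup.sigma i)).1 = (toLaurent (R := ℤ)).mapMatrix (gen X i) := by
    rw [hom_sigma, RingHom.mapMatrix_apply, map_gen, toLaurent_X]
  have h1 : ∃ u : List (Fin (n - 1)), (hom n γ).1 = (toLaurent (R := ℤ)).mapMatrix (posMat X u) := by
    induction hγ using Submonoid.closure_induction with
    | mem _ h =>
      obtain ⟨i, rfl⟩ := h
      exact ⟨[i], by rw [hgen]; simp [posMat]⟩
    | one => exact ⟨[], by simp [posMat]⟩
    | mul x y _ _ hx hy =>
      obtain ⟨u, hu⟩ := hx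
      obtain ⟨v, hv⟩ := hy
      exact ⟨u ++ v, by rw [map_mul, Units.val_mul, hu, hv, ← map_mul]; simp [posMat]⟩
  obtain ⟨u, hu⟩ := h1
  refine ⟨u, ?_⟩
  rw [map_mul, Units.val_mul, hu, ← RingHom.mapMatrix_apply, map_mul, map_pow]
  congr 1
  rw [BraidGroup.fullTwist, map_pow, Units.val_pow_eq_pow_val]
  congr 1
  rw [map_list_prod, map_list_prod, List.map_ofFn, List.map_ofFn, ← Units.coeHom_apply,
    map_list_prod, List.map_ofFn]
  congr 2
  ext i : 1
  exact hgen i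

end Burau

end

noncomputable section

/-! ## The Alexander polynomial of a twist positive knot -/

namespace Burau

section

variable {R : Type*} [CommRing R] {n : ℕ}

theorem posMat_append (t : R) (u v : List (Fin (n - 1))) :
    posMat t (u ++ v) = posMat t u * posMat t v := by simp [posMat]

/-- A positive word for the full twist followed by a positive braid. -/
def twistWord (n : ℕ) (u : List (Fin (n - 1))) : List (Fin (n - 1)) :=
  (List.replicate n (List.finRange (n - 1))).flatten ++ u

theorem posMat_twistWord (t : R) (u : List (Fin (n - 1))) :
    posMat t (twistWord n u) =
      (List.ofFn (gen t : Fin (n - 1) → Matrix (Fin n) (Fin n) R)).prod ^ n * posMat t u := by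
  rw [twistWord, posMat_append]
  congr 1
  generalize hk : (List.ofFn (gen t : Fin (n - 1) → Matrix (Fin n) (Fin n) R)).prod = A
  have hA : posMat t (List.finRange (n - 1)) = A := by
    rw [← hk, List.ofFn_eq_map]; rfl
  have key (k : ℕ) : posMat t (List.replicate k (List.finRange (n - 1))).flatten = A ^ k := by
    induction k with
    | zero => rfl
    | succ k ih => rw [List.replicate_succ, List.flatten_cons, posMat_append, ih, hA, pow_succ']
  exact key n

/-- At `t = 0` a generator sends both of its strands to the right one. Products are thus matrices of
maps that never move a strand to the left, and a strand moved once never returns. -/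
theorem posMat_zero (u : List (Fin (n - 1))) : ∃ φ : Fin n → Fin n,
    (∀ a b, posMat (0 : R) u a b = if φ a = b then 1 else 0) ∧ (∀ a, a ≤ φ a) ∧
      ∀ i ∈ u, lo i < φ (lo i) := by
  induction u with
  | nil => exact ⟨id, fun a b => by simp [posMat_nil, Matrix.one_apply], fun a => le_rfl, by simp⟩
  | cons i u ih =>
    obtain ⟨φ, h1, h2, h3⟩ := ih
    have hlt : lo i < hi i := by simp [lo, hi, Fin.lt_def]
    refine ⟨fun a => φ (if a = lo i then hi i else a), fun a b => ?_, fun a => ?_, fun j hj => ?_⟩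
    · have h4 := smulVec_gen (0 : R) i (fun c => posMat (0 : R) u c b) a
      rw [posMat_cons, Matrix.mul_apply]
      refine h4.trans ?_
      simp only [h1]
      split_ifs <;> simp_all
    · dsimp only
      split_ifs with h
      · rw [h]; exact hlt.le.trans (h2 _)
      · exact h2 a
    · dsimp only
      by_cases hji : j = i
      · subst hji
        rw [if_pos rfl]
        exact hlt.trans_le (h2 _)
      · rw [if_neg fun h => hji (by simpa [lo, Fin.ext_iff] using h)]
        exact h3 j ((List.mem_cons.1 hj).resolve_left hji)

theorem smulVec_gen_one (i : Fin (n - 1)) (y : Fin n → R) (a : Fin n) :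
    smulVec (gen (1 : R) i) y a = y (Equiv.swap (lo i) (hi i) a) := by
  rw [smulVec_gen, Equiv.swap_apply_def]
  split_ifs <;> simp

theorem posMat_one (u : List (Fin (n - 1))) : ∃ π : Equiv.Perm (Fin n),
    ∀ (y : Fin n → R) a, smulVec (posMat (1 : R) u) y a = y (π a) := by
  induction u with
  | nil => exact ⟨1, fun y a => by rw [posMat_nil, smulVec_one]; rfl⟩
  | cons i u ih =>
    obtain ⟨π, h⟩ := ih
    refine ⟨π * Equiv.swap (lo i) (hi i), fun y a => ?_⟩
    rw [posMat_cons, smulVec_mul, smulVec_gen_one, h]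
    rfl

/-- Without the generator `p` the permutation cannot carry a strand across the gap to the right of
`lo p`. -/
theorem smulVec_indicator (u : List (Fin (n - 1))) (p : Fin (n - 1)) (hp : p ∉ u) :
    smulVec (posMat (1 : R) u) (fun a => if a ≤ lo p then (1 : R) else 0) =
      fun a => if a ≤ lo p then (1 : R) else 0 := by
  induction u with
  | nil => rw [posMat_nil, smulVec_one]
  | cons i u ih =>
    rw [posMat_cons, smulVec_mul, ih fun h => hp (List.mem_cons_of_mem _ h)]
    ext a
    have hpi : (p : ℕ) ≠ i := fun h => hp (by rw [Fin.ext h]; simp)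
    rw [smulVec_gen_one, Equiv.swap_apply_def]
    simp only [lo, hi, Fin.le_def, Fin.ext_iff]
    split_ifs <;> first | rfl | (exfalso; simp_all; try omega)

end

theorem sum_X_pow (m : ℕ) :
    (1 - X) * ∑ b ∈ Finset.range m, (X : ℤ[X]) ^ (m - b) = X - X ^ (m + 1) := by
  induction m with
  | zero => simp
  | succ m ih =>
    rw [Finset.sum_range_succ', mul_add]
    simp only [Nat.add_sub_add_right, ih, Nat.sub_zero]
    ring

/-- Working modulo `X ^ (m + 2)`, the matrix factors into the rank one part and a unipotent matrix.
-/
theorem det_submatrix {m : ℕ} (u : List (Fin (m + 1 - 1)))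
    (hu : ∀ p, p ∈ u) : ∃ Q : ℤ[X],
      ((1 - posMat (X : ℤ[X]) (twistWord (m + 1) u)).submatrix Fin.castSucc Fin.castSucc).det =
        1 - X + X ^ (m + 1) + X ^ (m + 1 + 1) * Q := by
  set q := Ideal.Quotient.mk (Ideal.span {(X : ℤ[X]) ^ (m + 1 + 1)})
  suffices h : q ((1 - posMat (X : ℤ[X]) (twistWord (m + 1) u)).submatrix
      Fin.castSucc Fin.castSucc).det = q (1 - X + X ^ (m + 1)) by
    rw [Ideal.Quotient.eq, Ideal.mem_span_singleton] at h
    obtain ⟨Q, hQ⟩ := h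
    exact ⟨Q, by rw [← hQ]; ring⟩
  let w : Fin m → ℤ[X] := fun b => X ^ (m - (b : ℕ))
  -- The part of `1 - B` without `X ^ (m + 1) • G`. Being the identity plus a rank one matrix, it
  -- has the determinant 1 plus a scalar product.
  let A : Matrix (Fin m) (Fin m) ℤ[X] :=
    1 + Matrix.replicateCol Unit (fun _ => -(1 - X : ℤ[X])) * Matrix.replicateRow Unit w
  let G : Matrix (Fin m) (Fin m) ℤ[X] := (posMat X u).submatrix Fin.castSucc Fin.castSucc
  let G₀ : Matrix (Fin m) (Fin m) ℤ[X] := (posMat 0 u).submatrix Fin.castSucc Fin.castSucc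
  have hAdet : A.det = 1 - X + X ^ (m + 1) := by
    rw [Matrix.det_one_add_replicateCol_mul_replicateRow, dotProduct, ← Finset.sum_mul]
    have := sum_X_pow m
    rw [← Fin.sum_univ_eq_sum_range fun b => (X : ℤ[X]) ^ (m - b)] at this
    linear_combination -this
  have hAapp : ∀ a b, A a b = (1 : Matrix (Fin m) (Fin m) ℤ[X]) a b - (1 - X) * w b := by
    intro a b
    simp [A, Matrix.mul_apply]
    ring
  have hD : (1 - posMat (X : ℤ[X]) (twistWord (m + 1) u)).submatrix Fin.castSucc Fin.castSucc =
      A - (X : ℤ[X]) ^ (m + 1) • G := by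
    ext1 a b
    rw [posMat_twistWord, Matrix.submatrix_apply, Matrix.sub_apply, fullTwist_mul_apply,
      Matrix.sub_apply, hAapp]
    simp only [Matrix.smul_apply, smul_eq_mul, G, Matrix.submatrix_apply, w, weightVec,
      Matrix.one_apply, Fin.castSucc_inj, Fin.val_castSucc, Nat.add_sub_cancel]
    ring
  -- Every strand but the deleted last one is moved strictly to the right, because every generator
  -- occurs in `u`.
  have hG₀ : (1 - (X : ℤ[X]) ^ (m + 1) • G₀).det = 1 := by
    refine Matrix.det_one_sub_eq_one (fun a : Fin m => m - (a : ℕ)) _ fun a b hab => ?_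
    obtain ⟨φ, h1, -, h3⟩ := posMat_zero (R := ℤ[X]) u
    have h4 : φ a.castSucc = b.castSucc := by
      by_contra h
      exact hab (by simp [G₀, h1, h])
    have h5 := h3 ⟨a, by simp⟩ (hu _)
    have h6 : (a : ℕ) < b := by
      rw [show lo (⟨a, by simp⟩ : Fin (m + 1 - 1)) = a.castSucc from rfl, h4] at h5
      exact h5
    have := b.2
    omega
  -- At `X = 0` the matrix `A` becomes the identity, since `m - b` is positive, and `G` becomes
  -- `G₀`.
  have hdvd : ∀ a b, (X : ℤ[X]) ∣ (A * G₀ - G) a b := by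
    intro a b
    rw [X_dvd_iff, coeff_zero_eq_eval_zero, ← coe_evalRingHom, ← Matrix.map_apply (f := evalRingHom 0),
      ← RingHom.mapMatrix_apply, map_sub, map_mul]
    have hA0 : (evalRingHom (0 : ℤ)).mapMatrix A = 1 := by
      ext a b
      have : m - (b : ℕ) ≠ 0 := by have := b.2; omega
      rw [RingHom.mapMatrix_apply, Matrix.map_apply, hAapp]
      by_cases hab : a = b <;> simp [w, this, Matrix.one_apply, hab]
    have hG : (evalRingHom (0 : ℤ)).mapMatrix G₀ = (evalRingHom (0 : ℤ)).mapMatrix G := by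
      simp only [RingHom.mapMatrix_apply, G, G₀, ← Matrix.submatrix_map, map_posMat]
      simp
    rw [hA0, hG, one_mul, sub_self, Matrix.zero_apply]
  -- The two sides differ by `X ^ (m + 1) • (A * G₀ - G)`.
  have hq : q.mapMatrix (A - (X : ℤ[X]) ^ (m + 1) • G) =
      q.mapMatrix (A * (1 - (X : ℤ[X]) ^ (m + 1) • G₀)) := by
    ext1 a b
    simp only [RingHom.mapMatrix_apply, Matrix.map_apply]
    rw [Ideal.Quotient.eq, Ideal.mem_span_singleton, ← Matrix.sub_apply]
    obtain ⟨c, hc⟩ := hdvd a b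
    refine ⟨c, ?_⟩
    rw [mul_sub, mul_one, Matrix.mul_smul, sub_sub_sub_cancel_left, ← smul_sub, Matrix.smul_apply,
      hc, smul_eq_mul]
    ring
  rw [hD, RingHom.map_det, hq, ← RingHom.map_det, Matrix.det_mul, hAdet, hG₀, mul_one]

theorem eval_posMat_twistWord {n : ℕ} (u : List (Fin (n - 1))) (a b : Fin n) :
    (posMat (X : ℤ[X]) (twistWord n u) a b).eval 1 = posMat (1 : ℤ) u a b := by
  have h := congrFun (congrFun (map_posMat (evalRingHom (1 : ℤ)) X (twistWord n u)) a) b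
  rw [Matrix.map_apply, coe_evalRingHom, eval_X, posMat_twistWord (1 : ℤ), fullTwist_mul_apply,
    sub_self, zero_mul, add_zero, one_pow, one_mul] at h
  exact h

/-- At 1 the full twist disappears and a permutation matrix remains. By `H` the permutation has a
single cycle, and cutting this cycle at the last strand leaves a nilpotent matrix. -/
theorem eval_det_submatrix {m : ℕ} (u : List (Fin (m + 1 - 1)))
    (H : ∀ x : Fin (m + 1) → ℤ, smulVec (posMat (1 : ℤ) u) x = x → ∀ a b, x a = x b) :
    (((1 - posMat (X : ℤ[X]) (twistWord (m + 1) u)).submatrix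
      Fin.castSucc Fin.castSucc).det).eval 1 = 1 := by
  obtain ⟨π, hπ⟩ := posMat_one (R := ℤ) u
  have hent : ∀ a b, posMat (1 : ℤ) u a b = if π a = b then 1 else 0 := by
    intro a b
    have := hπ (Pi.single b 1) a
    simpa [smulVec, Pi.single_apply] using this
  have hmap : (evalRingHom (1 : ℤ)).mapMatrix ((1 - posMat (X : ℤ[X])
      (twistWord (m + 1) u)).submatrix Fin.castSucc Fin.castSucc) =
      1 - (posMat (1 : ℤ) u).submatrix Fin.castSucc Fin.castSucc := by
    ext a b
    simp only [RingHom.mapMatrix_apply, Matrix.map_apply, Matrix.submatrix_apply, Matrix.sub_apply,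
      map_sub]
    rw [coe_evalRingHom, eval_posMat_twistWord]
    simp [Matrix.one_apply, apply_ite]
  rw [← coe_evalRingHom, RingHom.map_det, hmap]
  have hex : ∀ a, ∃ k : ℕ, (π ^ k) a = Fin.last m := by
    classical
    intro a
    have h1 := H (fun a => if π.SameCycle a (Fin.last m) then 1 else 0) (by
      ext b
      simp only [hπ, Equiv.Perm.sameCycle_apply_left]) a (Fin.last m)
    have h2 : π.SameCycle a (Fin.last m) := by
      by_contra h
      simp only [h, if_false, if_pos (Equiv.Perm.SameCycle.refl π (Fin.last m))] at h1
      exact zero_ne_one h1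
    obtain ⟨k, -, hk⟩ := h2.exists_pow_eq'
    exact ⟨k, hk⟩
  -- The height of a strand is the number of steps it needs to reach the last one; a step along the
  -- cycle lowers it.
  refine Matrix.det_one_sub_eq_one (fun a => Nat.find (hex a.castSucc)) _ fun a b hab => ?_
  have hab : π a.castSucc = b.castSucc := by
    by_contra h
    exact hab (by simp [hent, h])
  have hk := Nat.find_spec (hex a.castSucc)
  rcases hf : Nat.find (hex a.castSucc) with _ | j
  · rw [hf, pow_zero] at hk
    exact absurd hk (Fin.castSucc_lt_last a).ne
  · rw [hf, pow_succ, Equiv.Perm.mul_apply, hab] at hk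
    exact (Nat.find_min' _ hk).trans_lt (Nat.lt_succ_self j)

end Burau

end

/-! ### Augmentation, and the proof of the theorem -/

noncomputable section

/-- The integers, with `t` acting as the identity. -/
def AugInt : Type := ℤ

namespace AugInt

instance : CommRing AugInt := inferInstanceAs (CommRing ℤ)

instance : Nontrivial AugInt := inferInstanceAs (Nontrivial ℤ)

/-- The augmentation. -/
def aug : ℤ[T;T⁻¹] →+* AugInt := LaurentPolynomial.eval₂ (Int.castRingHom AugInt) 1

instance : Module ℤ[T;T⁻¹] AugInt := Module.compHom AugInt aug

theorem smul_def (r : ℤ[T;T⁻¹]) (z : AugInt) : r • z = aug r * z := rfl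

theorem aug_T (k : ℤ) : aug (T k) = 1 := by simp [aug]

theorem aug_toLaurent (p : ℤ[X]) : aug (toLaurent p) = (p.eval 1 : ℤ) := by
  rw [aug, LaurentPolynomial.eval₂_toLaurent]
  exact (Polynomial.hom_eval₂ p (RingHom.id ℤ) (Int.castRingHom AugInt) 1).symm.trans rfl

/-- At `t = 1` an arc keeps its colour at an underpass, so integral colourings are constant along
components. They transport the number of components to other presentations of the module. -/
theorem under_eq (s : Bool) (o u : AugInt) : Marked.under s o u = u := by
  simp [Marked.under, smul_def, aug_T]

end AugInt

namespace LinkDiagram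

/-- The homomorphisms from the Alexander module of a knot to the integers are the multiples of one
of them. -/
theorem IsKnot.exists_aug {K : LinkDiagram} (hK : K.IsKnot) :
    ∃ ε : K.marked.M →ₗ[ℤ[T;T⁻¹]] AugInt, ε ≠ 0 ∧
      ∀ f : K.marked.M →ₗ[ℤ[T;T⁻¹]] AugInt, ∃ v : AugInt, ∀ z, f z = v * ε z := by
  obtain ⟨c, h⟩ := K.exists_presents
  -- `ε` corresponds to the colouring of all arcs by 1.
  obtain ⟨ε, hε⟩ := h.lift AugInt (fun _ => 1) fun ρ _ => by
    cases ρ with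
    | crossing o l r => exact (Marked.under_self _ _).symm
    | join a b => rfl
  refine ⟨ε, fun h0 => ?_, fun f => ?_⟩
  · have := hε 0 hK.1
    rw [h0] at this
    exact zero_ne_one this
  · have hcons : ∀ a b, K.Consecutive a b → f (c a) = f (c b) := by
      rintro a b (⟨o, hab⟩ | hab)
      · have h1 : f (c b) = _ := (h.sat _ hab).map f
        rw [h1, AugInt.under_eq]
      · exact (h.sat _ hab).map f
    have heq : ∀ a b, Relation.EqvGen K.Consecutive a b → f (c a) = f (c b) := by
      intro a b hab
      induction hab with
      | rel a b h => exact hcons a b h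
      | refl a => rfl
      | symm a b _ h => exact h.symm
      | trans a b d _ _ h h' => exact h.trans h'
    refine ⟨f (c 0), fun z => ?_⟩
    have hz : z ∈ Submodule.span ℤ[T;T⁻¹] (c '' {j | j < K.scan.arcs}) := by rw [h.gen]; trivial
    induction hz using Submodule.span_induction with
    | mem _ hx =>
      obtain ⟨j, hj, rfl⟩ := hx
      rw [hε j hj, mul_one, heq j 0 (hK.2 j hj 0 hK.1)]
    | zero => simp
    | add x y _ _ hx hy => rw [map_add, map_add, hx, hy, mul_add]
    | smul r x _ hx =>
      rw [map_smul, map_smul, hx, AugInt.smul_def, AugInt.smul_def, mul_left_comm]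

/-- A knot with a presentation of its Alexander module: colourings by integers are constant. -/
theorem IsKnot.constant {K : LinkDiagram} (hK : K.IsKnot) {n : ℕ}
    (π : (Fin n → ℤ[T;T⁻¹]) →ₗ[ℤ[T;T⁻¹]] K.marked.M) (hπ : Function.Surjective π)
    {C : Matrix (Fin n) (Fin n) ℤ[T;T⁻¹]}
    (hker : LinearMap.ker π = Submodule.span ℤ[T;T⁻¹] (Set.range (1 - C).row))
    (hC : ∀ i, ∑ j, C i j = 1) :
    0 < n ∧ ∀ x : Fin n → AugInt, (∀ i, ∑ j, C i j • x j = x i) → ∀ a b, x a = x b := by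
  obtain ⟨ε, hε, hf⟩ := hK.exists_aug
  have key : ∀ x : Fin n → AugInt, (∀ i, ∑ j, C i j • x j = x i) →
      ∃ v, ∀ a, x a = v * ε (π (Pi.single a 1)) := by
    intro x hx
    let F := Fintype.linearCombination ℤ[T;T⁻¹] x
    have hF : LinearMap.ker π ≤ LinearMap.ker F := by
      rw [hker, Submodule.span_le]
      rintro _ ⟨i, rfl⟩
      simp only [SetLike.mem_coe, LinearMap.mem_ker, F, Fintype.linearCombination_apply,
        Matrix.row_apply, Matrix.sub_apply, sub_smul, Finset.sum_sub_distrib, hx i]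
      simp [Matrix.one_apply, ite_smul]
    let f := (Submodule.liftQ _ F hF) ∘ₗ (π.quotKerEquivOfSurjective hπ).symm.toLinearMap
    obtain ⟨v, hv⟩ := hf f
    refine ⟨v, fun a => ?_⟩
    rw [← hv]
    have h1 : (π.quotKerEquivOfSurjective hπ).symm (π (Pi.single a 1)) =
        Submodule.Quotient.mk (Pi.single a 1) := by
      rw [LinearEquiv.symm_apply_eq]; rfl
    simp only [f, LinearMap.comp_apply, LinearEquiv.coe_coe, h1, Submodule.liftQ_apply]
    simp [F, Fintype.linearCombination_apply_single]
  constructor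
  -- On no generators the module would be zero, which contradicts `ε ≠ 0`.
  · rw [Nat.pos_iff_ne_zero]
    rintro rfl
    refine hε (LinearMap.ext fun z => ?_)
    obtain ⟨v, rfl⟩ := hπ z
    rw [show v = 0 from Subsingleton.elim _ _, map_zero, map_zero, map_zero]
  · intro x hx a b
    obtain ⟨v, hv⟩ := key x hx
    obtain ⟨v₁, hv₁⟩ := key (fun _ => 1) fun i => by rw [← Finset.sum_smul, hC, one_smul]
    rw [hv a, hv b]
    have ha := hv₁ a
    have hb := hv₁ b
    -- The constant colouring gives `v₁ * ε_a = 1 = v₁ * ε_b` for the values of `ε` on two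
    -- generators, and this forces `ε_a = ε_b`.
    linear_combination v * ε (π (Pi.single a 1)) * hb - v * ε (π (Pi.single b 1)) * ha

/-- The Alexander polynomial of a twist positive knot. -/
theorem exists_isAlexanderPolynomial {n : ℕ} {K : LinkDiagram} (hK : K.IsKnot)
    (hn : K.IsTwistPositive n) :
    ∃ R : ℤ[X], K.IsAlexanderPolynomial (1 - X + X ^ n + X ^ (n + 1) * R) := by
  obtain ⟨β, hβ, w, rfl, hiso⟩ := hn
  obtain ⟨u, hu⟩ := Burau.exists_posMat hβ
  rw [← Burau.posMat_twistWord] at hu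
  obtain ⟨π₀, hπ₀, hker₀⟩ := Burau.exists_surjective n w
  obtain ⟨e, -⟩ := (iso_marked_of_isotopic hiso).symm
  let π : (Fin n → ℤ[T;T⁻¹]) →ₗ[ℤ[T;T⁻¹]] K.marked.M := e.toLinearMap ∘ₗ π₀
  have hπ : Function.Surjective π := by
    rw [LinearMap.coe_comp]; exact e.surjective.comp hπ₀
  have hker : LinearMap.ker π = Submodule.span ℤ[T;T⁻¹] (Set.range
      (1 - (Burau.posMat X (Burau.twistWord n u)).map (toLaurent (R := ℤ))).row) := by
    rw [LinearEquiv.ker_comp, hker₀, hu]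
  have hC : (Burau.posMat X (Burau.twistWord n u)).map (toLaurent (R := ℤ)) =
      Burau.posMat (T 1) (Burau.twistWord n u) := by
    rw [Burau.map_posMat, toLaurent_X]
  obtain ⟨hpos, hconst⟩ := hK.constant π hπ hker fun i => by
    rw [hC]; exact Burau.posMat_sum_row _ _ i
  obtain ⟨m, rfl⟩ : ∃ m, n = m + 1 := ⟨n - 1, by omega⟩
  -- Vectors fixed by the permutation are integral colourings of the closed braid, hence constant
  -- because `K` is a knot.
  have H : ∀ x : Fin (m + 1) → ℤ, Burau.smulVec (Burau.posMat (1 : ℤ) u) x = x →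
      ∀ a b, x a = x b := by
    intro x hx
    let x' : Fin (m + 1) → AugInt := x
    refine hconst x' fun i => ?_
    refine (Finset.sum_congr rfl fun j _ => ?_).trans (congrFun hx i)
    have h1 : AugInt.aug ((Burau.posMat X (Burau.twistWord (m + 1) u)).map toLaurent i j) =
        (Burau.posMat (1 : ℤ) u i j : ℤ) := by
      rw [Matrix.map_apply, AugInt.aug_toLaurent, Burau.eval_posMat_twistWord]
    exact congrArg (· * x' j) h1
  -- A missing generator would produce a fixed indicator vector that is not constant.
  have hmem : ∀ p, p ∈ u := by
    intro p
    by_contra hp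
    have := H _ (Burau.smulVec_indicator u p hp) (Burau.lo p) (Burau.hi p)
    simp [Burau.lo, Burau.hi, Fin.le_def] at this
  obtain ⟨Q, hQ⟩ := Burau.det_submatrix u hmem
  have heval := Burau.eval_det_submatrix u H
  rw [hQ] at heval
  refine ⟨Q, ?_, ?_, heval⟩
  · obtain ⟨c, h⟩ := K.exists_presents
    -- The Wirtinger presentation of `K` is replaced by the Burau presentation of the same module.
    -- In the latter, rows and weighted columns of `1 - B` sum to zero, so one minor generates the
    -- ideal.
    rw [K.alexanderIdeal_eq h, Submodule.minorIdeal_eq_of_surjective hK.1 hpos _ h.surjective π hπ,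
      hker, Nat.add_sub_cancel, Matrix.minorIdeal_eq_span_det _ ?_
        (Burau.weightVec (m + 1) (T 1)) ?_ ?_, ← hQ, RingHom.map_det]
    · congr 3
      ext a b
      simp [Matrix.one_apply, apply_ite]
    · intro i
      rw [hC]
      simp [Finset.sum_sub_distrib, Burau.posMat_sum_row, Matrix.one_apply]
    · simp [Burau.weightVec]
    · intro j
      rw [hC]
      simp [Finset.sum_sub_distrib, mul_sub, Burau.weightVec_posMat, Matrix.one_apply]
  · rcases Nat.eq_zero_or_pos m with rfl | hm
    · simp [coeff_X, pow_succ, mul_assoc]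
    · simp [coeff_X, pow_succ, mul_assoc]

end LinkDiagram

end

theorem mainTheorem1 (n : ℕ) (K : LinkDiagram) (hK : K.IsKnot) (hn : K.IsTwistPositive n) :
    ∃ R : ℤ[X],
      K.IsAlexanderPolynomial (1 - X + X ^ n + X ^ (n + 1) * R) ∧
      (2 ≤ n → (1 - X + X ^ n + X ^ (n + 1) * R).coeff K.braidIndex ≠ 0) := by
  obtain ⟨R, hR⟩ := LinkDiagram.exists_isAlexanderPolynomial hK hn
  refine ⟨R, hR, fun h => ?_⟩
  -- For `2 ≤ n` only the summand `X ^ n` contributes in degree `n`.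
  rw [LinkDiagram.braidIndex_eq_of_isTwistPositive hn]
  have h1 : (X ^ (n + 1) * R).coeff n = 0 := by
    rw [coeff_X_pow_mul', if_neg (by omega)]
  have h2 : (1 : ℤ[X]).coeff n = 0 := by rw [coeff_one, if_neg (by omega)]
  have h3 : (X : ℤ[X]).coeff n = 0 := by rw [coeff_X, if_neg (by omega)]
  simp [h1, h2, h3]
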